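/- **Theorem 7.3 (globally strict convexity).** *Grid and spaces.* Let $b,d>0$, $-\xi<d$, $\Omega=\{|x|,|y|<b,\ -\xi<z<d\}$, $\Gamma=\{|x|,|y|<b,\ z=-\xi\}$, and let $x_j=-b+jh$, $y_s=-b+sh$ $(0\le j,s\le n+1)$, $h=2b/(n+1)$, be a uniform grid. Nodes with $1\le j,s\le n$ are called interior, the others lateral. Let $[\underline k,\overline k]\subset(0,\infty)$, $\underline k<\overline k$. For complex-valued semidiscrete functions put $$\|f\|_{H^{m,h}}^2=\sum_{j,s}\sum_{r=0}^m h^2\int_{-\xi}^d|\partial_z^r f(x_j,y_s,z)|^2dz,\qquad \|f\|_{H_m^h}^2=\int_{\underline k}^{\overline k}\|f(\cdot,k)\|_{H^{m,h}}^2\,dk ,$$ and let $H^{m,h}$, $H_m^h$ be the corresponding real Hilbert spaces. $H_0^{2,h}\subset H^{2,h}$ and $H_{0,2}^h\subset H_2^h$ are the subspaces of the $f$ with $f|_{\partial\Omega}=0$, $f_z|_\Gamma=0$ (for a.e. $k$ in the second case), boundary values being taken at the grid points. At interior nodes let $\Delta^hf=f_{zz}+f^h_{xx}+f^h_{yy}$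 with the standard three-point second differences, and $\nabla^hf=(\partial_x^hf,\partial_y^hf,f_z)$ with central differences. All sums $\sum_{j,s}$ below are over the interior nodes. *Carleman number.* There is $\lambda_0>1$, depending only on the grid, $\xi$ and $d$, and a constant $C>0$ such that for all $\lambda\ge\lambda_0$ and $u\in H_0^{2,h}$ $$\sum_{j,s} h^2\!\int_{-\xi}^d|\Delta^hu|^2e^{-2\lambda z}dz\ \ge\ C\sum_{j,s} h^2\!\int_{-\xi}^d\big(|u_{zz}|^2+\lambda|u_z|^2+\lambda^3|u|^2\big)e^{-2\lambda z}dz ,$$ and with this $\lambda_0$ the following holds. *Functional.* For $V\in H^{2,h}$, $F\in H_3^h$, and with $a\cdot b=\sum_c a_cb_c$ (no conjugation), let $$L^h(q)=\Delta^hq+2k\Big(\nabla^hV-\int_k^{\overline k}\nabla^hq\,d\kappa\Big)\cdot\Big(k\nabla^hq+\theta(k)\nabla^hV-\int_k^{\overline k}\nabla^hq\,d\kappa\Big)+2i\Big(kq_z+V_z-\int_k^{\overline k}q_z\,d\kappa\Big),$$ where either $\theta(k)\equiv1$ or $\theta(k)=k$ (the result holds for both), and $$J_\lambda(p)=e^{2\lambda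 d}\sum_{j,s}h^2\int_{\underline k}^{\overline k}\int_{-\xi}^d|L^h(p+F)(x_j,y_s,z,k)|^2e^{-2\lambda z}\,dz\,dk,\qquad p\in H_{0,2}^h .$$ *Statement.* For every $R>0$ there are $\lambda_1\ge\lambda_0$ and $C_1>0$, depending only on $\Omega_h$ (that is, $b,d,\xi,n$), $R$, $\|F_*\|_{H_3^h}$, $\|V_*\|_{H^{2,h}}$, $\underline k,\overline k$ (and the choice of $\theta$), such that the following holds whenever $0<\delta<e^{-2(d+\xi)\lambda_1}$ and 1. $Q,Q_*,V_*\in H^{2,h}$ vanish on $\partial\Omega\setminus\Gamma$ and have the Cauchy data $(\psi_0,\psi_1)$, $(\psi_{0*},\psi_{1*})$, $(\psi_{0*},\psi_{1*})$ on $\Gamma$ (the values of the function and of its $z$-derivative), $\Delta^hV_*=0$, and $\|Q-Q_*\|_{H^{2,h}}<\delta$; 2. $F,F_*\in H_3^h$ vanish on $\partial\Omega\setminus\Gamma$, have the Cauchy data $(\phi_0,\phi_1)$ and $(\phi_{0*},\phi_{1*})$ on $\Gamma$, and $\|F-F_*\|_{H_3^h}<\delta$. With $\mu(\delta)=\ln(\delta^{-1/(2(d+\xi))})$,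 the functional $I_{\mu(\delta)}(W)=e^{2\mu(\delta) d}\sum_{j,s}h^2\int_{-\xi}^d|\Delta^hW+\Delta^hQ|^2e^{-2\mu(\delta) z}dz$ has a unique minimizer $W$ on $H_0^{2,h}$; let $V=V_{\mu(\delta)}=W+Q$ be the tail function in $L^h$. Then: (a) for every $\lambda>0$, the integrals defining $J_\lambda$ converge, and $J_\lambda$ has a Fréchet derivative $J_\lambda'(p)\in H_{0,2}^h$ (identified through the scalar product of $H_2^h$) at every $p\in H_{0,2}^h$; (b) for every $\lambda\ge\lambda_1$, $J_\lambda$ is strictly convex on $\overline{B(R)}=\{p\in H_{0,2}^h:\|p\|_{H_2^h}\le R\}$, and more precisely $$J_\lambda(p+r)-J_\lambda(p)-J_\lambda'(p)(r)\ \ge\ C_1\|r\|_{H_2^h}^2\qquad\text{for all }p,\ p+r\in\overline{B(R)} .$$ -/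

import Mathlib

open MeasureTheory Set
open scoped Matrix

noncomputable section

namespace SemiDiscrete

/-- The box `{|x|, |y| < b, -ξ < z < d}` with a uniform grid in `(x, y)`: the grid lines are
`x_j = -b + j h`, `y_s = -b + s h` for `j, s = 0, …, n + 1`, with `h = 2 b / (n + 1)`. Thus there
are `n + 2` nodes in each direction, the indices `0` and `n + 1` being on the lateral boundary. -/
structure Box where
  n : ℕ
  b : ℝ
  d : ℝ
  ξ : ℝ
  b_pos : 0 < b
  d_pos : 0 < d
  lt : -ξ < d

/-- The grid step. -/
def Box.h (G : Box) : ℝ := 2 * G.b / (G.n + 1)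

/-- All nodes of one coordinate direction. -/
abbrev Box.Node (G : Box) : Type := Fin (G.n + 2)

/-- `Fin n` enumerates the interior nodes; `mid i` is the interior node itself, `lft i` and `rgt i`
are its two neighbours. -/
def Box.mid (G : Box) (i : Fin G.n) : G.Node := i.castSucc.succ

def Box.lft (G : Box) (i : Fin G.n) : G.Node := i.castSucc.castSucc

def Box.rgt (G : Box) (i : Fin G.n) : G.Node := i.succ.succ

/-- The node `(x_j, y_s)` lies on the boundary of the square. -/
def Box.Lateral (G : Box) (j s : G.Node) : Prop :=
  j = 0 ∨ j = Fin.last (G.n + 1) ∨ s = 0 ∨ s = Fin.last (G.n + 1)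

section Spaces

variable {K : Type} [MeasurableSpace K]

/-- The measure `dz dν(k)` on `(-ξ, d) × K`, for a parameter space `(K, ν)`. -/
def Box.dom (G : Box) (ν : Measure K) : Measure (ℝ × K) :=
  (volume.restrict (Ioo (-G.ξ) G.d)).prod ν

/-- The measure `h² dz dν(k)`. -/
def Box.wt (G : Box) (ν : Measure K) : Measure (ℝ × K) :=
  ENNReal.ofReal (G.h ^ 2) • G.dom ν

/-- For almost every parameter `k`, the function `u(·, k)` is (a.e. equal to) the absolutely
continuous function with derivative `v(·, k)` and with the value `g k` at `z = a`. -/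
def Box.TraceAt (G : Box) (ν : Measure K) (a : ℝ) (u v : ℝ × K → ℂ) (g : K → ℂ) : Prop :=
  ∀ᵐ x ∂(G.dom ν), u x = g x.2 + ∫ t in a..x.1, v (t, x.2)

/-- `v = ∂_z u`: for almost every `k`, `u(·, k)` is absolutely continuous with derivative
`v(·, k)`. -/
def Box.IsZDeriv (G : Box) (ν : Measure K) (u v : ℝ × K → ℂ) : Prop :=
  ∃ c : K → ℂ, G.TraceAt ν (-G.ξ) u v c

lemma Box.wt_ae {G : Box} {ν : Measure K} {p : ℝ × K → Prop} :
    (∀ᵐ x ∂(G.wt ν), p x) ↔ ∀ᵐ x ∂(G.dom ν), p x := by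
  have hh : 0 < G.h := by
    have := G.b_pos
    unfold Box.h
    positivity
  have h0 : ENNReal.ofReal (G.h ^ 2) ≠ 0 := by
    simpa using hh.ne'
  unfold Box.wt
  rw [ae_iff, ae_iff, Measure.smul_apply, smul_eq_mul, mul_eq_zero]
  simp [h0]

lemma Box.ae_param {G : Box} {ν : Measure K} [SFinite ν] {p : K → Prop} (h : ∀ᵐ k ∂ν, p k) :
    ∀ᵐ x ∂(G.dom ν), p x.2 :=
  Measure.quasiMeasurePreserving_snd.ae h

lemma Box.ae_swap {G : Box} {ν : Measure K} [SFinite ν] {p : ℝ × K → Prop}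
    (h : ∀ᵐ x ∂(G.dom ν), p x) :
    ∀ᵐ k ∂ν, ∀ᵐ z ∂(volume.restrict (Ioo (-G.ξ) G.d)), p (z, k) := by
  have h1 : ∀ᵐ y ∂(ν.prod (volume.restrict (Ioo (-G.ξ) G.d))), p y.swap :=
    (Measure.measurePreserving_swap (μ := ν)
      (ν := volume.restrict (Ioo (-G.ξ) G.d))).quasiMeasurePreserving.ae h
  exact Measure.ae_ae_of_ae_prod h1

lemma Box.integrable_slice {G : Box} {ν : Measure K} [SFinite ν] (v : Lp ℂ 2 (G.wt ν)) :
    ∀ᵐ k ∂ν, IntegrableOn (fun z => v (z, k)) (Ioo (-G.ξ) G.d) := by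
  have hh : 0 < G.h := by
    have := G.b_pos
    unfold Box.h
    positivity
  have h0 : ENNReal.ofReal (G.h ^ 2) ≠ 0 := by
    simpa using hh.ne'
  have hm : AEStronglyMeasurable v (G.dom ν) := by
    refine (Lp.aestronglyMeasurable v).mono_ac ?_
    intro s hs
    have : G.wt ν s = 0 := hs
    unfold Box.wt at this
    rw [Measure.smul_apply, smul_eq_mul, mul_eq_zero] at this
    exact this.resolve_left h0
  have h2 : Integrable (fun x => ‖v x‖ ^ 2) (G.wt ν) := (Lp.memLp v).integrable_norm_pow (by simp)
  have h3 : Integrable (fun x => ‖v x‖ ^ 2) (G.dom ν) := by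
    unfold Box.wt at h2
    rwa [integrable_smul_measure h0 ENNReal.ofReal_ne_top] at h2
  have h4 : ∀ᵐ k ∂ν, Integrable (fun z => ‖v (z, k)‖ ^ 2) (volume.restrict (Ioo (-G.ξ) G.d)) :=
    h3.prod_left_ae
  have h5 : ∀ᵐ k ∂ν, AEStronglyMeasurable (fun z => v (z, k))
      (volume.restrict (Ioo (-G.ξ) G.d)) := by
    have := hm.prod_swap
    exact this.prodMk_left
  filter_upwards [h4, h5] with k h4 h5
  have : MemLp (fun z => v (z, k)) 2 (volume.restrict (Ioo (-G.ξ) G.d)) :=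
    (memLp_two_iff_integrable_sq_norm h5).2 h4
  exact this.integrable (by norm_num)

lemma Box.uIoc_subset {G : Box} {a z : ℝ} (ha : a ∈ Icc (-G.ξ) G.d)
    (hz : z ∈ Ioo (-G.ξ) G.d) : uIoc a z ⊆ Ioc (-G.ξ) G.d := by
  intro t ht
  rcases mem_uIoc.1 ht with h | h
  · exact ⟨lt_of_le_of_lt ha.1 h.1, h.2.trans hz.2.le⟩
  · exact ⟨lt_trans hz.1 h.1, h.2.trans ha.2⟩

lemma Box.ae_mem {G : Box} {ν : Measure K} [SFinite ν] :
    ∀ᵐ x ∂(G.dom ν), x.1 ∈ Ioo (-G.ξ) G.d :=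
  Measure.quasiMeasurePreserving_fst.ae (ae_restrict_mem measurableSet_Ioo)

lemma Box.TraceAt.add {G : Box} {ν : Measure K} [SFinite ν] {a : ℝ}
    (ha : a ∈ Icc (-G.ξ) G.d) {u v u' v' : Lp ℂ 2 (G.wt ν)} {g g' : K → ℂ}
    (h : G.TraceAt ν a u v g) (h' : G.TraceAt ν a u' v' g') :
    G.TraceAt ν a (u + u' : Lp ℂ 2 (G.wt ν)) (v + v' : Lp ℂ 2 (G.wt ν)) (g + g') := by
  have hu := Box.wt_ae.1 (Lp.coeFn_add u u')
  have hv := Box.ae_param (G := G) (Box.ae_swap (Box.wt_ae.1 (Lp.coeFn_add v v')))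
  have i1 := Box.ae_param (G := G) (Box.integrable_slice v)
  have i2 := Box.ae_param (G := G) (Box.integrable_slice v')
  unfold Box.TraceAt at *
  filter_upwards [h, h', hu, hv, i1, i2, Box.ae_mem (G := G) (ν := ν)]
    with x h h' hu hv i1 i2 hx
  have hs := Box.uIoc_subset ha hx
  rw [← integrableOn_Ioc_iff_integrableOn_Ioo] at i1 i2
  rw [restrict_Ioo_eq_restrict_Ioc] at hv
  have e : ∫ t in a..x.1, (v + v' : Lp ℂ 2 (G.wt ν)) (t, x.2)
      = ∫ t in a..x.1, (v (t, x.2) + v' (t, x.2)) := by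
    apply intervalIntegral.integral_congr_ae
    have := (ae_restrict_iff' measurableSet_Ioc).1 hv
    filter_upwards [this] with t ht htm
    exact ht (hs htm)
  rw [hu, e, intervalIntegral.integral_add
    (intervalIntegrable_iff.2 (i1.mono_set hs)) (intervalIntegrable_iff.2 (i2.mono_set hs))]
  simp only [Pi.add_apply]
  rw [h, h']
  ring

lemma Box.TraceAt.smul {G : Box} {ν : Measure K} [SFinite ν] {a : ℝ}
    (ha : a ∈ Icc (-G.ξ) G.d) {u v : Lp ℂ 2 (G.wt ν)} {g : K → ℂ} (c : ℝ)
    (h : G.TraceAt ν a u v g) :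
    G.TraceAt ν a (c • u : Lp ℂ 2 (G.wt ν)) (c • v : Lp ℂ 2 (G.wt ν)) (c • g) := by
  have hu := Box.wt_ae.1 (Lp.coeFn_smul c u)
  have hv := Box.ae_param (G := G) (Box.ae_swap (Box.wt_ae.1 (Lp.coeFn_smul c v)))
  unfold Box.TraceAt at *
  filter_upwards [h, hu, hv, Box.ae_mem (G := G) (ν := ν)] with x h hu hv hx
  have hs := Box.uIoc_subset ha hx
  rw [restrict_Ioo_eq_restrict_Ioc] at hv
  have e : ∫ t in a..x.1, (c • v : Lp ℂ 2 (G.wt ν)) (t, x.2)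
      = ∫ t in a..x.1, c • v (t, x.2) := by
    apply intervalIntegral.integral_congr_ae
    have := (ae_restrict_iff' measurableSet_Ioc).1 hv
    filter_upwards [this] with t ht htm
    exact ht (hs htm)
  rw [hu, e, intervalIntegral.integral_smul]
  simp only [Pi.smul_apply]
  rw [h, smul_add]

lemma Box.TraceAt.zero {G : Box} {ν : Measure K} [SFinite ν] {a : ℝ}
    (ha : a ∈ Icc (-G.ξ) G.d) :
    G.TraceAt ν a (0 : Lp ℂ 2 (G.wt ν)) (0 : Lp ℂ 2 (G.wt ν)) 0 := by
  have hu := Box.wt_ae.1 (Lp.coeFn_zero ℂ 2 (G.wt ν))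
  have hv := Box.ae_param (G := G) (Box.ae_swap hu)
  unfold Box.TraceAt
  filter_upwards [hu, hv, Box.ae_mem (G := G) (ν := ν)] with x hu hv hx
  have hs := Box.uIoc_subset ha hx
  rw [restrict_Ioo_eq_restrict_Ioc] at hv
  have e : ∫ t in a..x.1, (0 : Lp ℂ 2 (G.wt ν)) (t, x.2) = ∫ t in a..x.1, (0 : ℂ) := by
    apply intervalIntegral.integral_congr_ae
    have := (ae_restrict_iff' measurableSet_Ioc).1 hv
    filter_upwards [this] with t ht htm
    exact ht (hs htm)
  rw [hu, e]
  simp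

lemma Box.TraceAt.add₀ {G : Box} {ν : Measure K} [SFinite ν] {a : ℝ}
    (ha : a ∈ Icc (-G.ξ) G.d) {u v u' v' : Lp ℂ 2 (G.wt ν)}
    (h : G.TraceAt ν a u v 0) (h' : G.TraceAt ν a u' v' 0) :
    G.TraceAt ν a (u + u' : Lp ℂ 2 (G.wt ν)) (v + v' : Lp ℂ 2 (G.wt ν)) 0 := by
  have e := h.add ha h'
  rwa [add_zero] at e

lemma Box.TraceAt.smul₀ {G : Box} {ν : Measure K} [SFinite ν] {a : ℝ}
    (ha : a ∈ Icc (-G.ξ) G.d) {u v : Lp ℂ 2 (G.wt ν)} (c : ℝ)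
    (h : G.TraceAt ν a u v 0) :
    G.TraceAt ν a (c • u : Lp ℂ 2 (G.wt ν)) (c • v : Lp ℂ 2 (G.wt ν)) 0 := by
  have e := h.smul ha c
  rwa [smul_zero] at e

lemma Box.left_mem (G : Box) : -G.ξ ∈ Icc (-G.ξ) G.d := ⟨le_rfl, G.lt.le⟩

lemma Box.right_mem (G : Box) : G.d ∈ Icc (-G.ξ) G.d := ⟨G.lt.le, le_rfl⟩

/-- Semidiscrete complex-valued functions `f(x_j, y_s, z, k)` with `k` in the measure space
`(K, ν)`, which together with their `z`-derivatives up to the order `m` are square integrable: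
an element is the family `(∂_z^r f(x_j, y_s, ·, ·))_{j, s, r}`, and its norm is given by
`‖f‖² = ∑_{j,s} ∑_{r ≤ m} h² ∫_K ∫_{-ξ}^d |∂_z^r f(x_j, y_s, z, k)|² dz dν(k)`.
Complex-valued functions are pairs of real ones, so this is a real inner product space. -/
def Sob (G : Box) (ν : Measure K) [SFinite ν] (m : ℕ) :
    Submodule ℝ (PiLp 2 (fun _ : G.Node × G.Node × Fin (m + 1) => Lp ℂ 2 (G.wt ν))) where
  carrier := {f | ∀ j s, ∀ r : Fin m, G.IsZDeriv ν (f (j, s, r.castSucc)) (f (j, s, r.succ))}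
  add_mem' := by
    intro f f' hf hf' j s r
    obtain ⟨c, hc⟩ := hf j s r
    obtain ⟨c', hc'⟩ := hf' j s r
    exact ⟨c + c', hc.add G.left_mem hc'⟩
  zero_mem' := by
    intro j s r
    exact ⟨0, Box.TraceAt.zero G.left_mem⟩
  smul_mem' := by
    intro a f hf j s r
    obtain ⟨c, hc⟩ := hf j s r
    exact ⟨a • c, hc.smul G.left_mem a⟩

/-- `zD f r j s` is the function `(z, k) ↦ ∂_z^r f(x_j, y_s, z, k)`. -/
def zD {G : Box} {ν : Measure K} [SFinite ν] {m : ℕ} (f : Sob G ν m) (r : Fin (m + 1))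
    (j s : G.Node) : ℝ × K → ℂ :=
  ((f : PiLp 2 (fun _ : G.Node × G.Node × Fin (m + 1) => Lp ℂ 2 (G.wt ν))) (j, s, r) :
    Lp ℂ 2 (G.wt ν))

/-- The embedding of the space of order `m + 1` into the space of order `m`. -/
def trunc {G : Box} {ν : Measure K} [SFinite ν] {m : ℕ} (f : Sob G ν (m + 1)) : Sob G ν m :=
  ⟨WithLp.toLp 2 (fun a =>
    (f : PiLp 2 (fun _ : G.Node × G.Node × Fin (m + 2) => Lp ℂ 2 (G.wt ν)))
      (a.1, a.2.1, a.2.2.castSucc)), by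
    intro j s r
    exact f.2 j s r.castSucc⟩

/-- The boundary conditions `f = φ₀`, `∂_z f = φ₁` on the face `Γ = {|x|, |y| < b, z = -ξ}` and
`f = 0` on the rest of the boundary (the face `z = d` and the lateral faces). -/
def HasBC {G : Box} {ν : Measure K} [SFinite ν] (f : Sob G ν 2)
    (φ₀ φ₁ : Fin G.n → Fin G.n → K → ℂ) : Prop :=
  (∀ i l, G.TraceAt ν (-G.ξ) (zD f 0 (G.mid i) (G.mid l)) (zD f 1 (G.mid i) (G.mid l)) (φ₀ i l)) ∧
  (∀ i l, G.TraceAt ν (-G.ξ) (zD f 1 (G.mid i) (G.mid l)) (zD f 2 (G.mid i) (G.mid l)) (φ₁ i l)) ∧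
  (∀ i l, G.TraceAt ν G.d (zD f 0 (G.mid i) (G.mid l)) (zD f 1 (G.mid i) (G.mid l)) 0) ∧
  (∀ j s, G.Lateral j s → ∀ᵐ x ∂(G.dom ν), zD f 0 j s x = 0)

/-- The subspace given by `f = 0` on the whole boundary and `∂_z f = 0` on `Γ`. -/
def Sob₀ (G : Box) (ν : Measure K) [SFinite ν] : Submodule ℝ (Sob G ν 2) where
  carrier := {f | HasBC f 0 0}
  add_mem' := by
    rintro f f' ⟨h1, h2, h3, h4⟩ ⟨h1', h2', h3', h4'⟩
    refine ⟨fun i l => ?_, fun i l => ?_, fun i l => ?_, fun j s hjs => ?_⟩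
    · exact Box.TraceAt.add₀ G.left_mem (h1 i l) (h1' i l)
    · exact Box.TraceAt.add₀ G.left_mem (h2 i l) (h2' i l)
    · exact Box.TraceAt.add₀ G.right_mem (h3 i l) (h3' i l)
    · have hu := Box.wt_ae.1 (Lp.coeFn_add (f.1 (j, s, 0)) (f'.1 (j, s, 0)))
      filter_upwards [hu, h4 j s hjs, h4' j s hjs] with x hx h h'
      refine hx.trans ?_
      have e : zD f 0 j s x + zD f' 0 j s x = 0 := by rw [h, h', add_zero]
      exact e
  zero_mem' := by
    refine ⟨fun i l => ?_, fun i l => ?_, fun i l => ?_, fun j s hjs => ?_⟩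
    · exact Box.TraceAt.zero G.left_mem
    · exact Box.TraceAt.zero G.left_mem
    · exact Box.TraceAt.zero G.right_mem
    · exact Box.wt_ae.1 (Lp.coeFn_zero ℂ 2 (G.wt ν))
  smul_mem' := by
    rintro c f ⟨h1, h2, h3, h4⟩
    refine ⟨fun i l => ?_, fun i l => ?_, fun i l => ?_, fun j s hjs => ?_⟩
    · exact Box.TraceAt.smul₀ G.left_mem c (h1 i l)
    · exact Box.TraceAt.smul₀ G.left_mem c (h2 i l)
    · exact Box.TraceAt.smul₀ G.right_mem c (h3 i l)
    · have hu := Box.wt_ae.1 (Lp.coeFn_smul c (f.1 (j, s, 0)))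
      filter_upwards [hu, h4 j s hjs] with x hx h
      refine hx.trans ?_
      have e : c • zD f 0 j s x = 0 := by rw [h, smul_zero]
      exact e

/-- The semidiscrete Laplacian `f_zz + f_xx^h + f_yy^h` at the interior node `(i, l)`. -/
def lap {G : Box} {ν : Measure K} [SFinite ν] (f : Sob G ν 2) (i l : Fin G.n)
    (x : ℝ × K) : ℂ :=
  zD f 2 (G.mid i) (G.mid l) x
    + (zD f 0 (G.lft i) (G.mid l) x - 2 * zD f 0 (G.mid i) (G.mid l) x
        + zD f 0 (G.rgt i) (G.mid l) x) / (G.h : ℂ) ^ 2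
    + (zD f 0 (G.mid i) (G.lft l) x - 2 * zD f 0 (G.mid i) (G.mid l) x
        + zD f 0 (G.mid i) (G.rgt l) x) / (G.h : ℂ) ^ 2

/-- The semidiscrete gradient `(∂_x^h f, ∂_y^h f, ∂_z f)` at the interior node `(i, l)`. -/
def grad {G : Box} {ν : Measure K} [SFinite ν] (f : Sob G ν 2) (i l : Fin G.n)
    (x : ℝ × K) : Fin 3 → ℂ :=
  ![(zD f 0 (G.rgt i) (G.mid l) x - zD f 0 (G.lft i) (G.mid l) x) / (2 * (G.h : ℂ)),
    (zD f 0 (G.mid i) (G.rgt l) x - zD f 0 (G.mid i) (G.lft l) x) / (2 * (G.h : ℂ)),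
    zD f 1 (G.mid i) (G.mid l) x]

end Spaces

/-- Semidiscrete functions `f(x_j, y_s, z)` without parameter: the space `H^{m,h}(Ω_h)`. -/
abbrev HΩ (G : Box) (m : ℕ) : Type := Sob G (Measure.dirac ()) m

/-- The space `H_0^{2,h}(Ω_h)`. -/
abbrev HΩ₀ (G : Box) : Type := Sob₀ G (Measure.dirac ())

/-- Semidiscrete functions `f(x_j, y_s, z, k)`, `k ∈ (k₁, k₂)`: the space `H_m^h`. -/
abbrev HK (G : Box) (k₁ k₂ : ℝ) (m : ℕ) : Type := Sob G (volume.restrict (Ioo k₁ k₂)) m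

/-- The space `H_{0,2}^h`. -/
abbrev HK₀ (G : Box) (k₁ k₂ : ℝ) : Type := Sob₀ G (volume.restrict (Ioo k₁ k₂))

/-- `∑ h² ∫ |u(x_i, y_l, z)|² e^{-2λz} dz`, the sum over the interior nodes. -/
def weightedSq (G : Box) (lam : ℝ) (u : Fin G.n → Fin G.n → ℝ × Unit → ℂ) : ℝ :=
  ∑ i, ∑ l, G.h ^ 2 *
    ∫ x, ‖u i l x‖ ^ 2 * Real.exp (-2 * lam * x.1) ∂(G.dom (Measure.dirac ()))

/-- The Carleman estimate for `Δ^h` with the weight `e^{-2λz}` and the constant `C`. -/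
def CarlemanEstimate (G : Box) (C lam : ℝ) : Prop :=
  ∀ u : HΩ₀ G,
    C * weightedSq G lam (fun i l => zD u.1 2 (G.mid i) (G.mid l))
      + C * lam * weightedSq G lam (fun i l => zD u.1 1 (G.mid i) (G.mid l))
      + C * lam ^ 3 * weightedSq G lam (fun i l => zD u.1 0 (G.mid i) (G.mid l))
    ≤ weightedSq G lam (lap u.1)

/-- The functional `I_μ(W)` for the tail function. -/
def tailCost (G : Box) (Q : HΩ G 2) (μ : ℝ) (W : HΩ₀ G) : ℝ :=
  Real.exp (2 * μ * G.d) * weightedSq G μ (fun i l x => lap W.1 i l x + lap Q i l x)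

/-- The choice `μ(δ) = ln(δ^{-1/(2(d+ξ))})`. -/
def tailParam (G : Box) (δ : ℝ) : ℝ :=
  Real.log (δ ^ (-(1 / (2 * (G.d + G.ξ)))))

/-- The semidiscrete integro-differential operator
`L^h(q) = Δ^h q + 2k (∇^h V - ∫_k^{k₂} ∇^h q dκ) · (k ∇^h q + θ(k) ∇^h V - ∫_k^{k₂} ∇^h q dκ)
  + 2i (k q_z + V_z - ∫_k^{k₂} q_z dκ)`
at the interior node `(i, l)` and the point `x = (z, k)`; `a · b = ∑ a_c b_c` without
conjugation. -/
def Lop (G : Box) (k₁ k₂ : ℝ) (θ : ℝ → ℝ) (V : HΩ G 2) (q : HK G k₁ k₂ 2) (i l : Fin G.n)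
    (x : ℝ × ℝ) : ℂ :=
  let gV : Fin 3 → ℂ := grad V i l (x.1, ())
  let gq : Fin 3 → ℂ := grad q i l x
  let S : Fin 3 → ℂ := fun c => ∫ κ in x.2..k₂, grad q i l (x.1, κ) c
  lap q i l x
    + 2 * (x.2 : ℂ) * ((gV - S) ⬝ᵥ ((x.2 : ℂ) • gq + (θ x.2 : ℂ) • gV - S))
    + 2 * Complex.I * ((x.2 : ℂ) * gq 2 + gV 2 - S 2)

/-- The integrand `|L^h(p + F)|² e^{-2λz}` of the cost functional. -/
def costDensity (G : Box) (k₁ k₂ : ℝ) (θ : ℝ → ℝ) (V : HΩ G 2) (F : HK G k₁ k₂ 3) (lam : ℝ)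
    (p : HK₀ G k₁ k₂) (i l : Fin G.n) (x : ℝ × ℝ) : ℝ :=
  ‖Lop G k₁ k₂ θ V (p.1 + trunc F) i l x‖ ^ 2 * Real.exp (-2 * lam * x.1)

/-- The weighted cost functional `J_λ(p)`. -/
def cost (G : Box) (k₁ k₂ : ℝ) (θ : ℝ → ℝ) (V : HΩ G 2) (F : HK G k₁ k₂ 3) (lam : ℝ)
    (p : HK₀ G k₁ k₂) : ℝ :=
  Real.exp (2 * lam * G.d) * ∑ i, ∑ l, G.h ^ 2 *
    ∫ x, costDensity G k₁ k₂ θ V F lam p i l x ∂(G.dom (volume.restrict (Ioo k₁ k₂)))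

/-- `J` is Fréchet differentiable at `p`, and its derivative is `r ↦ ⟨X, r⟩`. -/
def HasFrechetGrad {E : Type*} [NormedAddCommGroup E] [InnerProductSpace ℝ E] (J : E → ℝ)
    (X p : E) : Prop :=
  HasFDerivAt J (innerSL ℝ X) p

end SemiDiscrete

end

/-!
On a fixed grid `u_zz` differs from `Δ^h u` by finite differences of `u` with bounded coefficients.
For `u` with `u = u_z = 0` on `Γ`, the face where the weight `e^{-2λz}` is largest, integration in
`z` gains negative powers of `λ` in the weighted norms, so large `λ` absorbs these differences
in `u_zz`. This is the Carleman estimate.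

The increment `L^h(q + r) - L^h(q)` is `Δ^h r` plus terms in `∇^h r` and `∫_k^{k₂} ∇^h r dκ`, with
coefficients bounded on bounded sets; the Volterra integrals are harmless because the weight does
not depend on `k`. Hence the second order remainder of `J_λ` at `p` is at least half of the weighted
norm of `Δ^h r`, up to `O(1 / λ)` times the weighted norm of `r_zz`, and the Carleman estimate
makes it dominate the latter.

The tail `V` enters only through a bound of its norm. Comparing the minimizer `W` with `V_* - Q_*`,
the Carleman estimate loses a factor `e^{2μ(d + ξ)}`, which the choice of `μ(δ)` makes `1 / δ`,
against a squared data error below `δ²`.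
-/

noncomputable section

namespace SemiDiscrete

/-! ## Weighted estimates of primitives -/

section Primitives

theorem sq_integral_mul_le {α : Type*} [MeasurableSpace α] {μ : Measure α} {f g : α → ℝ}
    (hf : MemLp f 2 μ) (hg : MemLp g 2 μ) :
    (∫ x, f x * g x ∂μ) ^ 2 ≤ (∫ x, f x ^ 2 ∂μ) * ∫ x, g x ^ 2 ∂μ := by
  have holder := integral_mul_norm_le_Lp_mul_Lq (μ := μ) (f := f) (g := g)
    Real.HolderConjugate.two_two (by simpa using hf) (by simpa using hg)
  simp only [Real.rpow_two, ← Real.sqrt_eq_rpow, Real.norm_eq_abs, sq_abs] at holder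
  have abs_le : |∫ x, f x * g x ∂μ| ≤ ∫ x, |f x| * |g x| ∂μ := by
    simpa only [abs_mul] using abs_integral_le_integral_abs (μ := μ) (f := fun x => f x * g x)
  calc (∫ x, f x * g x ∂μ) ^ 2 = |∫ x, f x * g x ∂μ| ^ 2 := (sq_abs _).symm
    _ ≤ (√(∫ x, f x ^ 2 ∂μ) * √(∫ x, g x ^ 2 ∂μ)) ^ 2 := by gcongr; exact abs_le.trans holder
    _ = (∫ x, f x ^ 2 ∂μ) * ∫ x, g x ^ 2 ∂μ := by
      rw [mul_pow, Real.sq_sqrt (integral_nonneg fun x => sq_nonneg _),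
        Real.sq_sqrt (integral_nonneg fun x => sq_nonneg _)]

theorem sq_exp_neg_mul (lam t : ℝ) : Real.exp (-lam * t) ^ 2 = Real.exp (-2 * lam * t) := by
  rw [← Real.exp_nat_mul]
  congr 1
  push_cast
  ring

theorem setIntegral_exp_neg_mul_sub_le {a z lam : ℝ} (hlam : 0 < lam) (haz : a ≤ z) :
    ∫ t in Ioo a z, Real.exp (-lam * (z - t)) ≤ 1 / lam := by
  have hderiv : ∀ t ∈ uIcc a z, HasDerivAt (fun t => Real.exp (-lam * (z - t)) / lam)
      (Real.exp (-lam * (z - t))) t := by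
    intro t _
    have hlin : HasDerivAt (fun t => -lam * (z - t)) lam t := by
      simpa using ((hasDerivAt_id t).const_sub z).const_mul (-lam)
    simpa only [mul_div_cancel_right₀ _ hlam.ne'] using hlin.exp.div_const lam
  rw [← integral_Ioc_eq_integral_Ioo, ← intervalIntegral.integral_of_le haz,
    intervalIntegral.integral_eq_sub_of_hasDerivAt hderiv
      (Continuous.intervalIntegrable (by fun_prop) _ _), sub_self, mul_zero, Real.exp_zero]
  linarith [show 0 ≤ Real.exp (-lam * (z - a)) / lam by positivity]

variable {E : Type*} [NormedAddCommGroup E] {a b y z lam : ℝ} {g u v : ℝ → E}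

theorem sq_setIntegral_norm_le (hab : a ≤ b) (hg : MemLp g 2 (volume.restrict (Ioo a b))) :
    (∫ t in Ioo a b, ‖g t‖) ^ 2 ≤ (b - a) * ∫ t in Ioo a b, ‖g t‖ ^ 2 := by
  simpa [hab] using sq_integral_mul_le (memLp_const (1 : ℝ)) hg.norm

theorem integrableOn_Ioc_of_memLp_two (hg : MemLp g 2 (volume.restrict (Ioo a b))) :
    IntegrableOn g (Ioc a b) :=
  (integrableOn_Ioc_iff_integrableOn_Ioo).2 (hg.integrable one_le_two)

theorem integrableOn_sq_mul_exp (lam : ℝ) (hg : MemLp g 2 (volume.restrict (Ioo a b))) :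
    IntegrableOn (fun t => ‖g t‖ ^ 2 * Real.exp (-2 * lam * t)) (Ioo a b) := by
  have hexp : Continuous fun t : ℝ => Real.exp (-2 * lam * t) := by fun_prop
  have hsq : IntegrableOn (fun t => ‖g t‖ ^ 2) (Ioo a b) := hg.integrable_norm_pow two_ne_zero
  rw [← integrableOn_Icc_iff_integrableOn_Ioo] at hsq ⊢
  exact hsq.mul_continuousOn hexp.continuousOn isCompact_Icc

theorem memLp_two_mul_exp (lam : ℝ) (hg : MemLp g 2 (volume.restrict (Ioo a b))) :
    MemLp (fun t => ‖g t‖ * Real.exp (-lam * t)) 2 (volume.restrict (Ioo a b)) := by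
  refine (memLp_two_iff_integrable_sq ?_).2 ?_
  · exact hg.1.norm.mul (Continuous.aestronglyMeasurable (by fun_prop))
  · simp only [mul_pow, sq_exp_neg_mul]
    exact integrableOn_sq_mul_exp lam hg

/-- Cauchy–Schwarz after writing `e^{-λz} = e^{-λt} e^{-λ(z-t)}`. -/
theorem sq_weighted_setIntegral_norm_le (hlam : 0 < lam) (haz : a ≤ z)
    (hg : MemLp g 2 (volume.restrict (Ioo a z))) :
    ((∫ t in Ioo a z, ‖g t‖) * Real.exp (-lam * z)) ^ 2
      ≤ 1 / (2 * lam) * ∫ t in Ioo a z, ‖g t‖ ^ 2 * Real.exp (-2 * lam * t) := by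
  have hkernel : MemLp (fun t => Real.exp (-lam * (z - t))) 2 (volume.restrict (Ioo a z)) := by
    refine (memLp_two_iff_integrable_sq (Continuous.aestronglyMeasurable (by fun_prop))).2 ?_
    exact (Continuous.integrableOn_Icc (by fun_prop)).mono_set Ioo_subset_Icc_self
  have hkernel_sq : ∫ t in Ioo a z, Real.exp (-2 * lam * (z - t)) ≤ 1 / (2 * lam) := by
    simpa only [neg_mul] using
      setIntegral_exp_neg_mul_sub_le (lam := 2 * lam) (by positivity) haz
  have hsplit : (∫ t in Ioo a z, ‖g t‖) * Real.exp (-lam * z)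
      = ∫ t in Ioo a z, Real.exp (-lam * (z - t)) * (‖g t‖ * Real.exp (-lam * t)) := by
    rw [← integral_mul_const]
    refine integral_congr_ae (.of_forall fun t => ?_)
    dsimp only
    rw [mul_left_comm, ← Real.exp_add]
    ring_nf
  calc ((∫ t in Ioo a z, ‖g t‖) * Real.exp (-lam * z)) ^ 2
      ≤ (∫ t in Ioo a z, Real.exp (-lam * (z - t)) ^ 2)
          * ∫ t in Ioo a z, (‖g t‖ * Real.exp (-lam * t)) ^ 2 := by
        rw [hsplit]
        exact sq_integral_mul_le hkernel (memLp_two_mul_exp lam hg)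
    _ ≤ 1 / (2 * lam) * ∫ t in Ioo a z, ‖g t‖ ^ 2 * Real.exp (-2 * lam * t) := by
        simp only [mul_pow, sq_exp_neg_mul lam]
        exact mul_le_mul_of_nonneg_right hkernel_sq (integral_nonneg fun t => by positivity)

variable [NormedSpace ℝ E]

theorem norm_intervalIntegral_le_setIntegral_norm (hg : IntegrableOn g (Ioc a b))
    (hy : y ∈ Icc a b) (hz : z ∈ Icc a b) : ‖∫ t in y..z, g t‖ ≤ ∫ t in Ioo a b, ‖g t‖ := by
  have hsub : uIoc y z ⊆ Ioc a b :=
    Ioc_subset_Ioc (le_min hy.1 hz.1) (max_le hy.2 hz.2)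
  rw [← integral_Ioc_eq_integral_Ioo]
  exact intervalIntegral.norm_integral_le_integral_norm_uIoc.trans
    (setIntegral_mono_set hg.norm (.of_forall fun _ => norm_nonneg _) hsub.eventuallyLE)

theorem sq_norm_intervalIntegral_le (hg : MemLp g 2 (volume.restrict (Ioo a b)))
    (hy : y ∈ Icc a b) (hz : z ∈ Icc a b) :
    ‖∫ t in y..z, g t‖ ^ 2 ≤ (b - a) * ∫ t in Ioo a b, ‖g t‖ ^ 2 := by
  have hnorm := norm_intervalIntegral_le_setIntegral_norm (integrableOn_Ioc_of_memLp_two hg) hy hz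
  exact (pow_le_pow_left₀ (norm_nonneg _) hnorm 2).trans
    (sq_setIntegral_norm_le (hy.1.trans hy.2) hg)

/-- Integrating from the face where the weight `e^{-λz}` is largest gains the factor
`1 / (2 λ)`; this is the source of all smallness for large `λ`. -/
theorem sq_weighted_primitive_le (hlam : 0 < lam) (hz : z ∈ Ioo a b)
    (hg : MemLp g 2 (volume.restrict (Ioo a b))) :
    (‖∫ t in a..z, g t‖ * Real.exp (-lam * z)) ^ 2
      ≤ 1 / (2 * lam) * ∫ t in Ioo a b, ‖g t‖ ^ 2 * Real.exp (-2 * lam * t) := by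
  have hsub : Ioo a z ⊆ Ioo a b := Ioo_subset_Ioo_right hz.2.le
  have hgz : MemLp g 2 (volume.restrict (Ioo a z)) :=
    hg.mono_measure (Measure.restrict_mono hsub le_rfl)
  have hnorm := norm_intervalIntegral_le_setIntegral_norm (integrableOn_Ioc_of_memLp_two hgz)
    (left_mem_Icc.2 hz.1.le) (right_mem_Icc.2 hz.1.le)
  calc (‖∫ t in a..z, g t‖ * Real.exp (-lam * z)) ^ 2
      ≤ ((∫ t in Ioo a z, ‖g t‖) * Real.exp (-lam * z)) ^ 2 := by gcongr
    _ ≤ 1 / (2 * lam) * ∫ t in Ioo a z, ‖g t‖ ^ 2 * Real.exp (-2 * lam * t) :=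
        sq_weighted_setIntegral_norm_le hlam hz.1.le hgz
    _ ≤ 1 / (2 * lam) * ∫ t in Ioo a b, ‖g t‖ ^ 2 * Real.exp (-2 * lam * t) := by
        refine mul_le_mul_of_nonneg_left ?_ (by positivity)
        exact setIntegral_mono_set (integrableOn_sq_mul_exp lam hg)
          (.of_forall fun t => by positivity) hsub.eventuallyLE

theorem weighted_primitive_le_of_weighted_le {c : ℝ} (hlam : 0 < lam) (hz : z ∈ Ioo a b)
    (hc : 0 ≤ c) (hg : ∀ᵐ t ∂volume.restrict (Ioo a b), ‖g t‖ * Real.exp (-lam * t) ≤ c) :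
    ‖∫ t in a..z, g t‖ * Real.exp (-lam * z) ≤ c / lam := by
  have hinteg : IntegrableOn (fun t => c * Real.exp (lam * z) * Real.exp (-lam * (z - t)))
      (Ioo a z) := (Continuous.integrableOn_Icc (by fun_prop)).mono_set Ioo_subset_Icc_self
  have hnorm : ‖∫ t in a..z, g t‖
      ≤ ∫ t in Ioo a z, c * Real.exp (lam * z) * Real.exp (-lam * (z - t)) := by
    rw [intervalIntegral.integral_of_le hz.1.le, integral_Ioc_eq_integral_Ioo]
    refine norm_integral_le_of_norm_le hinteg ?_
    filter_upwards [ae_restrict_of_ae_restrict_of_subset (Ioo_subset_Ioo_right hz.2.le) hg]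
      with t ht
    refine le_of_mul_le_mul_right (ht.trans_eq ?_) (Real.exp_pos (-lam * t))
    rw [mul_assoc c, mul_assoc c, ← Real.exp_add, ← Real.exp_add]
    ring_nf
    simp
  have hexp : Real.exp (lam * z) * Real.exp (-lam * z) = 1 := by
    rw [← Real.exp_add, neg_mul, add_neg_cancel, Real.exp_zero]
  rw [integral_const_mul] at hnorm
  calc ‖∫ t in a..z, g t‖ * Real.exp (-lam * z)
      ≤ c * Real.exp (lam * z) * (1 / lam) * Real.exp (-lam * z) := by
        gcongr
        exact hnorm.trans (mul_le_mul_of_nonneg_left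
          (setIntegral_exp_neg_mul_sub_le hlam hz.1.le) (by positivity))
    _ = c / lam * (Real.exp (lam * z) * Real.exp (-lam * z)) := by ring
    _ = c / lam := by rw [hexp, mul_one]

theorem ae_sq_norm_le_of_primitive {c : E} (hu : MemLp u 2 (volume.restrict (Ioo a b)))
    (hv : MemLp v 2 (volume.restrict (Ioo a b)))
    (huv : ∀ᵐ z ∂volume.restrict (Ioo a b), u z = c + ∫ t in a..z, v t) :
    ∀ᵐ z ∂volume.restrict (Ioo a b), ‖u z‖ ^ 2
      ≤ 2 / (b - a) * (∫ t in Ioo a b, ‖u t‖ ^ 2)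
        + 2 * (b - a) * ∫ t in Ioo a b, ‖v t‖ ^ 2 := by
  rcases le_or_gt b a with hba | hab
  · simp [Ioo_eq_empty_of_le hba]
  set A := ∫ t in Ioo a b, ‖u t‖ ^ 2
  set B := ∫ t in Ioo a b, ‖v t‖ ^ 2
  have hv_int : ∀ z ∈ Ioo a b, IntervalIntegrable v volume a z := fun z hz =>
    (intervalIntegrable_iff_integrableOn_Ioc_of_le hz.1.le).2
      ((integrableOn_Ioc_of_memLp_two hv).mono_set (Ioc_subset_Ioc_right hz.2.le))
  have hu_sq : IntegrableOn (fun t => ‖u t‖ ^ 2) (Ioo a b) := hu.integrable_norm_pow two_ne_zero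
  filter_upwards [huv, ae_restrict_mem measurableSet_Ioo] with z hz hzm
  have hpair : ∀ᵐ y ∂volume.restrict (Ioo a b),
      ‖u z‖ ^ 2 ≤ 2 * ‖u y‖ ^ 2 + 2 * ((b - a) * B) := by
    filter_upwards [huv, ae_restrict_mem measurableSet_Ioo] with y hy hym
    have hdiff : u z = u y + ∫ t in y..z, v t := by
      rw [hz, hy, add_assoc, intervalIntegral.integral_add_adjacent_intervals (hv_int y hym)
        ((hv_int y hym).symm.trans (hv_int z hzm))]
    have hinteg : ‖∫ t in y..z, v t‖ ^ 2 ≤ (b - a) * B :=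
      sq_norm_intervalIntegral_le hv (Ioo_subset_Icc_self hym) (Ioo_subset_Icc_self hzm)
    calc ‖u z‖ ^ 2 ≤ (‖u y‖ + ‖∫ t in y..z, v t‖) ^ 2 := by
          rw [hdiff]; gcongr; exact norm_add_le _ _
      _ ≤ 2 * (‖u y‖ ^ 2 + ‖∫ t in y..z, v t‖ ^ 2) := add_sq_le
      _ ≤ 2 * ‖u y‖ ^ 2 + 2 * ((b - a) * B) := by linarith
  have hmean : (b - a) * ‖u z‖ ^ 2 ≤ 2 * A + (b - a) * (2 * ((b - a) * B)) := by
    have := integral_mono_ae (integrable_const _)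
      ((hu_sq.const_mul 2).add (integrable_const _)) hpair
    simpa [integral_add (hu_sq.const_mul 2) (integrable_const _), integral_const_mul, A,
      Real.volume_real_Ioo_of_le hab.le] using this
  have hlen : 0 < b - a := sub_pos.2 hab
  calc ‖u z‖ ^ 2 ≤ (2 * A + (b - a) * (2 * ((b - a) * B))) / (b - a) := by
        rwa [le_div_iff₀' hlen]
    _ = 2 / (b - a) * A + 2 * (b - a) * B := by field_simp

theorem ae_eq_zero_of_primitive_eq_zero [CompleteSpace E] {c : E} (hv : IntegrableOn v (Ioo a b))
    (h : ∀ᵐ z ∂volume.restrict (Ioo a b), c + ∫ t in a..z, v t = 0) :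
    ∀ᵐ z ∂volume.restrict (Ioo a b), v z = 0 := by
  rcases le_or_gt b a with hba | hab
  · simp [Ioo_eq_empty_of_le hba]
  have hv_int : IntervalIntegrable v volume a b :=
    (intervalIntegrable_iff_integrableOn_Ioo_of_le hab.le).2 hv
  have hcont : ContinuousOn (fun z => c + ∫ t in a..z, v t) (Ioo a b) := by
    have := intervalIntegral.continuousOn_primitive_interval' hv_int left_mem_uIcc
    rw [uIcc_of_le hab.le] at this
    exact (continuousOn_const.add this).mono Ioo_subset_Icc_self
  have hzero : ∀ z ∈ Ioo a b, c + ∫ t in a..z, v t = 0 :=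
    Measure.eqOn_open_of_ae_eq (μ := volume) (g := fun _ => (0 : E)) h isOpen_Ioo hcont
      continuousOn_const
  rw [ae_restrict_iff' measurableSet_Ioo]
  filter_upwards [hv_int.ae_hasDerivAt_integral] with z hz hzm
  have hderiv : HasDerivAt (fun z => ∫ t in a..z, v t) (v z) z :=
    hz (by rw [uIcc_of_le hab.le]; exact Ioo_subset_Icc_self hzm) a left_mem_uIcc
  refine hderiv.unique ((hasDerivAt_const z (-c)).congr_of_eventuallyEq ?_)
  filter_upwards [isOpen_Ioo.mem_nhds hzm] with y hy
  exact (neg_eq_of_add_eq_zero_right (hzero y hy)).symm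

end Primitives

section Slices

variable {K : Type} [MeasurableSpace K] {G : Box} {ν : Measure K}

namespace Box

theorem h_pos (G : Box) : 0 < G.h := by
  have := G.b_pos
  unfold Box.h
  positivity

/-- The height `d + ξ` of the box. -/
def len (G : Box) : ℝ := G.d + G.ξ

theorem sub_neg_eq_len (G : Box) : G.d - -G.ξ = G.len := sub_neg_eq_add _ _

theorem len_pos (G : Box) : 0 < G.len := G.sub_neg_eq_len ▸ sub_pos.2 G.lt

theorem ae_of_ae_swap [SFinite ν] {p : ℝ × K → Prop}
    (h : ∀ᵐ k ∂ν, ∀ᵐ z ∂volume.restrict (Ioo (-G.ξ) G.d), p (z, k))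
    (hp : MeasurableSet {x | p x}) : ∀ᵐ x ∂G.dom ν, p x := by
  have hswap : ∀ᵐ y ∂ν.prod (volume.restrict (Ioo (-G.ξ) G.d)), p y.swap :=
    (Measure.ae_prod_iff_ae_ae (hp.preimage measurable_swap)).2 h
  exact Measure.measurePreserving_swap.quasiMeasurePreserving.ae hswap

theorem integrable_wt_iff {E : Type*} [NormedAddCommGroup E] {f : ℝ × K → E} :
    Integrable f (G.wt ν) ↔ Integrable f (G.dom ν) :=
  integrable_smul_measure (by simpa using G.h_pos.ne') ENNReal.ofReal_ne_top

theorem integrable_sq (v : Lp ℂ 2 (G.wt ν)) : Integrable (fun x => ‖v x‖ ^ 2) (G.dom ν) :=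
  integrable_wt_iff.1 ((Lp.memLp v).integrable_norm_pow two_ne_zero)

theorem measurable_coeFn (v : Lp ℂ 2 (G.wt ν)) : Measurable v :=
  (Lp.stronglyMeasurable v).measurable

theorem norm_sq_eq (v : Lp ℂ 2 (G.wt ν)) :
    ‖v‖ ^ 2 = G.h ^ 2 * ∫ x, ‖v x‖ ^ 2 ∂G.dom ν := by
  rw [← real_inner_self_eq_norm_sq, L2.inner_def]
  simp only [real_inner_self_eq_norm_sq]
  unfold Box.wt
  rw [integral_smul_measure, ENNReal.toReal_ofReal (by positivity), smul_eq_mul]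

theorem exp_le {lam z : ℝ} (hz : z ∈ Ioo (-G.ξ) G.d) :
    Real.exp (-2 * lam * z) ≤ Real.exp (2 * |lam| * (|G.ξ| + |G.d|)) := by
  have hz_le : |z| ≤ |G.ξ| + |G.d| := abs_le.2
    ⟨by linarith [hz.1, le_abs_self G.ξ, abs_nonneg G.d],
      by linarith [hz.2, le_abs_self G.d, abs_nonneg G.ξ]⟩
  refine Real.exp_le_exp.2 ?_
  calc -2 * lam * z = 2 * -(lam * z) := by ring
    _ ≤ 2 * (|lam| * |z|) := by rw [← abs_mul]; gcongr; exact neg_le_abs _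
    _ ≤ 2 * |lam| * (|G.ξ| + |G.d|) := by rw [← mul_assoc]; gcongr

theorem integrable_mul_exp [SFinite ν] {f : ℝ × K → ℝ} (lam : ℝ)
    (hf : Integrable f (G.dom ν)) :
    Integrable (fun x => f x * Real.exp (-2 * lam * x.1)) (G.dom ν) := by
  refine hf.mul_bdd (c := Real.exp (2 * |lam| * (|G.ξ| + |G.d|)))
    (Measurable.aestronglyMeasurable (by fun_prop)) ?_
  filter_upwards [Box.ae_mem] with x hx
  rw [Real.norm_eq_abs, Real.abs_exp]
  exact exp_le hx

theorem integrable_param [SFinite ν] {e : K → ℝ} (he : Integrable e ν) :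
    Integrable (fun x => e x.2) (G.dom ν) :=
  he.comp_snd _

theorem integral_param [SFinite ν] (e : K → ℝ) :
    ∫ x, e x.2 ∂G.dom ν = G.len * ∫ k, e k ∂ν := by
  rw [Box.dom, integral_fun_snd, measureReal_restrict_apply_univ,
    Real.volume_real_Ioo_of_le G.lt.le, sub_neg_eq_len, smul_eq_mul]

theorem ae_memLp_slice [SFinite ν] (v : Lp ℂ 2 (G.wt ν)) :
    ∀ᵐ k ∂ν, MemLp (fun z => v (z, k)) 2 (volume.restrict (Ioo (-G.ξ) G.d)) := by
  filter_upwards [(integrable_sq v).prod_left_ae] with k hk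
  exact (memLp_two_iff_integrable_sq_norm
    ((measurable_coeFn v).comp measurable_prodMk_right).aestronglyMeasurable).2 hk

/-- The weighted square norm `∫ |f(z, k)|² e^{-2λz} dz` of the slice of `f` at `k`. -/
def sliceSq (G : Box) (lam : ℝ) (f : ℝ × K → ℂ) (k : K) : ℝ :=
  ∫ z in Ioo (-G.ξ) G.d, ‖f (z, k)‖ ^ 2 * Real.exp (-2 * lam * z)

theorem sliceSq_nonneg {K : Type} (G : Box) (lam : ℝ) (f : ℝ × K → ℂ) (k : K) :
    0 ≤ G.sliceSq lam f k :=
  integral_nonneg fun _ => by positivity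

theorem measurable_sliceSq (G : Box) (lam : ℝ) {f : ℝ × K → ℂ} (hf : Measurable f) :
    Measurable (G.sliceSq lam f) := by
  have h : StronglyMeasurable fun p : ℝ × K => ‖f p‖ ^ 2 * Real.exp (-2 * lam * p.1) :=
    Measurable.stronglyMeasurable (by fun_prop)
  exact h.integral_prod_left'.measurable

theorem integrable_sliceSq [SFinite ν] (lam : ℝ) {f : ℝ × K → ℂ}
    (hf : Integrable (fun x => ‖f x‖ ^ 2) (G.dom ν)) : Integrable (G.sliceSq lam f) ν :=
  (integrable_mul_exp lam hf).integral_prod_right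

theorem integral_sliceSq [SFinite ν] (lam : ℝ) {f : ℝ × K → ℂ}
    (hf : Integrable (fun x => ‖f x‖ ^ 2) (G.dom ν)) :
    ∫ k, G.sliceSq lam f k ∂ν = ∫ x, ‖f x‖ ^ 2 * Real.exp (-2 * lam * x.1) ∂G.dom ν :=
  (integral_prod_symm _ (integrable_mul_exp lam hf)).symm

theorem stronglyMeasurable_setIntegral {X E : Type*} [MeasurableSpace X] [NormedAddCommGroup E]
    [NormedSpace ℝ E] {s : X → Set ℝ} {f : ℝ × X → E} (hf : StronglyMeasurable f)
    (hs : MeasurableSet {y : X × ℝ | y.2 ∈ s y.1}) :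
    StronglyMeasurable fun x => ∫ t in s x, f (t, x) := by
  have h : StronglyMeasurable fun y : X × ℝ =>
      {y : X × ℝ | y.2 ∈ s y.1}.indicator (fun y => f y.swap) y :=
    (hf.comp_measurable measurable_swap).indicator hs
  convert h.integral_prod_right' (ν := volume) using 2 with x
  rw [← integral_indicator (s := s x) (measurable_prodMk_left hs)]
  rfl

theorem stronglyMeasurable_primitive {E : Type*} [NormedAddCommGroup E] [NormedSpace ℝ E] (a : ℝ)
    {v : ℝ × K → E} (hv : StronglyMeasurable v) :
    StronglyMeasurable fun x : ℝ × K => ∫ t in a..x.1, v (t, x.2) := by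
  have hv' : StronglyMeasurable fun y : ℝ × ℝ × K => v (y.1, y.2.2) :=
    hv.comp_measurable (by fun_prop)
  have hright : MeasurableSet {y : (ℝ × K) × ℝ | y.2 ∈ Ioc a y.1.1} :=
    (measurableSet_lt measurable_const measurable_snd).inter
      (measurableSet_le measurable_snd (by fun_prop))
  have hleft : MeasurableSet {y : (ℝ × K) × ℝ | y.2 ∈ Ioc y.1.1 a} :=
    (measurableSet_lt (by fun_prop) measurable_snd).inter
      (measurableSet_le measurable_snd measurable_const)
  exact (stronglyMeasurable_setIntegral hv' hright).sub (stronglyMeasurable_setIntegral hv' hleft)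

section Traces

variable [SFinite ν] {u v : Lp ℂ 2 (G.wt ν)} {lam : ℝ}

theorem IsZDeriv.ae_eq_zero (h : G.IsZDeriv ν u v) (hu : ∀ᵐ x ∂G.dom ν, u x = 0) :
    ∀ᵐ x ∂G.dom ν, v x = 0 := by
  obtain ⟨c, hc⟩ := h
  have hprim : ∀ᵐ x ∂G.dom ν, c x.2 + ∫ t in (-G.ξ)..x.1, v (t, x.2) = 0 := by
    filter_upwards [hc, hu] with x hx hux
    rw [← hx, hux]
  refine ae_of_ae_swap ?_ (measurable_coeFn v (measurableSet_singleton 0))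
  filter_upwards [ae_swap hprim, integrable_slice v] with k hk hv
  exact ae_eq_zero_of_primitive_eq_zero hv hk

/-- The Sobolev embedding in `z`, on almost every slice. -/
theorem IsZDeriv.ae_sq_norm_le (h : G.IsZDeriv ν u v) :
    ∀ᵐ x ∂G.dom ν,
      ‖u x‖ ^ 2 ≤ 2 / G.len * G.sliceSq 0 u x.2 + 2 * G.len * G.sliceSq 0 v x.2 := by
  obtain ⟨c, hc⟩ := h
  have hu_meas := measurable_coeFn u
  have hu_slice := G.measurable_sliceSq 0 hu_meas
  have hv_slice := G.measurable_sliceSq 0 (measurable_coeFn v)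
  refine ae_of_ae_swap ?_ (measurableSet_le (by fun_prop) (by fun_prop))
  filter_upwards [ae_swap hc, ae_memLp_slice u, ae_memLp_slice v] with k hk hu hv
  simpa [sliceSq, sub_neg_eq_len, len] using ae_sq_norm_le_of_primitive hu hv hk

theorem TraceAt.ae_weighted_sq_le (h : G.TraceAt ν (-G.ξ) u v 0) (hlam : 0 < lam) :
    ∀ᵐ x ∂G.dom ν,
      (‖u x‖ * Real.exp (-lam * x.1)) ^ 2 ≤ 1 / (2 * lam) * G.sliceSq lam v x.2 := by
  have hu_meas := measurable_coeFn u
  have hv_slice := G.measurable_sliceSq lam (measurable_coeFn v)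
  refine ae_of_ae_swap ?_ (measurableSet_le (by fun_prop) (by fun_prop))
  filter_upwards [ae_swap h, ae_memLp_slice v] with k hk hv
  filter_upwards [hk, ae_restrict_mem measurableSet_Ioo] with z hz hzm
  simpa only [hz, Pi.zero_apply, zero_add, sliceSq] using sq_weighted_primitive_le hlam hzm hv

theorem TraceAt.ae_weighted_le (h : G.TraceAt ν (-G.ξ) u v 0) (hlam : 0 < lam) {e : K → ℝ}
    (he_meas : Measurable e) (he : ∀ k, 0 ≤ e k)
    (hv : ∀ᵐ x ∂G.dom ν, ‖v x‖ * Real.exp (-lam * x.1) ≤ e x.2) :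
    ∀ᵐ x ∂G.dom ν, ‖u x‖ * Real.exp (-lam * x.1) ≤ e x.2 / lam := by
  have hu_meas := measurable_coeFn u
  refine ae_of_ae_swap ?_ (measurableSet_le (by fun_prop) (by fun_prop))
  filter_upwards [ae_swap h, ae_swap hv] with k hk hv
  filter_upwards [hk, ae_restrict_mem measurableSet_Ioo] with z hz hzm
  simpa only [hz, Pi.zero_apply, zero_add] using
    weighted_primitive_le_of_weighted_le hlam hzm (he k) hv

end Traces

end Box

end Slices

section Pointwise

variable {K : Type} [MeasurableSpace K] {G : Box} {ν : Measure K} [SFinite ν] {m : ℕ}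

theorem measurable_zD (f : Sob G ν m) (r : Fin (m + 1)) (j s : G.Node) :
    Measurable (zD f r j s) :=
  Box.measurable_coeFn _

theorem integrable_sq_zD (f : Sob G ν m) (r : Fin (m + 1)) (j s : G.Node) :
    Integrable (fun x => ‖zD f r j s x‖ ^ 2) (G.dom ν) :=
  Box.integrable_sq _

theorem ae_zD_add (f g : Sob G ν m) :
    ∀ᵐ x ∂G.dom ν, ∀ r j s, zD (f + g) r j s x = zD f r j s x + zD g r j s x := by
  simp only [ae_all_iff]
  exact fun r j s => Box.wt_ae.1 (Lp.coeFn_add (f.1 (j, s, r)) (g.1 (j, s, r)))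

theorem ae_zD_smul (c : ℝ) (f : Sob G ν m) :
    ∀ᵐ x ∂G.dom ν, ∀ r j s, zD (c • f) r j s x = (c : ℂ) * zD f r j s x := by
  simp only [ae_all_iff]
  exact fun r j s => Box.wt_ae.1 (Lp.coeFn_smul c (f.1 (j, s, r)))

theorem lap_eq_add {f g e : Sob G ν 2} {x : ℝ × K}
    (h : ∀ r j s, zD e r j s x = zD f r j s x + zD g r j s x) (i l : Fin G.n) :
    lap e i l x = lap f i l x + lap g i l x := by
  simp only [lap, h]
  ring

theorem lap_eq_smul {c : ℝ} {f e : Sob G ν 2} {x : ℝ × K}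
    (h : ∀ r j s, zD e r j s x = (c : ℂ) * zD f r j s x) (i l : Fin G.n) :
    lap e i l x = (c : ℂ) * lap f i l x := by
  simp only [lap, h]
  ring

theorem grad_eq_add {f g e : Sob G ν 2} {x : ℝ × K}
    (h : ∀ r j s, zD e r j s x = zD f r j s x + zD g r j s x) (i l : Fin G.n) :
    grad e i l x = grad f i l x + grad g i l x := by
  simp only [grad, h]
  ext c
  fin_cases c <;> simp <;> ring

theorem grad_eq_smul {c : ℝ} {f e : Sob G ν 2} {x : ℝ × K}
    (h : ∀ r j s, zD e r j s x = (c : ℂ) * zD f r j s x) (i l : Fin G.n) :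
    grad e i l x = (c : ℂ) • grad f i l x := by
  simp only [grad, h]
  ext c
  fin_cases c <;> simp <;> ring

theorem measurable_lap (f : Sob G ν 2) (i l : Fin G.n) : Measurable (lap f i l) := by
  have h := measurable_zD f
  unfold lap
  fun_prop

theorem measurable_grad (f : Sob G ν 2) (i l : Fin G.n) (c : Fin 3) :
    Measurable fun x => grad f i l x c := by
  have h := measurable_zD f
  fin_cases c <;> simp only [grad, Fin.reduceFinMk, Fin.isValue, Fin.zero_eta, Fin.mk_one,
    Matrix.cons_val, Matrix.cons_val_zero, Matrix.cons_val_one] <;> fun_prop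

theorem norm_second_difference_le {a b c : ℂ} {A : ℝ} (h : ℝ) (ha : ‖a‖ ≤ A) (hb : ‖b‖ ≤ A)
    (hc : ‖c‖ ≤ A) : ‖(a - 2 * b + c) / (h : ℂ) ^ 2‖ ≤ 4 / h ^ 2 * A := by
  have hnum : ‖a - 2 * b + c‖ ≤ 4 * A := by
    calc ‖a - 2 * b + c‖ ≤ ‖a‖ + ‖2 * b‖ + ‖c‖ :=
          (norm_add_le _ _).trans (by gcongr; exact norm_sub_le _ _)
      _ ≤ A + 2 * A + A := by
          rw [norm_mul, Complex.norm_ofNat]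
          gcongr
      _ = 4 * A := by ring
  rw [norm_div, norm_pow, Complex.norm_real, Real.norm_eq_abs, sq_abs, div_mul_eq_mul_div]
  gcongr

theorem norm_central_difference_le {a b : ℂ} {A h : ℝ} (hh : 0 < h) (ha : ‖a‖ ≤ A)
    (hb : ‖b‖ ≤ A) : ‖(a - b) / (2 * (h : ℂ))‖ ≤ 1 / h * A := by
  have hnum : ‖a - b‖ ≤ 2 * A := (norm_sub_le _ _).trans (by linarith)
  rw [norm_div, norm_mul, Complex.norm_real, Real.norm_of_nonneg hh.le, Complex.norm_ofNat]
  calc ‖a - b‖ / (2 * h) ≤ 2 * A / (2 * h) := by gcongr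
    _ = 1 / h * A := by field_simp

theorem norm_lap_sub_le {f : Sob G ν 2} {x : ℝ × K} {A : ℝ} (h : ∀ j s, ‖zD f 0 j s x‖ ≤ A)
    (i l : Fin G.n) :
    ‖lap f i l x - zD f 2 (G.mid i) (G.mid l) x‖ ≤ 8 / G.h ^ 2 * A := by
  rw [lap, add_assoc, add_sub_cancel_left]
  calc _ ≤ 4 / G.h ^ 2 * A + 4 / G.h ^ 2 * A := norm_add_le_of_le
        (norm_second_difference_le _ (h _ _) (h _ _) (h _ _))
        (norm_second_difference_le _ (h _ _) (h _ _) (h _ _))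
    _ = 8 / G.h ^ 2 * A := by ring

theorem norm_grad_le {f : Sob G ν 2} {x : ℝ × K} {A : ℝ} {i l : Fin G.n}
    (h0 : ∀ j s, ‖zD f 0 j s x‖ ≤ A) (h1 : ‖zD f 1 (G.mid i) (G.mid l) x‖ ≤ A) (c : Fin 3) :
    ‖grad f i l x c‖ ≤ (1 + 1 / G.h) * A := by
  have hA : 0 ≤ A := (norm_nonneg _).trans h1
  have hh : 0 ≤ 1 / G.h * A := mul_nonneg (one_div_pos.2 G.h_pos).le hA
  rw [one_add_mul]
  fin_cases c
  · exact (norm_central_difference_le G.h_pos (h0 _ _) (h0 _ _)).trans (le_add_of_nonneg_left hA)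
  · exact (norm_central_difference_le G.h_pos (h0 _ _) (h0 _ _)).trans (le_add_of_nonneg_left hA)
  · exact h1.trans (le_add_of_nonneg_right hh)

theorem norm_sq_eq_sum (f : Sob G ν m) :
    ‖f‖ ^ 2 = G.h ^ 2 * ∑ a : G.Node × G.Node × Fin (m + 1),
      ∫ x, ‖zD f a.2.2 a.1 a.2.1 x‖ ^ 2 ∂G.dom ν := by
  rw [Submodule.coe_norm, PiLp.norm_sq_eq_of_L2 _ f.1, Finset.mul_sum]
  exact Finset.sum_congr rfl fun a _ => Box.norm_sq_eq _

/-- The pointwise square norm `∑_{j,s,r} |∂_z^r f(x_j, y_s, z, k)|²` over all nodes and orders. -/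
def totalSq (f : Sob G ν m) (x : ℝ × K) : ℝ :=
  ∑ a : G.Node × G.Node × Fin (m + 1), ‖zD f a.2.2 a.1 a.2.1 x‖ ^ 2

theorem totalSq_nonneg (f : Sob G ν m) (x : ℝ × K) : 0 ≤ totalSq f x :=
  Finset.sum_nonneg fun _ _ => sq_nonneg _

theorem integrable_totalSq (f : Sob G ν m) : Integrable (totalSq f) (G.dom ν) :=
  integrable_finsetSum _ fun _ _ => integrable_sq_zD f _ _ _

theorem integral_totalSq (f : Sob G ν m) :
    ∫ x, totalSq f x ∂G.dom ν = ‖f‖ ^ 2 / G.h ^ 2 := by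
  rw [norm_sq_eq_sum, mul_div_cancel_left₀ _ (pow_ne_zero 2 G.h_pos.ne')]
  exact integral_finsetSum _ fun _ _ => integrable_sq_zD f _ _ _

theorem norm_zD_le_sqrt_totalSq (f : Sob G ν m) (r : Fin (m + 1)) (j s : G.Node) (x : ℝ × K) :
    ‖zD f r j s x‖ ≤ √(totalSq f x) :=
  Real.le_sqrt_of_sq_le (Finset.single_le_sum
    (f := fun a : G.Node × G.Node × Fin (m + 1) => ‖zD f a.2.2 a.1 a.2.1 x‖ ^ 2)
    (fun _ _ => sq_nonneg _) (Finset.mem_univ (j, s, r)))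

theorem sq_norm_lap_le (f : Sob G ν 2) (i l : Fin G.n) (x : ℝ × K) :
    ‖lap f i l x‖ ^ 2 ≤ (1 + 8 / G.h ^ 2) ^ 2 * totalSq f x := by
  have hlap : ‖lap f i l x‖ ≤ (1 + 8 / G.h ^ 2) * √(totalSq f x) := by
    linarith [norm_lap_sub_le (norm_zD_le_sqrt_totalSq f 0 · · x) i l,
      norm_zD_le_sqrt_totalSq f 2 (G.mid i) (G.mid l) x,
      norm_le_norm_add_norm_sub' (lap f i l x) (zD f 2 (G.mid i) (G.mid l) x)]
  calc ‖lap f i l x‖ ^ 2 ≤ ((1 + 8 / G.h ^ 2) * √(totalSq f x)) ^ 2 := by gcongr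
    _ = (1 + 8 / G.h ^ 2) ^ 2 * totalSq f x := by rw [mul_pow, Real.sq_sqrt (totalSq_nonneg _ _)]

theorem integrable_sq_lap (f : Sob G ν 2) (i l : Fin G.n) :
    Integrable (fun x => ‖lap f i l x‖ ^ 2) (G.dom ν) := by
  refine ((integrable_totalSq f).const_mul ((1 + 8 / G.h ^ 2) ^ 2)).mono'
    ((measurable_lap f i l).norm.pow_const 2).aestronglyMeasurable (.of_forall fun x => ?_)
  rw [Real.norm_of_nonneg (sq_nonneg _)]
  exact sq_norm_lap_le f i l x

theorem integral_sq_lap_le (f : Sob G ν 2) (i l : Fin G.n) :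
    ∫ x, ‖lap f i l x‖ ^ 2 ∂G.dom ν ≤ (1 + 8 / G.h ^ 2) ^ 2 * (‖f‖ ^ 2 / G.h ^ 2) := by
  rw [← integral_totalSq, ← integral_const_mul]
  exact integral_mono (integrable_sq_lap f i l) ((integrable_totalSq f).const_mul _)
    (sq_norm_lap_le f i l)

/-- The square norm `∑_{j,s,r} ∫ |∂_z^r f(x_j, y_s, z, k)|² dz` of the slice of `f` at `k`. -/
def totalSlice (f : Sob G ν m) (k : K) : ℝ :=
  ∑ a : G.Node × G.Node × Fin (m + 1), G.sliceSq 0 (zD f a.2.2 a.1 a.2.1) k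

theorem totalSlice_nonneg (f : Sob G ν m) (k : K) : 0 ≤ totalSlice f k :=
  Finset.sum_nonneg fun _ _ => G.sliceSq_nonneg _ _ _

theorem measurable_totalSlice (f : Sob G ν m) : Measurable (totalSlice f) :=
  Finset.measurable_fun_sum _ fun _ _ => G.measurable_sliceSq _ (measurable_zD f _ _ _)

theorem integrable_totalSlice (f : Sob G ν m) : Integrable (totalSlice f) ν :=
  integrable_finsetSum _ fun _ _ => Box.integrable_sliceSq 0 (integrable_sq_zD f _ _ _)

theorem integral_totalSlice (f : Sob G ν m) :
    ∫ k, totalSlice f k ∂ν = ‖f‖ ^ 2 / G.h ^ 2 := by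
  rw [norm_sq_eq_sum, mul_div_cancel_left₀ _ (pow_ne_zero 2 G.h_pos.ne')]
  unfold totalSlice
  rw [integral_finsetSum _ fun _ _ => Box.integrable_sliceSq 0 (integrable_sq_zD f _ _ _)]
  refine Finset.sum_congr rfl fun a _ => ?_
  rw [Box.integral_sliceSq 0 (integrable_sq_zD f _ _ _)]
  simp only [mul_zero, zero_mul, Real.exp_zero, mul_one]

theorem sliceSq_zD_le_totalSlice (f : Sob G ν m) (r : Fin (m + 1)) (j s : G.Node) (k : K) :
    G.sliceSq 0 (zD f r j s) k ≤ totalSlice f k :=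
  Finset.single_le_sum
    (f := fun a : G.Node × G.Node × Fin (m + 1) => G.sliceSq 0 (zD f a.2.2 a.1 a.2.1) k)
    (fun _ _ => G.sliceSq_nonneg _ _ _) (Finset.mem_univ (j, s, r))

theorem ae_norm_zD_castSucc_le (f : Sob G ν (m + 1)) :
    ∀ᵐ x ∂G.dom ν, ∀ (r : Fin (m + 1)) j s,
      ‖zD f r.castSucc j s x‖ ≤ √(2 / G.len + 2 * G.len) * √(totalSlice f x.2) := by
  have hlen := G.len_pos
  simp only [ae_all_iff]
  intro r j s
  filter_upwards [(f.2 j s r).ae_sq_norm_le] with x hx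
  rw [← Real.sqrt_mul (by positivity), add_mul]
  refine Real.le_sqrt_of_sq_le (hx.trans ?_)
  gcongr <;> exact sliceSq_zD_le_totalSlice f _ j s x.2

/-- The constant of the embedding of `H^{2,h}` into functions with bounded gradient. -/
def Box.supConst (G : Box) : ℝ := (1 + 1 / G.h) * √(2 / G.len + 2 * G.len)

theorem Box.supConst_nonneg (G : Box) : 0 ≤ G.supConst :=
  mul_nonneg (by linarith [one_div_pos.2 G.h_pos]) (Real.sqrt_nonneg _)

theorem ae_norm_grad_le (f : Sob G ν 2) :
    ∀ᵐ x ∂G.dom ν, ∀ i l c, ‖grad f i l x c‖ ≤ G.supConst * √(totalSlice f x.2) := by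
  filter_upwards [ae_norm_zD_castSucc_le f] with x hx i l c
  rw [Box.supConst, mul_assoc]
  exact norm_grad_le (hx 0) (hx 1 _ _) c

end Pointwise

/-! ## The Carleman estimate -/

section Carleman

theorem sum_sum_le {n : ℕ} {f : Fin n → Fin n → ℝ} {c : ℝ} (h : ∀ i l, f i l ≤ c) :
    ∑ i, ∑ l, f i l ≤ n ^ 2 * c := by
  calc ∑ i, ∑ l, f i l ≤ ∑ _i : Fin n, ∑ _l : Fin n, c := by
        gcongr with i _ l _
        exact h i l
    _ = n ^ 2 * c := by
        simp only [Finset.sum_const, Finset.card_univ, Fintype.card_fin, nsmul_eq_mul]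
        ring

theorem le_sum_sum {n : ℕ} {f : Fin n → Fin n → ℝ} (h : ∀ i l, 0 ≤ f i l) (i l : Fin n) :
    f i l ≤ ∑ i, ∑ l, f i l :=
  (Finset.single_le_sum (fun l _ => h i l) (Finset.mem_univ l)).trans
    (Finset.single_le_sum (f := fun i => ∑ l, f i l)
      (fun i _ => Finset.sum_nonneg fun l _ => h i l) (Finset.mem_univ i))

variable {K : Type} [MeasurableSpace K] {G : Box} {ν : Measure K} {lam : ℝ}

namespace Box

theorem lateral_or_mid (G : Box) (j s : G.Node) :
    G.Lateral j s ∨ ∃ i l, j = G.mid i ∧ s = G.mid l := by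
  have node_cases : ∀ j : G.Node, j = 0 ∨ j = Fin.last (G.n + 1) ∨ ∃ i, j = G.mid i := by
    intro j
    induction j using Fin.cases with
    | zero => exact .inl rfl
    | succ j =>
      induction j using Fin.lastCases with
      | last => exact .inr (.inl (Fin.succ_last _))
      | cast i => exact .inr (.inr ⟨i, rfl⟩)
  unfold Box.Lateral
  rcases node_cases j with hj | hj | ⟨i, hj⟩
  · exact .inl (.inl hj)
  · exact .inl (.inr (.inl hj))
  · rcases node_cases s with hs | hs | ⟨l, hs⟩
    · exact .inl (.inr (.inr (.inl hs)))
    · exact .inl (.inr (.inr (.inr hs)))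
    · exact .inr ⟨i, l, hj, hs⟩

/-- The Carleman-weighted square norm `∫∫ |f(z, k)|² e^{-2λz} dz dν(k)`. -/
def weightedNormSq (G : Box) (ν : Measure K) (lam : ℝ) (f : ℝ × K → ℂ) : ℝ :=
  ∫ x, ‖f x‖ ^ 2 * Real.exp (-2 * lam * x.1) ∂G.dom ν

theorem weightedNormSq_nonneg (f : ℝ × K → ℂ) : 0 ≤ G.weightedNormSq ν lam f :=
  integral_nonneg fun _ => by positivity

/-- An upper bound of the weight `e^{-2λz}` on the box. -/
def wMax (G : Box) (lam : ℝ) : ℝ := Real.exp (2 * lam * G.ξ)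

theorem wMax_pos (G : Box) (lam : ℝ) : 0 < G.wMax lam := Real.exp_pos _

theorem exp_le_wMax {z : ℝ} (hlam : 0 ≤ lam) (hz : z ∈ Ioo (-G.ξ) G.d) :
    Real.exp (-2 * lam * z) ≤ G.wMax lam := by
  refine Real.exp_le_exp.2 ?_
  nlinarith [hz.1]

variable {f : ℝ × K → ℂ}

theorem weightedNormSq_eq_zero (hf : ∀ᵐ x ∂G.dom ν, f x = 0) : G.weightedNormSq ν lam f = 0 := by
  refine integral_eq_zero_of_ae ?_
  filter_upwards [hf] with x hx
  simp [hx]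

variable [SFinite ν]

theorem weightedNormSq_le_integral_sq {e : K → ℝ}
    (hf : Integrable (fun x => ‖f x‖ ^ 2) (G.dom ν)) (he : Integrable (fun k => e k ^ 2) ν)
    (hfe : ∀ᵐ x ∂G.dom ν, ‖f x‖ * Real.exp (-lam * x.1) ≤ e x.2) :
    G.weightedNormSq ν lam f ≤ G.len * ∫ k, e k ^ 2 ∂ν := by
  rw [← integral_param]
  refine integral_mono_ae (integrable_mul_exp lam hf) (integrable_param he) ?_
  filter_upwards [hfe] with x hx
  rw [← sq_exp_neg_mul, ← mul_pow]
  exact pow_le_pow_left₀ (by positivity) hx 2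

theorem integral_sq_norm_le_weighted (hlam : 0 ≤ lam)
    (hf : Integrable (fun x => ‖f x‖ ^ 2) (G.dom ν)) :
    ∫ x, ‖f x‖ ^ 2 ∂G.dom ν ≤ Real.exp (2 * lam * G.d) * G.weightedNormSq ν lam f := by
  rw [weightedNormSq, ← integral_const_mul]
  refine integral_mono_ae hf ((integrable_mul_exp lam hf).const_mul _) ?_
  filter_upwards [Box.ae_mem] with x hx
  have one_le : 1 ≤ Real.exp (2 * lam * G.d) * Real.exp (-2 * lam * x.1) := by
    rw [← Real.exp_add]
    exact Real.one_le_exp (by nlinarith [hx.2])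
  calc ‖f x‖ ^ 2 ≤ ‖f x‖ ^ 2 * (Real.exp (2 * lam * G.d) * Real.exp (-2 * lam * x.1)) :=
        le_mul_of_one_le_right (sq_nonneg _) one_le
    _ = _ := by ring

theorem weightedNormSq_le (hlam : 0 ≤ lam) (hf : Integrable (fun x => ‖f x‖ ^ 2) (G.dom ν)) :
    G.weightedNormSq ν lam f ≤ G.wMax lam * ∫ x, ‖f x‖ ^ 2 ∂G.dom ν := by
  rw [weightedNormSq, ← integral_const_mul]
  refine integral_mono_ae (integrable_mul_exp lam hf) (hf.const_mul _) ?_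
  filter_upwards [Box.ae_mem] with x hx
  rw [mul_comm]
  exact mul_le_mul_of_nonneg_right (exp_le_wMax hlam hx) (sq_nonneg _)

end Box

variable [SFinite ν]

theorem ae_zD_lateral (u : Sob₀ G ν) (r : Fin 3) {j s : G.Node} (h : G.Lateral j s) :
    ∀ᵐ x ∂G.dom ν, zD u.1 r j s x = 0 := by
  have h0 : ∀ᵐ x ∂G.dom ν, zD u.1 0 j s x = 0 := u.2.2.2.2 j s h
  have h1 : ∀ᵐ x ∂G.dom ν, zD u.1 1 j s x = 0 := (u.1.2 j s 0).ae_eq_zero h0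
  have h2 : ∀ᵐ x ∂G.dom ν, zD u.1 2 j s x = 0 := (u.1.2 j s 1).ae_eq_zero h1
  fin_cases r
  exacts [h0, h1, h2]

/-- The slice `∑ ∫ |u_zz|² e^{-2λz} dz` at `k` of `energy`. -/
def energySlice (lam : ℝ) (u : Sob₀ G ν) (k : K) : ℝ :=
  ∑ i, ∑ l, G.sliceSq lam (zD u.1 2 (G.mid i) (G.mid l)) k

/-- The principal part `∑ ∫∫ |u_zz|² e^{-2λz} dz dν` of the weighted norm, which controls all
the others since `u` vanishes to second order on `Γ`. -/
def energy (lam : ℝ) (u : Sob₀ G ν) : ℝ :=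
  ∑ i, ∑ l, G.weightedNormSq ν lam (zD u.1 2 (G.mid i) (G.mid l))

theorem energySlice_nonneg (lam : ℝ) (u : Sob₀ G ν) (k : K) : 0 ≤ energySlice lam u k :=
  Finset.sum_nonneg fun _ _ => Finset.sum_nonneg fun _ _ => G.sliceSq_nonneg _ _ _

theorem energy_nonneg (lam : ℝ) (u : Sob₀ G ν) : 0 ≤ energy lam u :=
  Finset.sum_nonneg fun _ _ => Finset.sum_nonneg fun _ _ => Box.weightedNormSq_nonneg _

theorem measurable_energySlice (lam : ℝ) (u : Sob₀ G ν) : Measurable (energySlice lam u) :=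
  Finset.measurable_fun_sum _ fun _ _ => Finset.measurable_fun_sum _ fun _ _ =>
    G.measurable_sliceSq _ (measurable_zD _ _ _ _)

theorem integrable_energySlice (lam : ℝ) (u : Sob₀ G ν) : Integrable (energySlice lam u) ν :=
  integrable_finsetSum _ fun _ _ => integrable_finsetSum _ fun _ _ =>
    Box.integrable_sliceSq lam (integrable_sq_zD _ _ _ _)

theorem integral_energySlice (lam : ℝ) (u : Sob₀ G ν) :
    ∫ k, energySlice lam u k ∂ν = energy lam u := by
  unfold energySlice energy
  rw [integral_finsetSum _ fun _ _ => integrable_finsetSum _ fun _ _ =>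
    Box.integrable_sliceSq lam (integrable_sq_zD _ _ _ _)]
  refine Finset.sum_congr rfl fun i _ => ?_
  rw [integral_finsetSum _ fun _ _ => Box.integrable_sliceSq lam (integrable_sq_zD _ _ _ _)]
  exact Finset.sum_congr rfl fun l _ => Box.integral_sliceSq lam (integrable_sq_zD _ _ _ _)

/-- The pointwise bound `(∑ ∫ |u_zz|² e^{-2λz} dz / 2λ)^{1/2}` of `|u_z| e^{-λz}`. -/
def weightedSup (lam : ℝ) (u : Sob₀ G ν) (k : K) : ℝ := √(energySlice lam u k / (2 * lam))

theorem weightedSup_nonneg (lam : ℝ) (u : Sob₀ G ν) (k : K) : 0 ≤ weightedSup lam u k :=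
  Real.sqrt_nonneg _

theorem measurable_weightedSup (lam : ℝ) (u : Sob₀ G ν) : Measurable (weightedSup lam u) :=
  ((measurable_energySlice lam u).div_const _).sqrt

theorem sq_weightedSup (hlam : 0 < lam) (u : Sob₀ G ν) (k : K) :
    weightedSup lam u k ^ 2 = energySlice lam u k / (2 * lam) :=
  Real.sq_sqrt (div_nonneg (energySlice_nonneg _ _ _) (by positivity))

theorem integrable_sq_weightedSup (hlam : 0 < lam) (u : Sob₀ G ν) :
    Integrable (fun k => weightedSup lam u k ^ 2) ν := by
  simpa only [sq_weightedSup hlam] using (integrable_energySlice lam u).div_const _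

theorem integral_sq_weightedSup (hlam : 0 < lam) (u : Sob₀ G ν) :
    ∫ k, weightedSup lam u k ^ 2 ∂ν = energy lam u / (2 * lam) := by
  simp only [sq_weightedSup hlam, integral_div, integral_energySlice]

theorem ae_weighted_zD_one_le (hlam : 0 < lam) (u : Sob₀ G ν) :
    ∀ᵐ x ∂G.dom ν, ∀ j s,
      ‖zD u.1 1 j s x‖ * Real.exp (-lam * x.1) ≤ weightedSup lam u x.2 := by
  simp only [ae_all_iff]
  intro j s
  rcases G.lateral_or_mid j s with h | ⟨i, l, rfl, rfl⟩
  · filter_upwards [ae_zD_lateral u 1 h] with x hx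
    simpa only [hx, norm_zero, zero_mul] using weightedSup_nonneg lam u x.2
  · filter_upwards [(u.2.2.1 i l).ae_weighted_sq_le hlam] with x hx
    refine Real.le_sqrt_of_sq_le (hx.trans ?_)
    rw [one_div_mul_eq_div]
    gcongr
    exact le_sum_sum (f := fun i l => G.sliceSq lam (zD u.1 2 (G.mid i) (G.mid l)) x.2)
      (fun _ _ => G.sliceSq_nonneg _ _ _) i l

theorem ae_weighted_zD_zero_le (hlam : 0 < lam) (u : Sob₀ G ν) :
    ∀ᵐ x ∂G.dom ν, ∀ j s,
      ‖zD u.1 0 j s x‖ * Real.exp (-lam * x.1) ≤ weightedSup lam u x.2 / lam := by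
  simp only [ae_all_iff]
  intro j s
  rcases G.lateral_or_mid j s with h | ⟨i, l, rfl, rfl⟩
  · filter_upwards [ae_zD_lateral u 0 h] with x hx
    simpa only [hx, norm_zero, zero_mul] using div_nonneg (weightedSup_nonneg lam u x.2) hlam.le
  · refine (u.2.1 i l).ae_weighted_le hlam (measurable_weightedSup lam u)
      (weightedSup_nonneg lam u) ?_
    filter_upwards [ae_weighted_zD_one_le hlam u] with x hx
    exact hx _ _

theorem weightedNormSq_zD_one_le (hlam : 0 < lam) (u : Sob₀ G ν) (j s : G.Node) :
    G.weightedNormSq ν lam (zD u.1 1 j s) ≤ G.len / (2 * lam) * energy lam u := by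
  calc _ ≤ G.len * ∫ k, weightedSup lam u k ^ 2 ∂ν :=
        Box.weightedNormSq_le_integral_sq (integrable_sq_zD _ _ _ _)
          (integrable_sq_weightedSup hlam u)
          ((ae_weighted_zD_one_le hlam u).mono fun x hx => hx j s)
    _ = G.len / (2 * lam) * energy lam u := by rw [integral_sq_weightedSup hlam]; ring

theorem weightedNormSq_zD_zero_le (hlam : 0 < lam) (u : Sob₀ G ν) (j s : G.Node) :
    G.weightedNormSq ν lam (zD u.1 0 j s) ≤ G.len / (2 * lam ^ 3) * energy lam u := by
  have hinteg : Integrable (fun k => (weightedSup lam u k / lam) ^ 2) ν := by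
    simpa only [div_pow] using (integrable_sq_weightedSup hlam u).div_const _
  calc _ ≤ G.len * ∫ k, (weightedSup lam u k / lam) ^ 2 ∂ν :=
        Box.weightedNormSq_le_integral_sq (integrable_sq_zD _ _ _ _) hinteg
          ((ae_weighted_zD_zero_le hlam u).mono fun x hx => hx j s)
    _ = G.len / (2 * lam ^ 3) * energy lam u := by
        simp only [div_pow, integral_div, integral_sq_weightedSup hlam]
        field_simp

theorem weightedNormSq_zD_two_le (lam : ℝ) (u : Sob₀ G ν) (j s : G.Node) :
    G.weightedNormSq ν lam (zD u.1 2 j s) ≤ energy lam u := by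
  rcases G.lateral_or_mid j s with h | ⟨i, l, rfl, rfl⟩
  · rw [Box.weightedNormSq_eq_zero (ae_zD_lateral u 2 h)]
    exact energy_nonneg lam u
  · exact le_sum_sum (f := fun i l => G.weightedNormSq ν lam (zD u.1 2 (G.mid i) (G.mid l)))
      (fun _ _ => Box.weightedNormSq_nonneg _) i l

/-- The weighted norm `∑ ∫∫ |Δ^h u|² e^{-2λz} dz dν` of the Laplacian. -/
def lapEnergy (lam : ℝ) (u : Sob G ν 2) : ℝ :=
  ∑ i, ∑ l, G.weightedNormSq ν lam (lap u i l)

theorem lapEnergy_nonneg (lam : ℝ) (u : Sob G ν 2) : 0 ≤ lapEnergy lam u :=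
  Finset.sum_nonneg fun _ _ => Finset.sum_nonneg fun _ _ => Box.weightedNormSq_nonneg _

theorem ae_weighted_zD_two_le (hlam : 0 < lam) (u : Sob₀ G ν) :
    ∀ᵐ x ∂G.dom ν, ∀ i l,
      ‖zD u.1 2 (G.mid i) (G.mid l) x‖ * Real.exp (-lam * x.1)
        ≤ ‖lap u.1 i l x‖ * Real.exp (-lam * x.1)
          + 8 / G.h ^ 2 * (weightedSup lam u x.2 / lam) := by
  filter_upwards [ae_weighted_zD_zero_le hlam u] with x hx i l
  have hw := Real.exp_pos (-lam * x.1)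
  have hsub := norm_lap_sub_le (fun j s => (le_div_iff₀ hw).2 (hx j s)) i l
  have htri := norm_le_norm_add_norm_sub (lap u.1 i l x) (zD u.1 2 (G.mid i) (G.mid l) x)
  calc _ ≤ (‖lap u.1 i l x‖
          + 8 / G.h ^ 2 * (weightedSup lam u x.2 / lam / Real.exp (-lam * x.1)))
        * Real.exp (-lam * x.1) := by
        gcongr
        exact htri.trans (by gcongr)
    _ = _ := by field_simp

theorem weightedNormSq_zD_two_le_lap (hlam : 0 < lam) (u : Sob₀ G ν) (i l : Fin G.n) :
    G.weightedNormSq ν lam (zD u.1 2 (G.mid i) (G.mid l))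
      ≤ 2 * G.weightedNormSq ν lam (lap u.1 i l)
        + 64 * G.len / G.h ^ 4 / lam ^ 3 * energy lam u := by
  have hlap := (Box.integrable_mul_exp lam (integrable_sq_lap u.1 i l)).const_mul 2
  have hdiff : Integrable (fun x : ℝ × K => 128 / G.h ^ 4 / lam ^ 2 * weightedSup lam u x.2 ^ 2)
      (G.dom ν) := Box.integrable_param ((integrable_sq_weightedSup hlam u).const_mul _)
  have hdiff_eq : ∫ x, 128 / G.h ^ 4 / lam ^ 2 * weightedSup lam u x.2 ^ 2 ∂G.dom ν
      = 64 * G.len / G.h ^ 4 / lam ^ 3 * energy lam u := by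
    have hh := G.h_pos
    rw [integral_const_mul, Box.integral_param (fun k => weightedSup lam u k ^ 2),
      integral_sq_weightedSup hlam]
    field_simp
    ring
  rw [← hdiff_eq, Box.weightedNormSq, Box.weightedNormSq, ← integral_const_mul,
    ← integral_add hlap hdiff]
  refine integral_mono_ae (Box.integrable_mul_exp lam (integrable_sq_zD _ _ _ _))
    (hlap.add hdiff) ?_
  filter_upwards [ae_weighted_zD_two_le hlam u] with x hx
  rw [← sq_exp_neg_mul, ← mul_pow, ← mul_pow]
  calc _ ≤ (‖lap u.1 i l x‖ * Real.exp (-lam * x.1)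
          + 8 / G.h ^ 2 * (weightedSup lam u x.2 / lam)) ^ 2 :=
        pow_le_pow_left₀ (by positivity) (hx i l) 2
    _ ≤ 2 * ((‖lap u.1 i l x‖ * Real.exp (-lam * x.1)) ^ 2
          + (8 / G.h ^ 2 * (weightedSup lam u x.2 / lam)) ^ 2) := add_sq_le
    _ = _ := by ring

namespace Box

/-- The threshold `λ₀`: beyond it the second differences are absorbed in the Carleman
estimate. -/
def carlemanParam (G : Box) : ℝ := 2 + 128 * G.n ^ 2 * G.len / G.h ^ 4

theorem two_le_carlemanParam (G : Box) : 2 ≤ G.carlemanParam :=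
  le_add_of_nonneg_right (by have := G.len_pos; have := G.h_pos; positivity)

theorem absorb_second_differences (hlam : G.carlemanParam ≤ lam) :
    G.n ^ 2 * (64 * G.len / G.h ^ 4 / lam ^ 3) ≤ 1 / 2 := by
  have two_le : 2 ≤ lam := G.two_le_carlemanParam.trans hlam
  have le_cube : lam ≤ lam ^ 3 := le_self_pow₀ (by linarith) three_ne_zero
  have le_param : 128 * G.n ^ 2 * G.len / G.h ^ 4 ≤ lam := by
    unfold carlemanParam at hlam
    linarith
  calc G.n ^ 2 * (64 * G.len / G.h ^ 4 / lam ^ 3)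
      = (128 * G.n ^ 2 * G.len / G.h ^ 4) / lam ^ 3 * (1 / 2) := by ring
    _ ≤ 1 * (1 / 2) := by
        gcongr
        exact (div_le_one (by positivity)).2 (le_param.trans le_cube)
    _ = 1 / 2 := one_mul _

end Box

theorem energy_le_lapEnergy (hlam : G.carlemanParam ≤ lam) (u : Sob₀ G ν) :
    energy lam u ≤ 4 * lapEnergy lam u.1 := by
  have hlam_pos : 0 < lam := by linarith [G.two_le_carlemanParam]
  have hsum : energy lam u ≤ 2 * lapEnergy lam u.1
      + G.n ^ 2 * (64 * G.len / G.h ^ 4 / lam ^ 3) * energy lam u := by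
    calc energy lam u ≤ ∑ i, ∑ l, (2 * G.weightedNormSq ν lam (lap u.1 i l)
          + 64 * G.len / G.h ^ 4 / lam ^ 3 * energy lam u) :=
          Finset.sum_le_sum fun i _ => Finset.sum_le_sum fun l _ =>
            weightedNormSq_zD_two_le_lap hlam_pos u i l
      _ = _ := by
          simp only [Finset.sum_add_distrib, ← Finset.mul_sum, Finset.sum_const, Finset.card_univ,
            Fintype.card_fin, nsmul_eq_mul, lapEnergy]
          ring
  have habsorb := mul_le_mul_of_nonneg_right (Box.absorb_second_differences hlam)
    (energy_nonneg lam u)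
  linarith

/-- The constant of the Carleman estimate. -/
def Box.carlemanConst (G : Box) : ℝ := 1 / (4 * (1 + G.n ^ 2 * G.len))

theorem Box.carlemanConst_pos (G : Box) : 0 < G.carlemanConst := by
  have := G.len_pos
  unfold Box.carlemanConst
  positivity

theorem weightedSq_eq (G : Box) (lam : ℝ) (u : Fin G.n → Fin G.n → ℝ × Unit → ℂ) :
    weightedSq G lam u
      = G.h ^ 2 * ∑ i, ∑ l, G.weightedNormSq (Measure.dirac ()) lam (u i l) := by
  simp only [weightedSq, Finset.mul_sum, Box.weightedNormSq]

theorem sum_weightedNormSq_zD_one_le (hlam : 0 < lam) (u : Sob₀ G ν) :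
    lam * ∑ i, ∑ l, G.weightedNormSq ν lam (zD u.1 1 (G.mid i) (G.mid l))
      ≤ G.n ^ 2 * G.len / 2 * energy lam u := by
  calc _ ≤ lam * (G.n ^ 2 * (G.len / (2 * lam) * energy lam u)) := by
        gcongr
        exact sum_sum_le fun i l => weightedNormSq_zD_one_le hlam u _ _
    _ = _ := by field_simp

theorem sum_weightedNormSq_zD_zero_le (hlam : 0 < lam) (u : Sob₀ G ν) :
    lam ^ 3 * ∑ i, ∑ l, G.weightedNormSq ν lam (zD u.1 0 (G.mid i) (G.mid l))
      ≤ G.n ^ 2 * G.len / 2 * energy lam u := by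
  calc _ ≤ lam ^ 3 * (G.n ^ 2 * (G.len / (2 * lam ^ 3) * energy lam u)) := by
        gcongr
        exact sum_sum_le fun i l => weightedNormSq_zD_zero_le hlam u _ _
    _ = _ := by field_simp

theorem carlemanEstimate (hlam : G.carlemanParam ≤ lam) :
    CarlemanEstimate G G.carlemanConst lam := by
  intro u
  have hlam_pos : 0 < lam := by linarith [G.two_le_carlemanParam]
  have hlen := G.len_pos
  have hC := G.carlemanConst_pos
  have hcancel : G.carlemanConst * (energy lam u + G.n ^ 2 * G.len / 2 * energy lam u
      + G.n ^ 2 * G.len / 2 * energy lam u) = energy lam u / 4 := by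
    unfold Box.carlemanConst
    field_simp
    ring
  simp only [weightedSq_eq]
  calc _ = G.h ^ 2 * (G.carlemanConst * (energy lam u
          + lam * ∑ i, ∑ l, G.weightedNormSq (.dirac ()) lam (zD u.1 1 (G.mid i) (G.mid l))
          + lam ^ 3 * ∑ i, ∑ l,
            G.weightedNormSq (.dirac ()) lam (zD u.1 0 (G.mid i) (G.mid l)))) := by
        unfold energy
        ring
    _ ≤ G.h ^ 2 * (G.carlemanConst * (energy lam u + G.n ^ 2 * G.len / 2 * energy lam u
          + G.n ^ 2 * G.len / 2 * energy lam u)) := by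
        gcongr G.h ^ 2 * (G.carlemanConst * (energy lam u + ?_ + ?_))
        · exact sum_weightedNormSq_zD_one_le hlam_pos u
        · exact sum_weightedNormSq_zD_zero_le hlam_pos u
    _ = G.h ^ 2 * (energy lam u / 4) := by rw [hcancel]
    _ ≤ G.h ^ 2 * lapEnergy lam u.1 := by
        gcongr
        linarith [energy_le_lapEnergy hlam u]

theorem weightedNormSq_zD_le_energy (hlam : 1 ≤ lam) (u : Sob₀ G ν) (r : Fin 3) (j s : G.Node) :
    G.weightedNormSq ν lam (zD u.1 r j s) ≤ (1 + G.len) * energy lam u := by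
  have hlam_pos : 0 < lam := by linarith
  have hlen := G.len_pos
  have hE := energy_nonneg lam u
  have hcube := one_le_pow₀ hlam (n := 3)
  fin_cases r
  · refine (weightedNormSq_zD_zero_le hlam_pos u j s).trans ?_
    gcongr
    linarith [div_le_self hlen.le (by linarith : 1 ≤ 2 * lam ^ 3)]
  · refine (weightedNormSq_zD_one_le hlam_pos u j s).trans ?_
    gcongr
    linarith [div_le_self hlen.le (by linarith : 1 ≤ 2 * lam)]
  · exact (weightedNormSq_zD_two_le lam u j s).trans (le_mul_of_one_le_left hE (by linarith))

/-- The constant in the bound of the norm of `u` by the weighted norm of `u_zz`. -/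
def Box.normConst (G : Box) : ℝ :=
  Fintype.card (G.Node × G.Node × Fin 3) * (G.h ^ 2 * (1 + G.len))

theorem Box.normConst_pos (G : Box) : 0 < G.normConst := by
  have := G.h_pos
  have := G.len_pos
  have : 0 < Fintype.card (G.Node × G.Node × Fin 3) := Fintype.card_pos
  unfold Box.normConst
  positivity

theorem norm_sq_le_energy (hlam : 1 ≤ lam) (u : Sob₀ G ν) :
    ‖u‖ ^ 2 ≤ G.normConst * (Real.exp (2 * lam * G.d) * energy lam u) := by
  have hnode (r : Fin 3) (j s) : ∫ x, ‖zD u.1 r j s x‖ ^ 2 ∂G.dom ν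
      ≤ Real.exp (2 * lam * G.d) * ((1 + G.len) * energy lam u) :=
    (Box.integral_sq_norm_le_weighted (by linarith) (integrable_sq_zD _ _ _ _)).trans
      (by gcongr; exact weightedNormSq_zD_le_energy hlam u r j s)
  rw [Submodule.coe_norm, norm_sq_eq_sum]
  calc _ ≤ G.h ^ 2 * ∑ a : G.Node × G.Node × Fin 3,
        Real.exp (2 * lam * G.d) * ((1 + G.len) * energy lam u) := by
        gcongr with a _
        exact hnode _ _ _
    _ = _ := by
        rw [Finset.sum_const, Finset.card_univ, nsmul_eq_mul, Box.normConst]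
        ring

theorem energy_le_norm_sq (hlam : 0 ≤ lam) (u : Sob₀ G ν) :
    energy lam u ≤ G.n ^ 2 * (G.wMax lam * (‖u‖ ^ 2 / G.h ^ 2)) := by
  refine sum_sum_le fun i l =>
    (Box.weightedNormSq_le hlam (integrable_sq_zD _ _ _ _)).trans ?_
  gcongr
  · exact (G.wMax_pos lam).le
  rw [Submodule.coe_norm, ← integral_totalSq]
  refine integral_mono (integrable_sq_zD _ _ _ _) (integrable_totalSq _) fun x => ?_
  exact (Real.le_sqrt (norm_nonneg _) (totalSq_nonneg _ _)).1 (norm_zD_le_sqrt_totalSq _ _ _ _ _)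

theorem lapEnergy_le_norm_sq (hlam : 0 ≤ lam) (u : Sob G ν 2) :
    lapEnergy lam u
      ≤ G.n ^ 2 * (G.wMax lam * ((1 + 8 / G.h ^ 2) ^ 2 * (‖u‖ ^ 2 / G.h ^ 2))) := by
  refine sum_sum_le fun i l =>
    (Box.weightedNormSq_le hlam (integrable_sq_lap _ _ _)).trans ?_
  gcongr
  · exact (G.wMax_pos lam).le
  · exact integral_sq_lap_le u i l

end Carleman

/-! ## Completeness of the spaces -/

section Complete

variable {K : Type} [MeasurableSpace K] {G : Box} {ν : Measure K}

theorem Box.TraceAt.unique {a : ℝ} {u u' v : Lp ℂ 2 (G.wt ν)}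
    (h : G.TraceAt ν a u v 0) (h' : G.TraceAt ν a u' v 0) : u = u' := by
  refine Lp.ext (Box.wt_ae.2 ?_)
  filter_upwards [h, h'] with x hx hx'
  rw [hx, hx']

theorem Box.ae_eq_zero_iff {v : Lp ℂ 2 (G.wt ν)} : (∀ᵐ x ∂G.dom ν, v x = 0) ↔ v = 0 := by
  rw [← Box.wt_ae, Lp.eq_zero_iff_ae_eq_zero]
  rfl

variable [SFinite ν] {a : ℝ}

namespace Box

theorem ae_sq_primitive_le (ha : a ∈ Icc (-G.ξ) G.d) (v : Lp ℂ 2 (G.wt ν)) :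
    ∀ᵐ x ∂G.dom ν, ‖∫ t in a..x.1, v (t, x.2)‖ ^ 2 ≤ G.len * G.sliceSq 0 v x.2 := by
  filter_upwards [Box.ae_param (Box.ae_memLp_slice v), Box.ae_mem] with x hslice hx
  simpa only [sub_neg_eq_len, sliceSq, mul_zero, zero_mul, Real.exp_zero, mul_one] using
    sq_norm_intervalIntegral_le hslice ha (Ioo_subset_Icc_self hx)

theorem memLp_primitive (ha : a ∈ Icc (-G.ξ) G.d) (v : Lp ℂ 2 (G.wt ν)) :
    MemLp (fun x : ℝ × K => ∫ t in a..x.1, v (t, x.2)) 2 (G.wt ν) := by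
  have hmeas := stronglyMeasurable_primitive a (Lp.stronglyMeasurable v)
  have hinteg : Integrable (fun x : ℝ × K => ‖∫ t in a..x.1, v (t, x.2)‖ ^ 2) (G.dom ν) := by
    refine Integrable.mono' (Box.integrable_param
      ((Box.integrable_sliceSq 0 (Box.integrable_sq v)).const_mul G.len))
      (hmeas.norm.pow 2).aestronglyMeasurable ?_
    filter_upwards [Box.ae_sq_primitive_le ha v] with x hx
    rwa [Real.norm_of_nonneg (sq_nonneg _)]
  exact (memLp_two_iff_integrable_sq_norm hmeas.aestronglyMeasurable).2
    (Box.integrable_wt_iff.2 hinteg)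

theorem traceAt_toLp (ha : a ∈ Icc (-G.ξ) G.d) (v : Lp ℂ 2 (G.wt ν)) :
    G.TraceAt ν a ((Box.memLp_primitive ha v).toLp _) v 0 := by
  filter_upwards [Box.wt_ae.1 (Box.memLp_primitive ha v).coeFn_toLp] with x hx
  rw [hx, Pi.zero_apply, zero_add]

theorem norm_toLp_primitive_le (ha : a ∈ Icc (-G.ξ) G.d) (v : Lp ℂ 2 (G.wt ν)) :
    ‖(Box.memLp_primitive ha v).toLp _‖ ≤ G.len * ‖v‖ := by
  have hlen := G.len_pos
  have hle : ∫ x, ‖(Box.memLp_primitive ha v).toLp _ x‖ ^ 2 ∂G.dom ν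
      ≤ ∫ x, G.len * G.sliceSq 0 v x.2 ∂G.dom ν := by
    refine integral_mono_ae (Box.integrable_sq _)
      (Box.integrable_param ((Box.integrable_sliceSq 0 (Box.integrable_sq v)).const_mul G.len)) ?_
    filter_upwards [Box.wt_ae.1 (Box.memLp_primitive ha v).coeFn_toLp,
      Box.ae_sq_primitive_le ha v] with x hx hle
    rwa [hx]
  have hslice : ∫ x, G.len * G.sliceSq 0 v x.2 ∂G.dom ν
      = G.len * (G.len * ∫ x, ‖v x‖ ^ 2 ∂G.dom ν) := by
    rw [Box.integral_param (fun k => G.len * G.sliceSq 0 v k), integral_const_mul,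
      Box.integral_sliceSq 0 (Box.integrable_sq v)]
    simp only [mul_zero, zero_mul, Real.exp_zero, mul_one]
  refine (sq_le_sq₀ (norm_nonneg _) (by positivity)).1 ?_
  calc _ = G.h ^ 2 * ∫ x, ‖(Box.memLp_primitive ha v).toLp _ x‖ ^ 2 ∂G.dom ν := Box.norm_sq_eq _
    _ ≤ G.h ^ 2 * (G.len * (G.len * ∫ x, ‖v x‖ ^ 2 ∂G.dom ν)) := by
        rw [← hslice]
        gcongr
    _ = (G.len * ‖v‖) ^ 2 := by
        rw [mul_pow, Box.norm_sq_eq]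
        ring

/-- The primitive in `z` vanishing at `z = a`, as a bounded operator. It turns the trace conditions
defining `Sob₀` into closed linear equations. -/
def primitive (ha : a ∈ Icc (-G.ξ) G.d) : Lp ℂ 2 (G.wt ν) →L[ℝ] Lp ℂ 2 (G.wt ν) :=
  LinearMap.mkContinuous
    { toFun := fun v => (Box.memLp_primitive ha v).toLp _
      map_add' := fun v v' => (Box.traceAt_toLp ha (v + v')).unique
        ((Box.traceAt_toLp ha v).add₀ ha (Box.traceAt_toLp ha v'))
      map_smul' := fun c v => (Box.traceAt_toLp ha (c • v)).unique
        ((Box.traceAt_toLp ha v).smul₀ ha c) }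
    G.len (Box.norm_toLp_primitive_le ha)

theorem traceAt_iff (ha : a ∈ Icc (-G.ξ) G.d) {u v : Lp ℂ 2 (G.wt ν)} :
    G.TraceAt ν a u v 0 ↔ u = Box.primitive ha v :=
  ⟨fun h => h.unique (Box.traceAt_toLp ha v), fun h => h ▸ Box.traceAt_toLp ha v⟩

end Box

end Complete

section CompleteSob₀

variable {K : Type} [MeasurableSpace K] {G : Box} {ν : Measure K} [SFinite ν]

theorem image_coe_Sob₀ :
    ((↑) : Sob G ν 2 → PiLp 2 fun _ : G.Node × G.Node × Fin 3 => Lp ℂ 2 (G.wt ν)) ''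
      (Sob₀ G ν : Set (Sob G ν 2)) = {f |
        (∀ i l, f (G.mid i, G.mid l, 0)
          = Box.primitive G.left_mem (f (G.mid i, G.mid l, 1))) ∧
        (∀ i l, f (G.mid i, G.mid l, 1)
          = Box.primitive G.left_mem (f (G.mid i, G.mid l, 2))) ∧
        (∀ i l, f (G.mid i, G.mid l, 0)
          = Box.primitive G.right_mem (f (G.mid i, G.mid l, 1))) ∧
        (∀ j s r, G.Lateral j s → f (j, s, r) = 0)} := by
  ext f
  constructor
  · rintro ⟨u, hu, rfl⟩
    have hbc : HasBC u 0 0 := hu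
    obtain ⟨hleft₀, hleft₁, hright, -⟩ := hbc
    exact ⟨fun i l => (Box.traceAt_iff G.left_mem).1 (hleft₀ i l),
      fun i l => (Box.traceAt_iff G.left_mem).1 (hleft₁ i l),
      fun i l => (Box.traceAt_iff G.right_mem).1 (hright i l),
      fun j s r h => Box.ae_eq_zero_iff.1 (ae_zD_lateral ⟨u, hu⟩ r h)⟩
  · rintro ⟨hleft₀, hleft₁, hright, hlateral⟩
    have hf : f ∈ Sob G ν 2 := by
      intro j s r
      rcases G.lateral_or_mid j s with h | ⟨i, l, rfl, rfl⟩
      · rw [hlateral j s _ h, hlateral j s _ h]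
        exact ⟨0, Box.TraceAt.zero G.left_mem⟩
      · refine ⟨0, (Box.traceAt_iff G.left_mem).2 ?_⟩
        fin_cases r
        exacts [hleft₀ i l, hleft₁ i l]
    exact ⟨⟨f, hf⟩, ⟨fun i l => (Box.traceAt_iff G.left_mem).2 (hleft₀ i l),
      fun i l => (Box.traceAt_iff G.left_mem).2 (hleft₁ i l),
      fun i l => (Box.traceAt_iff G.right_mem).2 (hright i l),
      fun j s h => Box.ae_eq_zero_iff.2 (hlateral j s 0 h)⟩, rfl⟩

theorem isClosed_image_coe_Sob₀ :
    IsClosed (((↑) : Sob G ν 2 → PiLp 2 fun _ : G.Node × G.Node × Fin 3 => Lp ℂ 2 (G.wt ν)) ''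
      (Sob₀ G ν : Set (Sob G ν 2))) := by
  have hcoord (c) : Continuous fun f : PiLp 2 (fun _ : G.Node × G.Node × Fin 3 =>
      Lp ℂ 2 (G.wt ν)) => f c := PiLp.continuous_apply 2 _ c
  have htrace {a : ℝ} (ha : a ∈ Icc (-G.ξ) G.d) (r r' : Fin 3) :
      IsClosed {f : PiLp 2 (fun _ : G.Node × G.Node × Fin 3 => Lp ℂ 2 (G.wt ν)) |
        ∀ i l, f (G.mid i, G.mid l, r) = Box.primitive ha (f (G.mid i, G.mid l, r'))} := by
    simp only [ofPred_forall]
    exact isClosed_iInter fun i => isClosed_iInter fun l =>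
      isClosed_eq (hcoord _) ((Box.primitive ha).continuous.comp (hcoord _))
  have hlateral :
      IsClosed {f : PiLp 2 (fun _ : G.Node × G.Node × Fin 3 => Lp ℂ 2 (G.wt ν)) |
        ∀ j s r, G.Lateral j s → f (j, s, r) = 0} := by
    simp only [ofPred_forall]
    exact isClosed_iInter fun j => isClosed_iInter fun s => isClosed_iInter fun r =>
      isClosed_iInter fun _ => isClosed_eq (hcoord _) continuous_const
  rw [image_coe_Sob₀]
  exact (htrace G.left_mem 0 1).inter ((htrace G.left_mem 1 2).inter
    ((htrace G.right_mem 0 1).inter hlateral))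

instance completeSpace_Sob₀ : CompleteSpace (Sob₀ G ν) :=
  IsComplete.completeSpace_coe (s := (Sob₀ G ν : Set (Sob G ν 2)))
    (isUniformEmbedding_subtype_val.isComplete_iff.1 isClosed_image_coe_Sob₀.isComplete)

end CompleteSob₀

/-! ## The tail problem -/

section Minimization

theorem lowerSemicontinuous_of_quasi_triangle {E : Type*} [SeminormedAddCommGroup E]
    {f : E → ℝ} {C : ℝ}
    (hf : ∀ x y, ∀ t > 0, f x ≤ (1 + t) * f y + (1 + 1 / t) * (C * ‖x - y‖ ^ 2)) :
    LowerSemicontinuous f := by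
  intro x c hc
  obtain ⟨t, ht, hct⟩ : ∃ t > 0, (1 + t) * c < f x := by
    have hcont : Filter.Tendsto (fun t : ℝ => (1 + t) * c) (nhdsWithin 0 (Ioi 0)) (nhds c) := by
      have : Continuous fun t : ℝ => (1 + t) * c := by fun_prop
      simpa using (this.tendsto 0).mono_left nhdsWithin_le_nhds
    obtain ⟨t, ht⟩ := ((hcont.eventually_lt_const hc).and self_mem_nhdsWithin).exists
    exact ⟨t, ht.2, ht.1⟩
  have hbound : Continuous fun y => (1 + t) * c + (1 + 1 / t) * (C * ‖x - y‖ ^ 2) := by fun_prop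
  have hnear : ∀ᶠ y in nhds x, (1 + t) * c + (1 + 1 / t) * (C * ‖x - y‖ ^ 2) < f x :=
    (hbound.tendsto x).eventually_lt_const (by simpa using hct)
  filter_upwards [hnear] with y hy
  have hlt : (1 + t) * c < (1 + t) * f y := by linarith [hf x y t ht]
  exact lt_of_mul_lt_mul_left hlt (by positivity)

section UniformlyConvex

variable {E : Type*} [NormedAddCommGroup E] [NormedSpace ℝ E] {f : E → ℝ} {c : ℝ}

theorem dist_le_of_le_iInf_add (hbdd : BddBelow (range f)) (hc : 0 < c)
    (hconv : ∀ x y, f ((1 / 2 : ℝ) • (x + y)) + c * ‖x - y‖ ^ 2 ≤ (f x + f y) / 2)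
    {x y : E} {e : ℝ} (hx : f x ≤ (⨅ z, f z) + e) (hy : f y ≤ (⨅ z, f z) + e) :
    dist x y ≤ √(e / c) := by
  rw [dist_eq_norm]
  refine Real.le_sqrt_of_sq_le ((le_div_iff₀ hc).2 ?_)
  linarith [hconv x y, ciInf_le hbdd ((1 / 2 : ℝ) • (x + y))]

theorem existsUnique_isMinOn_of_uniformlyConvex [CompleteSpace E] (hf : LowerSemicontinuous f)
    (hbdd : BddBelow (range f)) (hc : 0 < c)
    (hconv : ∀ x y, f ((1 / 2 : ℝ) • (x + y)) + c * ‖x - y‖ ^ 2 ≤ (f x + f y) / 2) :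
    ∃! x, IsMinOn f univ x := by
  set I := ⨅ z, f z
  have hdecay := tendsto_one_div_add_atTop_nhds_zero_nat (𝕜 := ℝ)
  have hmin (m : ℕ) : ∃ x, f x < I + 1 / ((m : ℝ) + 1) :=
    exists_lt_of_ciInf_lt (lt_add_of_pos_right _ (by positivity))
  choose s hs using hmin
  have hcauchy : CauchySeq s := by
    refine cauchySeq_of_le_tendsto_0 (fun N : ℕ => √(1 / ((N : ℝ) + 1) / c)) ?_
      (by simpa using (hdecay.div_const c).sqrt)
    intro m m' N hm hm'
    have hle (j : ℕ) (hj : N ≤ j) : f (s j) ≤ I + 1 / ((N : ℝ) + 1) :=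
      (hs j).le.trans (by gcongr)
    exact dist_le_of_le_iInf_add hbdd hc hconv (hle m hm) (hle m' hm')
  obtain ⟨x, hx⟩ := cauchySeq_tendsto_of_complete hcauchy
  have hfx : f x ≤ I := by
    refine le_of_forall_lt_imp_le_of_dense fun a ha => ?_
    have hlim : Filter.Tendsto (fun m : ℕ => I + 1 / ((m : ℝ) + 1)) Filter.atTop (nhds I) := by
      simpa using hdecay.const_add I
    refine ge_of_tendsto hlim ?_
    filter_upwards [hx.eventually (hf x a ha)] with m hm
    exact (hm.trans (hs m)).le
  refine ⟨x, fun y _ => hfx.trans (ciInf_le hbdd y), fun y hy => ?_⟩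
  have hfy : f y ≤ I := le_ciInf fun z => hy (mem_univ z)
  have hdist := dist_le_of_le_iInf_add hbdd hc hconv (e := 0) (by simpa using hfy)
    (by simpa using hfx)
  simpa using hdist

end UniformlyConvex

end Minimization

section Tail

variable {K : Type} [MeasurableSpace K] {G : Box} {ν : Measure K} [SFinite ν]

theorem integrable_lap_mul_exp (lam : ℝ) (f : Sob G ν 2) (i l : Fin G.n) :
    Integrable (fun x => ‖lap f i l x‖ ^ 2 * Real.exp (-2 * lam * x.1)) (G.dom ν) :=
  Box.integrable_mul_exp lam (integrable_sq_lap f i l)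

theorem sq_add_le {a b t : ℝ} (ht : 0 < t) :
    (a + b) ^ 2 ≤ (1 + t) * a ^ 2 + (1 + 1 / t) * b ^ 2 := by
  have hsq : (1 + t) * a ^ 2 + (1 + 1 / t) * b ^ 2 = (a + b) ^ 2 + (t * a - b) ^ 2 / t := by
    field_simp
    ring
  rw [hsq]
  exact le_add_of_nonneg_right (by positivity)

theorem lapEnergy_add_le (lam : ℝ) (f g : Sob G ν 2) {t : ℝ} (ht : 0 < t) :
    lapEnergy lam (f + g) ≤ (1 + t) * lapEnergy lam f + (1 + 1 / t) * lapEnergy lam g := by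
  simp only [lapEnergy, Finset.mul_sum, ← Finset.sum_add_distrib]
  refine Finset.sum_le_sum fun i _ => Finset.sum_le_sum fun l _ => ?_
  have hf := (integrable_lap_mul_exp lam f i l).const_mul (1 + t)
  have hg := (integrable_lap_mul_exp lam g i l).const_mul (1 + 1 / t)
  simp only [Box.weightedNormSq]
  rw [← integral_const_mul, ← integral_const_mul, ← integral_add hf hg]
  refine integral_mono_ae (integrable_lap_mul_exp lam _ i l) (hf.add hg) ?_
  filter_upwards [ae_zD_add f g] with x hx
  rw [lap_eq_add hx, ← mul_assoc, ← mul_assoc, ← add_mul]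
  gcongr
  exact (pow_le_pow_left₀ (norm_nonneg _) (norm_add_le _ _) 2).trans (sq_add_le ht)

theorem lapEnergy_smul (lam c : ℝ) (f : Sob G ν 2) :
    lapEnergy lam (c • f) = c ^ 2 * lapEnergy lam f := by
  simp only [lapEnergy, Finset.mul_sum]
  refine Finset.sum_congr rfl fun i _ => Finset.sum_congr rfl fun l _ => ?_
  simp only [Box.weightedNormSq]
  rw [← integral_const_mul]
  refine integral_congr_ae ?_
  filter_upwards [ae_zD_smul c f] with x hx
  rw [lap_eq_smul hx, norm_mul, mul_pow, Complex.norm_real, Real.norm_eq_abs, sq_abs, mul_assoc]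

theorem lapEnergy_parallelogram (lam : ℝ) (f g : Sob G ν 2) :
    lapEnergy lam (f + g) + lapEnergy lam (f - g) = 2 * (lapEnergy lam f + lapEnergy lam g) := by
  simp only [lapEnergy, Finset.mul_sum, ← Finset.sum_add_distrib]
  refine Finset.sum_congr rfl fun i _ => Finset.sum_congr rfl fun l _ => ?_
  have hinteg (u : Sob G ν 2) := integrable_lap_mul_exp lam u i l
  simp only [Box.weightedNormSq]
  rw [← integral_add (hinteg _) (hinteg _), ← integral_add (hinteg _) (hinteg _),
    ← integral_const_mul]
  refine integral_congr_ae ?_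
  filter_upwards [ae_zD_add f g, ae_zD_add (f - g) g] with x hadd hsub
  rw [sub_add_cancel] at hsub
  have hlap : lap (f - g) i l x = lap f i l x - lap g i l x :=
    eq_sub_of_add_eq (lap_eq_add hsub i l).symm
  rw [lap_eq_add hadd, hlap]
  linear_combination Real.exp (-2 * lam * x.1)
    * parallelogram_law_with_norm ℝ (lap f i l x) (lap g i l x)

theorem lapEnergy_midpoint (lam : ℝ) (f g : Sob G ν 2) :
    lapEnergy lam ((1 / 2 : ℝ) • (f + g)) + 1 / 4 * lapEnergy lam (f - g)
      = (lapEnergy lam f + lapEnergy lam g) / 2 := by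
  rw [lapEnergy_smul]
  linear_combination 1 / 4 * lapEnergy_parallelogram lam f g

theorem lapEnergy_eq_zero {lam : ℝ} {f : Sob G ν 2}
    (h : ∀ i l, ∀ᵐ x ∂G.dom ν, lap f i l x = 0) : lapEnergy lam f = 0 :=
  Finset.sum_eq_zero fun i _ => Finset.sum_eq_zero fun l _ => Box.weightedNormSq_eq_zero (h i l)

theorem norm_sq_le_lapEnergy {lam : ℝ} (hlam : G.carlemanParam ≤ lam) (u : Sob₀ G ν) :
    ‖u‖ ^ 2 ≤ 4 * G.normConst * Real.exp (2 * lam * G.d) * lapEnergy lam u.1 := by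
  have hN := G.normConst_pos
  calc _ ≤ G.normConst * (Real.exp (2 * lam * G.d) * energy lam u) :=
        norm_sq_le_energy (by linarith [G.two_le_carlemanParam]) u
    _ ≤ G.normConst * (Real.exp (2 * lam * G.d) * (4 * lapEnergy lam u.1)) := by
        gcongr
        exact energy_le_lapEnergy hlam u
    _ = _ := by ring

theorem tailCost_eq (Q : HΩ G 2) (μ : ℝ) (W : HΩ₀ G) :
    tailCost G Q μ W = Real.exp (2 * μ * G.d) * (G.h ^ 2 * lapEnergy μ (W.1 + Q)) := by
  unfold tailCost lapEnergy
  rw [weightedSq_eq]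
  congr 2
  refine Finset.sum_congr rfl fun i _ => Finset.sum_congr rfl fun l _ => integral_congr_ae ?_
  filter_upwards [ae_zD_add W.1 Q] with x hx
  rw [lap_eq_add hx]

theorem tailCost_nonneg (Q : HΩ G 2) (μ : ℝ) (W : HΩ₀ G) : 0 ≤ tailCost G Q μ W := by
  rw [tailCost_eq]
  have := lapEnergy_nonneg μ (W.1 + Q)
  positivity

theorem tailCost_quasi_triangle (Q : HΩ G 2) {μ t : ℝ} (hμ : 0 ≤ μ) (ht : 0 < t) (x y : HΩ₀ G) :
    tailCost G Q μ x ≤ (1 + t) * tailCost G Q μ y + (1 + 1 / t) * (Real.exp (2 * μ * G.d) *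
      (G.n ^ 2 * (G.wMax μ * (1 + 8 / G.h ^ 2) ^ 2)) * ‖x - y‖ ^ 2) := by
  have hh := G.h_pos
  have hdecomp : x.1 + Q = y.1 + Q + (x - y).1 := by
    rw [Submodule.coe_sub]
    abel
  calc tailCost G Q μ x
      ≤ Real.exp (2 * μ * G.d) * (G.h ^ 2 * ((1 + t) * lapEnergy μ (y.1 + Q)
        + (1 + 1 / t) * lapEnergy μ (x - y).1)) := by
        rw [tailCost_eq, hdecomp]
        gcongr
        exact lapEnergy_add_le μ _ _ ht
    _ ≤ Real.exp (2 * μ * G.d) * (G.h ^ 2 * ((1 + t) * lapEnergy μ (y.1 + Q)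
        + (1 + 1 / t) * (G.n ^ 2 * (G.wMax μ *
          ((1 + 8 / G.h ^ 2) ^ 2 * (‖(x - y).1‖ ^ 2 / G.h ^ 2)))))) := by
        gcongr
        exact lapEnergy_le_norm_sq hμ _
    _ = _ := by
        rw [tailCost_eq, ← Submodule.coe_norm]
        field_simp

theorem tailCost_midpoint_le (Q : HΩ G 2) {μ : ℝ} (hμ : G.carlemanParam ≤ μ) (x y : HΩ₀ G) :
    tailCost G Q μ ((1 / 2 : ℝ) • (x + y)) + G.h ^ 2 / (16 * G.normConst) * ‖x - y‖ ^ 2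
      ≤ (tailCost G Q μ x + tailCost G Q μ y) / 2 := by
  have hh := G.h_pos
  have hN := G.normConst_pos
  have hmid : ((1 / 2 : ℝ) • (x + y)).1 + Q = (1 / 2 : ℝ) • (x.1 + Q + (y.1 + Q)) := by
    rw [Submodule.coe_smul, Submodule.coe_add]
    module
  have hdiff : (x - y).1 = x.1 + Q - (y.1 + Q) := by
    rw [Submodule.coe_sub]
    abel
  have hnorm : G.h ^ 2 / (16 * G.normConst) * ‖x - y‖ ^ 2
      ≤ Real.exp (2 * μ * G.d) * (G.h ^ 2 * (1 / 4 * lapEnergy μ (x - y).1)) :=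
    calc _ ≤ G.h ^ 2 / (16 * G.normConst) *
          (4 * G.normConst * Real.exp (2 * μ * G.d) * lapEnergy μ (x - y).1) := by
          gcongr
          exact norm_sq_le_lapEnergy hμ _
      _ = _ := by
          field_simp
          ring
  refine (add_le_add_right hnorm _).trans_eq ?_
  rw [tailCost_eq, tailCost_eq, tailCost_eq, hmid, hdiff]
  linear_combination Real.exp (2 * μ * G.d) * G.h ^ 2 * lapEnergy_midpoint μ (x.1 + Q) (y.1 + Q)

theorem existsUnique_isMinOn_tailCost (Q : HΩ G 2) {μ : ℝ} (hμ : G.carlemanParam ≤ μ) :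
    ∃! W : HΩ₀ G, IsMinOn (tailCost G Q μ) univ W := by
  have hh := G.h_pos
  have hN := G.normConst_pos
  have hμ₀ : 0 ≤ μ := by linarith [G.two_le_carlemanParam]
  refine existsUnique_isMinOn_of_uniformlyConvex (c := G.h ^ 2 / (16 * G.normConst)) ?_ ?_
    (by positivity) ?_
  · exact lowerSemicontinuous_of_quasi_triangle fun x y t ht =>
      tailCost_quasi_triangle Q hμ₀ ht x y
  · exact ⟨0, by rintro _ ⟨W, rfl⟩; exact tailCost_nonneg Q μ W⟩
  · exact tailCost_midpoint_le Q hμ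

theorem HasBC.sub_mem {f g : Sob G ν 2} {φ₀ φ₁ : Fin G.n → Fin G.n → K → ℂ} (hf : HasBC f φ₀ φ₁)
    (hg : HasBC g φ₀ φ₁) : f - g ∈ Sob₀ G ν := by
  have htrace {a : ℝ} (ha : a ∈ Icc (-G.ξ) G.d) {u v u' v' : Lp ℂ 2 (G.wt ν)} {φ : K → ℂ}
      (h : G.TraceAt ν a u v φ) (h' : G.TraceAt ν a u' v' φ) :
      G.TraceAt ν a ↑(u + (-1 : ℝ) • u') ↑(v + (-1 : ℝ) • v') 0 := by
    have hsub := h.add ha (h'.smul ha (-1))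
    rwa [show φ + (-1 : ℝ) • φ = 0 by module] at hsub
  rw [show f - g = f + (-1 : ℝ) • g by module]
  obtain ⟨hf₀, hf₁, hf₂, hf₃⟩ := hf
  obtain ⟨hg₀, hg₁, hg₂, hg₃⟩ := hg
  refine ⟨fun i l => htrace G.left_mem (hf₀ i l) (hg₀ i l),
    fun i l => htrace G.left_mem (hf₁ i l) (hg₁ i l),
    fun i l => htrace G.right_mem (hf₂ i l) (hg₂ i l), fun j s hjs => ?_⟩
  filter_upwards [hf₃ j s hjs, hg₃ j s hjs, ae_zD_add f ((-1 : ℝ) • g), ae_zD_smul (-1) g]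
    with x hfx hgx hadd hsmul
  rw [hadd, hsmul, hfx, hgx, mul_zero, add_zero]

theorem tailParam_eq (G : Box) {δ : ℝ} (hδ : 0 < δ) :
    2 * tailParam G δ * G.len = -Real.log δ := by
  have hlen := G.len_pos
  rw [tailParam, Real.log_rpow hδ, ← Box.len]
  field_simp

theorem le_tailParam {δ lam : ℝ} (hδ : 0 < δ) (h : δ < Real.exp (-2 * (G.d + G.ξ) * lam)) :
    lam ≤ tailParam G δ := by
  have hlog : Real.log δ < -2 * G.len * lam := (Real.log_lt_iff_lt_exp hδ).2 h
  refine le_of_mul_le_mul_right ?_ (mul_pos two_pos G.len_pos)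
  linarith [tailParam_eq G hδ]

/-- The bound for the squared distance of the tail function from an exact one. -/
def Box.tailConst (G : Box) : ℝ :=
  32 * G.normConst * (G.n ^ 2 * ((1 + 8 / G.h ^ 2) ^ 2 / G.h ^ 2))

section TailBound

variable {Q Qs Vs : HΩ G 2} {W : HΩ₀ G}

theorem lapEnergy_le_of_isMinOn {μ : ℝ} (hW : IsMinOn (tailCost G Q μ) univ W) (U : HΩ₀ G) :
    lapEnergy μ (W.1 + Q) ≤ lapEnergy μ (U.1 + Q) := by
  have hh := G.h_pos
  have hmin : tailCost G Q μ W ≤ tailCost G Q μ U := hW (mem_univ U)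
  rw [tailCost_eq, tailCost_eq] at hmin
  exact le_of_mul_le_mul_left (le_of_mul_le_mul_left hmin (Real.exp_pos _)) (by positivity)

theorem lapEnergy_sub_le_of_isMinOn {μ : ℝ} (hW : IsMinOn (tailCost G Q μ) univ W)
    (hVs : Vs - Qs ∈ Sob₀ G (.dirac ())) (hlap : ∀ i l, ∀ᵐ x ∂G.dom (.dirac ()), lap Vs i l x = 0) :
    lapEnergy μ (W - ⟨Vs - Qs, hVs⟩ : HΩ₀ G).1 ≤ 8 * lapEnergy μ (Q - Qs) := by
  set U : HΩ₀ G := ⟨Vs - Qs, hVs⟩ with hU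
  have hexact : lapEnergy μ (U.1 + Q) ≤ 2 * lapEnergy μ (Q - Qs) := by
    have hadd := lapEnergy_add_le μ (Q - Qs) Vs one_pos
    rw [lapEnergy_eq_zero hlap] at hadd
    rw [show U.1 + Q = Q - Qs + Vs by simp only [hU]; abel]
    linarith
  have hdiff : (W - U).1 = W.1 + Q + (-1 : ℝ) • (U.1 + Q) := by
    rw [Submodule.coe_sub]
    module
  have hsub := lapEnergy_add_le μ (W.1 + Q) ((-1 : ℝ) • (U.1 + Q)) one_pos
  rw [← hdiff, lapEnergy_smul] at hsub
  linarith [lapEnergy_le_of_isMinOn hW U]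

theorem exp_mul_wMax_tailParam (G : Box) {δ : ℝ} (hδ : 0 < δ) :
    Real.exp (2 * tailParam G δ * G.d) * G.wMax (tailParam G δ) = δ⁻¹ := by
  rw [Box.wMax, ← Real.exp_add, ← mul_add]
  change Real.exp (2 * tailParam G δ * G.len) = _
  rw [tailParam_eq G hδ, Real.exp_neg, Real.exp_log hδ]

/-- The parameter `μ(δ)` is chosen so that the loss `e^{2μ(d + ξ)} = 1 / δ` in passing from weighted
to unweighted norms costs only one of the two factors `δ` of `‖Q - Qs‖² ≤ δ²`. -/
theorem norm_sub_sq_le_tailConst {δ : ℝ} (hδ : 0 < δ) (hδ_le : δ ≤ 1)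
    (hμ : G.carlemanParam ≤ tailParam G δ) (hQ : ‖Q - Qs‖ < δ) (hVs : Vs - Qs ∈ Sob₀ G (.dirac ()))
    (hlap : ∀ i l, ∀ᵐ x ∂G.dom (.dirac ()), lap Vs i l x = 0)
    (hW : IsMinOn (tailCost G Q (tailParam G δ)) univ W) :
    ‖W - ⟨Vs - Qs, hVs⟩‖ ^ 2 ≤ G.tailConst := by
  have hN := G.normConst_pos
  set μ := tailParam G δ
  have hw := G.wMax_pos μ
  have hμ₀ : 0 ≤ μ := by linarith [G.two_le_carlemanParam]
  have hh := G.h_pos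
  calc _ ≤ 4 * G.normConst * Real.exp (2 * μ * G.d)
          * lapEnergy μ (W - ⟨Vs - Qs, hVs⟩ : HΩ₀ G).1 := norm_sq_le_lapEnergy hμ _
    _ ≤ 4 * G.normConst * Real.exp (2 * μ * G.d) * (8 * lapEnergy μ (Q - Qs)) := by
        gcongr
        exact lapEnergy_sub_le_of_isMinOn hW hVs hlap
    _ ≤ 4 * G.normConst * Real.exp (2 * μ * G.d) * (8 * (G.n ^ 2 * (G.wMax μ *
          ((1 + 8 / G.h ^ 2) ^ 2 * (δ ^ 2 / G.h ^ 2))))) := by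
        gcongr
        refine (lapEnergy_le_norm_sq hμ₀ _).trans ?_
        gcongr
    _ = G.tailConst * (Real.exp (2 * μ * G.d) * G.wMax μ * δ ^ 2) := by
        unfold Box.tailConst
        ring
    _ = G.tailConst * δ := by
        rw [exp_mul_wMax_tailParam G hδ]
        field_simp
    _ ≤ G.tailConst := by
        refine mul_le_of_le_one_right ?_ hδ_le
        unfold Box.tailConst
        positivity

theorem norm_tail_le {δ : ℝ} (hδ : 0 < δ) (hδ_le : δ ≤ 1)
    (hμ : G.carlemanParam ≤ tailParam G δ) (hQ : ‖Q - Qs‖ < δ) (hVs : Vs - Qs ∈ Sob₀ G (.dirac ()))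
    (hlap : ∀ i l, ∀ᵐ x ∂G.dom (.dirac ()), lap Vs i l x = 0)
    (hW : IsMinOn (tailCost G Q (tailParam G δ)) univ W) :
    ‖W.1 + Q‖ ≤ √G.tailConst + 1 + ‖Vs‖ := by
  set U : HΩ₀ G := ⟨Vs - Qs, hVs⟩
  have hU : U.1 = Vs - Qs := rfl
  have hdist : ‖(W - U).1‖ ≤ √G.tailConst :=
    Real.le_sqrt_of_sq_le (norm_sub_sq_le_tailConst hδ hδ_le hμ hQ hVs hlap hW)
  calc ‖W.1 + Q‖ = ‖(W - U).1 + (Q - Qs) + Vs‖ := by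
        rw [Submodule.coe_sub, hU]
        congr 1
        abel
    _ ≤ ‖(W - U).1‖ + ‖Q - Qs‖ + ‖Vs‖ := norm_add₃_le
    _ ≤ √G.tailConst + 1 + ‖Vs‖ := by gcongr; linarith

end TailBound

end Tail

/-! ## Volterra integrals in the parameter -/

section Volterra

/-- The measure `dz dk` on `(-ξ, d) × (k₁, k₂)`. -/
abbrev Box.domK (G : Box) (k₁ k₂ : ℝ) : Measure (ℝ × ℝ) :=
  G.dom (volume.restrict (Ioo k₁ k₂))

variable {G : Box} {k₁ k₂ lam : ℝ}

theorem Box.ae_mem_param (G : Box) (k₁ k₂ : ℝ) : ∀ᵐ x ∂G.domK k₁ k₂, x.2 ∈ Ioo k₁ k₂ :=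
  Box.ae_param (ae_restrict_mem measurableSet_Ioo)

theorem Box.ae_ae_param {p : ℝ × ℝ → Prop} (h : ∀ᵐ x ∂G.domK k₁ k₂, p x) :
    ∀ᵐ x ∂G.domK k₁ k₂, ∀ᵐ κ ∂volume.restrict (Ioo k₁ k₂), p (x.1, κ) :=
  Measure.quasiMeasurePreserving_fst.ae (Measure.ae_ae_of_ae_prod h)

theorem ae_norm_volterra_le {E : Type*} [NormedAddCommGroup E] [NormedSpace ℝ E]
    {g : ℝ × ℝ → E} {ρ e : ℝ → ℝ} (hρ : ∀ z, 0 < ρ z)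
    (he : MemLp e 2 (volume.restrict (Ioo k₁ k₂)))
    (h : ∀ᵐ x ∂G.domK k₁ k₂, ‖g x‖ * ρ x.1 ≤ e x.2) :
    ∀ᵐ x ∂G.domK k₁ k₂,
      ‖∫ κ in x.2..k₂, g (x.1, κ)‖ * ρ x.1 ≤ √((k₂ - k₁) * ∫ κ in Ioo k₁ k₂, e κ ^ 2) := by
  have he_int : IntegrableOn (fun κ => ‖e κ‖) (Ioo k₁ k₂) :=
    (he.integrable one_le_two).norm
  filter_upwards [Box.ae_ae_param h, Box.ae_mem_param G k₁ k₂] with x hx hm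
  have hsub : Ioo x.2 k₂ ⊆ Ioo k₁ k₂ := Ioo_subset_Ioo_left hm.1.le
  have hinner : ‖∫ κ in x.2..k₂, g (x.1, κ)‖ ≤ (∫ κ in Ioo x.2 k₂, ‖e κ‖) / ρ x.1 := by
    rw [intervalIntegral.integral_of_le hm.2.le, integral_Ioc_eq_integral_Ioo, ← integral_div]
    refine norm_integral_le_of_norm_le ((he_int.mono_set hsub).div_const _) ?_
    filter_upwards [ae_restrict_of_ae_restrict_of_subset hsub hx] with κ hκ
    exact (le_div_iff₀ (hρ _)).2 (hκ.trans (Real.le_norm_self _))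
  calc ‖∫ κ in x.2..k₂, g (x.1, κ)‖ * ρ x.1 ≤ ∫ κ in Ioo x.2 k₂, ‖e κ‖ :=
        (le_div_iff₀ (hρ _)).1 hinner
    _ ≤ ∫ κ in Ioo k₁ k₂, ‖e κ‖ :=
        setIntegral_mono_set he_int (.of_forall fun _ => norm_nonneg _) hsub.eventuallyLE
    _ ≤ √((k₂ - k₁) * ∫ κ in Ioo k₁ k₂, e κ ^ 2) := Real.le_sqrt_of_sq_le <| by
        simpa only [Real.norm_eq_abs, sq_abs] using
          sq_setIntegral_norm_le (hm.1.trans hm.2).le he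

theorem stronglyMeasurable_volterra {E : Type*} [NormedAddCommGroup E] [NormedSpace ℝ E]
    {g : ℝ × ℝ → E} (hg : StronglyMeasurable g) (k₂ : ℝ) :
    StronglyMeasurable fun x : ℝ × ℝ => ∫ κ in x.2..k₂, g (x.1, κ) := by
  have hswap : StronglyMeasurable fun y : ℝ × ℝ => ∫ κ in k₂..y.1, g (y.2, κ) :=
    Box.stronglyMeasurable_primitive k₂ (hg.comp_measurable measurable_swap)
  simp only [intervalIntegral.integral_symm k₂]
  exact (hswap.comp_measurable measurable_swap).neg

/-- The Volterra integral `∫_k^{k₂} ∇^h q dκ` at the interior node `(i, l)`. -/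
def gradInt (q : HK G k₁ k₂ 2) (i l : Fin G.n) (x : ℝ × ℝ) : Fin 3 → ℂ :=
  fun c => ∫ κ in x.2..k₂, grad q i l (x.1, κ) c

theorem measurable_gradInt (q : HK G k₁ k₂ 2) (i l : Fin G.n) (c : Fin 3) :
    Measurable fun x => gradInt q i l x c :=
  (stronglyMeasurable_volterra (measurable_grad q i l c).stronglyMeasurable k₂).measurable

/-- A bound for `|∇^h q|` that depends on `k` only. -/
def gradSup (q : HK G k₁ k₂ 2) (k : ℝ) : ℝ := G.supConst * √(totalSlice q k)

theorem sq_gradSup (q : HK G k₁ k₂ 2) (k : ℝ) :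
    gradSup q k ^ 2 = G.supConst ^ 2 * totalSlice q k := by
  rw [gradSup, mul_pow, Real.sq_sqrt (totalSlice_nonneg q k)]

theorem integrable_sq_gradSup (q : HK G k₁ k₂ 2) :
    IntegrableOn (fun k => gradSup q k ^ 2) (Ioo k₁ k₂) := by
  simp only [sq_gradSup]
  exact (integrable_totalSlice q).const_mul _

theorem integral_sq_gradSup (q : HK G k₁ k₂ 2) :
    ∫ k in Ioo k₁ k₂, gradSup q k ^ 2 = (G.supConst * ‖q‖ / G.h) ^ 2 := by
  simp only [sq_gradSup]
  rw [integral_const_mul, integral_totalSlice]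
  ring

theorem memLp_gradSup (q : HK G k₁ k₂ 2) :
    MemLp (gradSup q) 2 (volume.restrict (Ioo k₁ k₂)) :=
  (memLp_two_iff_integrable_sq
    ((measurable_totalSlice q).sqrt.const_mul _).aestronglyMeasurable).2 (integrable_sq_gradSup q)

theorem ae_norm_gradInt_le (q : HK G k₁ k₂ 2) :
    ∀ᵐ x ∂G.domK k₁ k₂, ∀ i l c,
      ‖gradInt q i l x c‖ ≤ √(k₂ - k₁) * (G.supConst * ‖q‖ / G.h) := by
  have hB : 0 ≤ G.supConst * ‖q‖ / G.h :=
    div_nonneg (mul_nonneg G.supConst_nonneg (norm_nonneg q)) G.h_pos.le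
  simp only [ae_all_iff]
  intro i l c
  have hgrad : ∀ᵐ x ∂G.domK k₁ k₂, ‖grad q i l x c‖ * 1 ≤ gradSup q x.2 := by
    filter_upwards [ae_norm_grad_le q] with x hx
    simpa only [mul_one, gradSup] using hx i l c
  filter_upwards [ae_norm_volterra_le (fun _ => one_pos) (memLp_gradSup q) hgrad] with x hx
  rwa [mul_one, integral_sq_gradSup, Real.sqrt_mul' _ (sq_nonneg _), Real.sqrt_sq hB] at hx

theorem ae_intervalIntegrable_grad (q : HK G k₁ k₂ 2) :
    ∀ᵐ x ∂G.domK k₁ k₂, ∀ i l c,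
      IntervalIntegrable (fun κ => grad q i l (x.1, κ) c) volume x.2 k₂ := by
  filter_upwards [Box.ae_ae_param (ae_norm_grad_le q), Box.ae_mem_param G k₁ k₂]
    with x hx hm i l c
  have hinteg : IntegrableOn (fun κ => grad q i l (x.1, κ) c) (Ioo k₁ k₂) := by
    refine ((memLp_gradSup q).integrable one_le_two).mono'
      ((measurable_grad q i l c).comp (measurable_const.prodMk measurable_id)).aestronglyMeasurable
      ?_
    filter_upwards [hx] with κ hκ using hκ i l c
  rw [intervalIntegrable_iff, uIoc_of_le hm.2.le, integrableOn_Ioc_iff_integrableOn_Ioo]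
  exact hinteg.mono_set (Ioo_subset_Ioo_left hm.1.le)

theorem gradInt_congr {q : HK G k₁ k₂ 2} {i l : Fin G.n} {x : ℝ × ℝ} {g : ℝ → Fin 3 → ℂ}
    (hm : x.2 ∈ Ioo k₁ k₂)
    (h : ∀ᵐ κ ∂volume.restrict (Ioo k₁ k₂), grad q i l (x.1, κ) = g κ) (c : Fin 3) :
    gradInt q i l x c = ∫ κ in x.2..k₂, g κ c := by
  unfold gradInt
  rw [intervalIntegral.integral_of_le hm.2.le, intervalIntegral.integral_of_le hm.2.le,
    integral_Ioc_eq_integral_Ioo, integral_Ioc_eq_integral_Ioo]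
  refine integral_congr_ae ?_
  filter_upwards [ae_restrict_of_ae_restrict_of_subset (Ioo_subset_Ioo_left hm.1.le) h] with κ hκ
  rw [hκ]

theorem ae_gradInt_add (q r : HK G k₁ k₂ 2) :
    ∀ᵐ x ∂G.domK k₁ k₂, ∀ i l, gradInt (q + r) i l x = gradInt q i l x + gradInt r i l x := by
  filter_upwards [Box.ae_ae_param (ae_zD_add q r), ae_intervalIntegrable_grad q,
    ae_intervalIntegrable_grad r, Box.ae_mem_param G k₁ k₂] with x hx hq hr hm i l
  ext c
  rw [gradInt_congr hm (hx.mono fun κ hκ => grad_eq_add hκ i l)]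
  exact intervalIntegral.integral_add (hq i l c) (hr i l c)

theorem ae_gradInt_smul (a : ℝ) (q : HK G k₁ k₂ 2) :
    ∀ᵐ x ∂G.domK k₁ k₂, ∀ i l, gradInt (a • q) i l x = (a : ℂ) • gradInt q i l x := by
  filter_upwards [Box.ae_ae_param (ae_zD_smul a q), Box.ae_mem_param G k₁ k₂] with x hx hm i l
  ext c
  rw [gradInt_congr hm (hx.mono fun κ hκ => grad_eq_smul hκ i l)]
  exact intervalIntegral.integral_const_mul _ _

theorem ae_norm_grad_tail_le (V : HΩ G 2) :
    ∀ᵐ x ∂G.domK k₁ k₂, ∀ i l c, ‖grad V i l (x.1, ()) c‖ ≤ G.supConst * ‖V‖ / G.h := by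
  have hslice : √(totalSlice V ()) = ‖V‖ / G.h := by
    have hinteg : totalSlice V () = ‖V‖ ^ 2 / G.h ^ 2 := by
      rw [← integral_totalSlice V, integral_dirac]
    rw [hinteg, ← div_pow, Real.sqrt_sq (div_nonneg (norm_nonneg V) G.h_pos.le)]
  have hz : ∀ᵐ z ∂volume.restrict (Ioo (-G.ξ) G.d),
      ∀ i l c, ‖grad V i l (z, ()) c‖ ≤ G.supConst * √(totalSlice V ()) := by
    simpa only [ae_dirac_eq, Filter.eventually_pure] using Box.ae_swap (ae_norm_grad_le V)
  rw [hslice, ← mul_div_assoc] at hz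
  exact Measure.quasiMeasurePreserving_fst.ae hz

/-- The factor by which the weight makes the squares of `∇^h r` and of its Volterra integral
smaller than the energy of `r`. -/
def Box.small (G : Box) (lam : ℝ) : ℝ := (1 + 1 / G.h) ^ 2 * (1 + 1 / lam) ^ 2 / (2 * lam)

/-- A bound for `|∇^h r| e^{-λz}` that depends on `k` only. -/
def wSup (lam : ℝ) (r : HK₀ G k₁ k₂) (k : ℝ) : ℝ :=
  (1 + 1 / G.h) * ((1 + 1 / lam) * weightedSup lam r k)

/-- A bound for `|∫_k^{k₂} ∇^h r dκ| e^{-λz}`. -/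
def wSupInt (lam : ℝ) (r : HK₀ G k₁ k₂) : ℝ := √((k₂ - k₁) * (G.small lam * energy lam r))

theorem sq_wSup (hlam : 0 < lam) (r : HK₀ G k₁ k₂) (k : ℝ) :
    wSup lam r k ^ 2 = G.small lam * energySlice lam r k := by
  rw [wSup, mul_pow, mul_pow, sq_weightedSup hlam, Box.small]
  ring

theorem integrable_sq_wSup (hlam : 0 < lam) (r : HK₀ G k₁ k₂) :
    IntegrableOn (fun k => wSup lam r k ^ 2) (Ioo k₁ k₂) := by
  simp only [sq_wSup hlam]
  exact (integrable_energySlice lam r).const_mul _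

theorem integral_sq_wSup (hlam : 0 < lam) (r : HK₀ G k₁ k₂) :
    ∫ k in Ioo k₁ k₂, wSup lam r k ^ 2 = G.small lam * energy lam r := by
  simp only [sq_wSup hlam]
  rw [integral_const_mul, integral_energySlice]

theorem memLp_wSup (hlam : 0 < lam) (r : HK₀ G k₁ k₂) :
    MemLp (wSup lam r) 2 (volume.restrict (Ioo k₁ k₂)) :=
  (memLp_two_iff_integrable_sq (((measurable_weightedSup lam r).const_mul _).const_mul
    _).aestronglyMeasurable).2 (integrable_sq_wSup hlam r)

theorem Box.small_nonneg (G : Box) (hlam : 0 < lam) : 0 ≤ G.small lam := by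
  have := G.h_pos
  unfold Box.small
  positivity

theorem sq_wSupInt (hlam : 0 < lam) (hk : k₁ < k₂) (r : HK₀ G k₁ k₂) :
    wSupInt lam r ^ 2 = (k₂ - k₁) * (G.small lam * energy lam r) :=
  Real.sq_sqrt (mul_nonneg (sub_pos.2 hk).le (mul_nonneg (G.small_nonneg hlam) (energy_nonneg _ _)))

theorem ae_weighted_grad_le (hlam : 0 < lam) (r : HK₀ G k₁ k₂) :
    ∀ᵐ x ∂G.domK k₁ k₂, ∀ i l c,
      ‖grad r.1 i l x c‖ * Real.exp (-lam * x.1) ≤ wSup lam r x.2 := by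
  filter_upwards [ae_weighted_zD_zero_le hlam r, ae_weighted_zD_one_le hlam r] with x h0 h1 i l c
  have hS := weightedSup_nonneg lam r x.2
  have hexp := Real.exp_pos (-lam * x.1)
  have hinv : 0 ≤ 1 / lam := by positivity
  rw [wSup, ← le_div_iff₀ hexp, mul_div_assoc]
  refine norm_grad_le (fun j s => ?_) ?_ c
  · rw [le_div_iff₀ hexp]
    calc _ ≤ weightedSup lam r x.2 / lam := h0 j s
      _ = 1 / lam * weightedSup lam r x.2 := by ring
      _ ≤ (1 + 1 / lam) * weightedSup lam r x.2 := by
          gcongr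
          exact le_add_of_nonneg_left zero_le_one
  · rw [le_div_iff₀ hexp]
    exact (h1 _ _).trans (le_mul_of_one_le_left hS (le_add_of_nonneg_right hinv))

theorem ae_weighted_gradInt_le (hlam : 0 < lam) (r : HK₀ G k₁ k₂) :
    ∀ᵐ x ∂G.domK k₁ k₂, ∀ i l c,
      ‖gradInt r.1 i l x c‖ * Real.exp (-lam * x.1) ≤ wSupInt lam r := by
  simp only [ae_all_iff, wSupInt, ← integral_sq_wSup hlam]
  intro i l c
  exact ae_norm_volterra_le (fun z => Real.exp_pos (-lam * z)) (memLp_wSup hlam r)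
    ((ae_weighted_grad_le hlam r).mono fun x hx => hx i l c)

end Volterra

/-! ## The nonlinear operator -/

section Nonlinear

theorem norm_dotProduct_le {ι : Type*} [Fintype ι] {u v : ι → ℂ} {A B : ℝ}
    (hu : ∀ c, ‖u c‖ ≤ A) (hv : ∀ c, ‖v c‖ ≤ B) :
    ‖u ⬝ᵥ v‖ ≤ Fintype.card ι * (A * B) := by
  have hterm : ∀ c ∈ Finset.univ, ‖u c * v c‖ ≤ A * B := fun c _ => by
    rw [norm_mul]
    exact mul_le_mul (hu c) (hv c) (norm_nonneg _) ((norm_nonneg _).trans (hu c))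
  simpa [dotProduct] using norm_sum_le_of_le _ hterm

/-- The lower order terms of `L^h` as a function of `k`, `θ(k)`, `∇^h V`, `∇^h q` and
`S = ∫_k^{k₂} ∇^h q dκ`. -/
def lowerForm (k t : ℝ) (gV gq S : Fin 3 → ℂ) : ℂ :=
  2 * (k : ℂ) * ((gV - S) ⬝ᵥ ((k : ℂ) • gq + (t : ℂ) • gV - S))
    + 2 * Complex.I * ((k : ℂ) * gq 2 + gV 2 - S 2)

/-- The divided difference of `lowerForm`: it is linear in the increments `(gr, Sr)`, and is the
exact increment if `S₁` is the value of `S` at the new point, the derivative if it is the value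
at the old one. -/
def pertForm (k t : ℝ) (gV S₁ g₂ S₂ gr Sr : Fin 3 → ℂ) : ℂ :=
  2 * (k : ℂ) * ((gV - S₁) ⬝ᵥ ((k : ℂ) • gr - Sr)
    - Sr ⬝ᵥ ((k : ℂ) • g₂ + (t : ℂ) • gV - S₂)) + 2 * Complex.I * ((k : ℂ) * gr 2 - Sr 2)

theorem lowerForm_add (k t : ℝ) (gV gq S gr Sr : Fin 3 → ℂ) :
    lowerForm k t gV (gq + gr) (S + Sr)
      = lowerForm k t gV gq S + pertForm k t gV (S + Sr) gq S gr Sr := by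
  simp only [lowerForm, pertForm, dotProduct, Fin.sum_univ_three, Pi.add_apply, Pi.sub_apply,
    Pi.smul_apply, smul_eq_mul]
  ring

theorem pertForm_sub (k t : ℝ) (gV S g₂ S₂ gr Sr : Fin 3 → ℂ) :
    pertForm k t gV (S + Sr) g₂ S₂ gr Sr - pertForm k t gV S g₂ S₂ gr Sr
      = -(2 * (k : ℂ) * (Sr ⬝ᵥ ((k : ℂ) • gr - Sr))) := by
  simp only [pertForm, dotProduct, Fin.sum_univ_three, Pi.add_apply, Pi.sub_apply,
    Pi.smul_apply, smul_eq_mul]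
  ring

theorem pertForm_add (k t : ℝ) (gV S₁ g₂ S₂ gr Sr gr' Sr' : Fin 3 → ℂ) :
    pertForm k t gV S₁ g₂ S₂ (gr + gr') (Sr + Sr')
      = pertForm k t gV S₁ g₂ S₂ gr Sr + pertForm k t gV S₁ g₂ S₂ gr' Sr' := by
  simp only [pertForm, dotProduct, Fin.sum_univ_three, Pi.add_apply, Pi.sub_apply,
    Pi.smul_apply, smul_eq_mul]
  ring

theorem pertForm_smul (k t : ℝ) (gV S₁ g₂ S₂ gr Sr : Fin 3 → ℂ) (a : ℂ) :
    pertForm k t gV S₁ g₂ S₂ (a • gr) (a • Sr) = a * pertForm k t gV S₁ g₂ S₂ gr Sr := by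
  simp only [pertForm, dotProduct, Fin.sum_univ_three, Pi.sub_apply,
    Pi.add_apply, Pi.smul_apply, smul_eq_mul]
  ring

variable {k t b X a e s : ℝ} {gV S₁ g₂ S₂ gr Sr : Fin 3 → ℂ}

theorem norm_ofReal_mul_le {z : ℂ} (hk : |k| ≤ b) (hz : ‖z‖ ≤ a) : ‖(k : ℂ) * z‖ ≤ b * a := by
  rw [norm_mul, Complex.norm_real]
  exact mul_le_mul hk hz (norm_nonneg z) ((abs_nonneg k).trans hk)

theorem norm_two_mul_ofReal_mul_le {z : ℂ} (hk : |k| ≤ b) (hz : ‖z‖ ≤ a) :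
    ‖2 * (k : ℂ) * z‖ ≤ 2 * b * a := by
  rw [mul_assoc, mul_assoc, norm_mul, Complex.norm_ofNat]
  gcongr
  exact norm_ofReal_mul_le hk hz

theorem norm_two_mul_I_mul (z : ℂ) : ‖2 * Complex.I * z‖ = 2 * ‖z‖ := by
  rw [norm_mul, norm_mul, Complex.norm_I, Complex.norm_ofNat, mul_one]

theorem norm_smul_sub_apply_le {c : Fin 3} (hk : |k| ≤ b) (hg : ‖gr c‖ ≤ e) (hS : ‖Sr c‖ ≤ s) :
    ‖((k : ℂ) • gr - Sr) c‖ ≤ b * e + s :=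
  norm_sub_le_of_le (norm_ofReal_mul_le hk hg) hS

theorem norm_smul_add_smul_sub_apply_le {c : Fin 3} (hb : 1 ≤ b) (hk : |k| ≤ b) (ht : |t| ≤ b)
    (hV : ‖gV c‖ ≤ X) (hg : ‖g₂ c‖ ≤ a) (hS : ‖S₂ c‖ ≤ X) :
    ‖((k : ℂ) • g₂ + (t : ℂ) • gV - S₂) c‖ ≤ b * a + 2 * b * X := by
  have hX : 0 ≤ X := (norm_nonneg _).trans hV
  calc _ ≤ b * a + b * X + X := norm_sub_le_of_le
        (norm_add_le_of_le (norm_ofReal_mul_le hk hg) (norm_ofReal_mul_le ht hV)) hS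
    _ ≤ b * a + b * X + b * X := by
        gcongr
        exact le_mul_of_one_le_left hX hb
    _ = b * a + 2 * b * X := by ring

theorem norm_sub_apply_le {c : Fin 3} (hV : ‖gV c‖ ≤ X) (hS : ‖S₁ c‖ ≤ X) :
    ‖(gV - S₁) c‖ ≤ 2 * X :=
  (norm_sub_le_of_le hV hS).trans_eq (two_mul X).symm

theorem norm_pertForm_le (hb : 1 ≤ b) (hk : |k| ≤ b) (ht : |t| ≤ b)
    (hV : ∀ c, ‖gV c‖ ≤ X) (hS₁ : ∀ c, ‖S₁ c‖ ≤ X) (hg₂ : ∀ c, ‖g₂ c‖ ≤ a)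
    (hS₂ : ∀ c, ‖S₂ c‖ ≤ X) (hgr : ∀ c, ‖gr c‖ ≤ e) (hSr : ∀ c, ‖Sr c‖ ≤ s) :
    ‖pertForm k t gV S₁ g₂ S₂ gr Sr‖ ≤ 24 * b ^ 2 * (1 + X) * (e + s + s * a) := by
  have hX : 0 ≤ X := (norm_nonneg _).trans (hV 0)
  have ha : 0 ≤ a := (norm_nonneg _).trans (hg₂ 0)
  have he : 0 ≤ e := (norm_nonneg _).trans (hgr 0)
  have hs : 0 ≤ s := (norm_nonneg _).trans (hSr 0)
  have hfst := norm_dotProduct_le (fun c => norm_sub_apply_le (hV c) (hS₁ c))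
    (fun c => norm_smul_sub_apply_le hk (hgr c) (hSr c))
  have hsnd := norm_dotProduct_le hSr
    (fun c => norm_smul_add_smul_sub_apply_le hb hk ht (hV c) (hg₂ c) (hS₂ c))
  have hlin : ‖2 * Complex.I * ((k : ℂ) * gr 2 - Sr 2)‖ ≤ 2 * (b * e + s) := by
    rw [norm_two_mul_I_mul]
    gcongr
    exact norm_smul_sub_apply_le hk (hgr 2) (hSr 2)
  have hsum := norm_add_le_of_le
    (norm_two_mul_ofReal_mul_le hk (norm_sub_le_of_le hfst hsnd)) hlin
  rw [Fintype.card_fin, Nat.cast_ofNat] at hsum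
  have hbb : b ≤ b ^ 2 := by nlinarith
  have hb1 : 1 ≤ b ^ 2 := by nlinarith
  calc _ ≤ _ := hsum
    _ = b ^ 2 * (12 * (X * e) + 6 * (s * a) + 12 * (X * s)) + b * (12 * (X * s) + 2 * e)
        + 1 * (2 * s) := by ring
    _ ≤ b ^ 2 * (12 * (X * e) + 6 * (s * a) + 12 * (X * s)) + b ^ 2 * (12 * (X * s) + 2 * e)
        + b ^ 2 * (2 * s) := by gcongr
    _ ≤ 24 * b ^ 2 * (1 + X) * (e + s + s * a) := by
        rw [← sub_nonneg]
        ring_nf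
        positivity

theorem norm_quadForm_le (hb : 1 ≤ b) (hk : |k| ≤ b) (hgr : ∀ c, ‖gr c‖ ≤ e)
    (hSr : ∀ c, ‖Sr c‖ ≤ s) :
    ‖-(2 * (k : ℂ) * (Sr ⬝ᵥ ((k : ℂ) • gr - Sr)))‖ ≤ 6 * b ^ 2 * (s * e + s ^ 2) := by
  have hdot := norm_dotProduct_le hSr (fun c => norm_smul_sub_apply_le hk (hgr c) (hSr c))
  have hbb : b ≤ b ^ 2 := by nlinarith
  rw [norm_neg]
  calc _ ≤ _ := norm_two_mul_ofReal_mul_le hk hdot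
    _ = 6 * b ^ 2 * (s * e) + 6 * b * s ^ 2 := by
        rw [Fintype.card_fin, Nat.cast_ofNat]
        ring
    _ ≤ 6 * b ^ 2 * (s * e) + 6 * b ^ 2 * s ^ 2 := by gcongr
    _ = 6 * b ^ 2 * (s * e + s ^ 2) := by ring

theorem norm_lowerForm_le (hb : 1 ≤ b) (hk : |k| ≤ b) (ht : |t| ≤ b)
    (hV : ∀ c, ‖gV c‖ ≤ X) (hg₂ : ∀ c, ‖g₂ c‖ ≤ a) (hS₂ : ∀ c, ‖S₂ c‖ ≤ X) :
    ‖lowerForm k t gV g₂ S₂‖ ≤ 24 * b ^ 2 * (1 + X) * (a + X) := by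
  have hX : 0 ≤ X := (norm_nonneg _).trans (hV 0)
  have ha : 0 ≤ a := (norm_nonneg _).trans (hg₂ 0)
  have hdot := norm_dotProduct_le (fun c => norm_sub_apply_le (hV c) (hS₂ c))
    (fun c => norm_smul_add_smul_sub_apply_le hb hk ht (hV c) (hg₂ c) (hS₂ c))
  have hlin : ‖2 * Complex.I * ((k : ℂ) * g₂ 2 + gV 2 - S₂ 2)‖ ≤ 2 * (b * a + 2 * b * X) := by
    rw [norm_two_mul_I_mul]
    gcongr
    simpa using norm_smul_add_smul_sub_apply_le (t := 1) hb hk (by simpa) (hV 2) (hg₂ 2) (hS₂ 2)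
  have hsum := norm_add_le_of_le (norm_two_mul_ofReal_mul_le hk hdot) hlin
  rw [Fintype.card_fin, Nat.cast_ofNat] at hsum
  have hbb : b ≤ b ^ 2 := by nlinarith
  calc _ ≤ _ := hsum
    _ = b ^ 2 * (12 * (X * a) + 24 * X ^ 2) + b * (2 * a + 4 * X) := by ring
    _ ≤ b ^ 2 * (12 * (X * a) + 24 * X ^ 2) + b ^ 2 * (2 * a + 4 * X) := by gcongr
    _ ≤ 24 * b ^ 2 * (1 + X) * (a + X) := by
        rw [← sub_nonneg]
        ring_nf
        positivity

end Nonlinear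

section Operator

variable {G : Box} {k₁ k₂ : ℝ}

/-- `pertForm` at the data of the semidiscrete problem. By `ae_Lop_add`, `L^h` has the increment
`Δ^h r + pert θ V (q + r) q r` and the derivative `Δ^h r + pert θ V q q r` at `q` in the
direction `r`. -/
def pert (θ : ℝ → ℝ) (V : HΩ G 2) (q₁ q₂ r : HK G k₁ k₂ 2) (i l : Fin G.n) (x : ℝ × ℝ) : ℂ :=
  pertForm x.2 (θ x.2) (grad V i l (x.1, ())) (gradInt q₁ i l x) (grad q₂ i l x)
    (gradInt q₂ i l x) (grad r i l x) (gradInt r i l x)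

theorem Lop_eq (θ : ℝ → ℝ) (V : HΩ G 2) (q : HK G k₁ k₂ 2) (i l : Fin G.n) (x : ℝ × ℝ) :
    Lop G k₁ k₂ θ V q i l x = lap q i l x
      + lowerForm x.2 (θ x.2) (grad V i l (x.1, ())) (grad q i l x) (gradInt q i l x) :=
  add_assoc _ _ _

theorem ae_Lop_add (θ : ℝ → ℝ) (V : HΩ G 2) (q r : HK G k₁ k₂ 2) :
    ∀ᵐ x ∂G.domK k₁ k₂, ∀ i l, Lop G k₁ k₂ θ V (q + r) i l x
      = Lop G k₁ k₂ θ V q i l x + (lap r i l x + pert θ V (q + r) q r i l x) := by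
  filter_upwards [ae_zD_add q r, ae_gradInt_add q r] with x hzD hinteg i l
  rw [Lop_eq, Lop_eq, lap_eq_add hzD, grad_eq_add hzD, hinteg, lowerForm_add, pert, hinteg]
  ring

theorem ae_pert_sub (θ : ℝ → ℝ) (V : HΩ G 2) (q r : HK G k₁ k₂ 2) :
    ∀ᵐ x ∂G.domK k₁ k₂, ∀ i l, pert θ V (q + r) q r i l x - pert θ V q q r i l x
      = -(2 * (x.2 : ℂ) * (gradInt r i l x ⬝ᵥ ((x.2 : ℂ) • grad r i l x - gradInt r i l x))) := by
  filter_upwards [ae_gradInt_add q r] with x hinteg i l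
  rw [pert, pert, hinteg, pertForm_sub]

theorem ae_pert_add (θ : ℝ → ℝ) (V : HΩ G 2) (q₁ q₂ r r' : HK G k₁ k₂ 2) :
    ∀ᵐ x ∂G.domK k₁ k₂, ∀ i l, pert θ V q₁ q₂ (r + r') i l x
      = pert θ V q₁ q₂ r i l x + pert θ V q₁ q₂ r' i l x := by
  filter_upwards [ae_zD_add r r', ae_gradInt_add r r'] with x hzD hinteg i l
  rw [pert, hinteg, grad_eq_add hzD, pertForm_add, pert, pert]

theorem ae_pert_smul (θ : ℝ → ℝ) (V : HΩ G 2) (q₁ q₂ r : HK G k₁ k₂ 2) (a : ℝ) :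
    ∀ᵐ x ∂G.domK k₁ k₂, ∀ i l, pert θ V q₁ q₂ (a • r) i l x
      = (a : ℂ) * pert θ V q₁ q₂ r i l x := by
  filter_upwards [ae_zD_smul a r, ae_gradInt_smul a r] with x hzD hinteg i l
  rw [pert, hinteg, grad_eq_smul hzD, pertForm_smul, pert]

theorem measurable_grad_tail (V : HΩ G 2) (i l : Fin G.n) (c : Fin 3) :
    Measurable fun x : ℝ × ℝ => grad V i l (x.1, ()) c :=
  (measurable_grad V i l c).comp (measurable_fst.prodMk measurable_const)

theorem measurable_pert {θ : ℝ → ℝ} (hθ : Measurable θ) (V : HΩ G 2) (q₁ q₂ r : HK G k₁ k₂ 2)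
    (i l : Fin G.n) : Measurable (pert θ V q₁ q₂ r i l) := by
  have hV := measurable_grad_tail V i l
  have hS₁ := measurable_gradInt q₁ i l
  have hS₂ := measurable_gradInt q₂ i l
  have hSr := measurable_gradInt r i l
  have hg₂ := measurable_grad q₂ i l
  have hgr := measurable_grad r i l
  unfold pert pertForm
  simp only [dotProduct, Fin.sum_univ_three, Pi.add_apply, Pi.sub_apply,
    Pi.smul_apply, smul_eq_mul]
  fun_prop

theorem measurable_Lop {θ : ℝ → ℝ} (hθ : Measurable θ) (V : HΩ G 2) (q : HK G k₁ k₂ 2)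
    (i l : Fin G.n) : Measurable (Lop G k₁ k₂ θ V q i l) := by
  have hV := measurable_grad_tail V i l
  have hS := measurable_gradInt q i l
  have hgq := measurable_grad q i l
  have hlap := measurable_lap q i l
  rw [funext (Lop_eq θ V q i l)]
  unfold lowerForm
  simp only [dotProduct, Fin.sum_univ_three, Pi.add_apply, Pi.sub_apply,
    Pi.smul_apply, smul_eq_mul]
  fun_prop

end Operator

section Bounds

theorem integral_add_add {α : Type*} [MeasurableSpace α] {μ : Measure α} {f g h : α → ℝ}
    (hf : Integrable f μ) (hg : Integrable g μ) (hh : Integrable h μ) :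
    ∫ x, f x + g x + h x ∂μ = ∫ x, f x ∂μ + ∫ x, g x ∂μ + ∫ x, h x ∂μ := by
  rw [← integral_add hf hg]
  exact integral_add (hf.add hg) hh

theorem integrable_of_nonneg_of_ae_le {α : Type*} [MeasurableSpace α] {μ : Measure α}
    {f g : α → ℝ} (hf : AEStronglyMeasurable f μ) (h0 : ∀ x, 0 ≤ f x) (h : ∀ᵐ x ∂μ, f x ≤ g x)
    (hg : Integrable g μ) : Integrable f μ :=
  hg.mono' hf (h.mono fun x hx => (Real.norm_of_nonneg (h0 x)).trans_le hx)

theorem sq_add_add_le (a b c : ℝ) : (a + b + c) ^ 2 ≤ 3 * a ^ 2 + 3 * b ^ 2 + 3 * c ^ 2 := by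
  nlinarith [sq_nonneg (a - b), sq_nonneg (a - c), sq_nonneg (b - c)]

/-- The standing assumptions on the coefficients of `L^h`: `b` bounds the parameter `k` and the
coefficient `θ`, and `Y` bounds the tail function `V`. -/
structure Coeff (G : Box) (k₁ k₂ : ℝ) (θ : ℝ → ℝ) (V : HΩ G 2) (b Y : ℝ) : Prop where
  lt : k₁ < k₂
  measurable : Measurable θ
  one_le : 1 ≤ b
  abs_param_le : ∀ k ∈ Ioo k₁ k₂, |k| ≤ b
  abs_coeff_le : ∀ k ∈ Ioo k₁ k₂, |θ k| ≤ b
  norm_le : ‖V‖ ≤ Y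

/-- The bound for the gradient of a function of norm at most `Y`. -/
def Box.supBound (G : Box) (Y : ℝ) : ℝ := G.supConst * Y / G.h

/-- The common bound for `∇^h V` and `∫_k^{k₂} ∇^h q dκ`. -/
def Box.gradBound (G : Box) (k₁ k₂ Y : ℝ) : ℝ := (1 + √(k₂ - k₁)) * G.supBound Y

/-- The bound for the coefficients of the lower order terms. -/
def Box.coeffBound (G : Box) (k₁ k₂ b Y : ℝ) : ℝ := 24 * b ^ 2 * (1 + G.gradBound k₁ k₂ Y)

/-- The bound for `∫ |L^h(q)|² dz dk` if `‖q‖ ≤ Y`. -/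
def Box.opBound (G : Box) (k₁ k₂ b Y : ℝ) : ℝ :=
  3 * ((1 + 8 / G.h ^ 2) ^ 2 * (Y ^ 2 / G.h ^ 2))
    + 3 * G.coeffBound k₁ k₂ b Y ^ 2 * (G.len * G.supBound Y ^ 2)
    + 3 * (G.coeffBound k₁ k₂ b Y * G.gradBound k₁ k₂ Y) ^ 2 * (G.len * (k₂ - k₁))

/-- The bound for the lower order part `pert` of an increment, relative to the energy. -/
def Box.pertBound (G : Box) (k₁ k₂ b Y : ℝ) : ℝ :=
  3 * G.coeffBound k₁ k₂ b Y ^ 2 * G.len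
    * (1 + (k₂ - k₁) ^ 2 + (k₂ - k₁) * G.supBound Y ^ 2)

/-- The bound for the integral of `crossTerm`, relative to the energy. -/
def Box.quadBound (G : Box) (k₁ k₂ b Y : ℝ) : ℝ :=
  6 * b ^ 2 * (2 * (k₂ - k₁) * G.opBound k₁ k₂ b Y + G.len + (k₂ - k₁) ^ 2 * G.len)

variable {G : Box} {k₁ k₂ b Y lam : ℝ} {θ : ℝ → ℝ} {V : HΩ G 2}

theorem Box.supBound_nonneg (G : Box) (hY : 0 ≤ Y) : 0 ≤ G.supBound Y :=
  div_nonneg (mul_nonneg G.supConst_nonneg hY) G.h_pos.le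

theorem Box.supBound_le_supBound (G : Box) {Z : ℝ} (h : Z ≤ Y) : G.supBound Z ≤ G.supBound Y := by
  have hh := G.h_pos
  have hS := G.supConst_nonneg
  unfold Box.supBound
  gcongr

section Param

theorem integrable_domK_const (c : ℝ) : Integrable (fun _ : ℝ × ℝ => c) (G.domK k₁ k₂) :=
  Box.integrable_param (integrable_const c)

theorem integral_domK_const (hk : k₁ < k₂) (c : ℝ) :
    ∫ _x, c ∂G.domK k₁ k₂ = c * (G.len * (k₂ - k₁)) := by
  rw [Box.integral_param (fun _ => c), integral_const, measureReal_restrict_apply_univ,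
    Real.volume_real_Ioo_of_le hk.le, smul_eq_mul]
  ring

theorem integrable_domK_sq_gradSup (q : HK G k₁ k₂ 2) :
    Integrable (fun x => gradSup q x.2 ^ 2) (G.domK k₁ k₂) :=
  Box.integrable_param (integrable_sq_gradSup q)

theorem integral_domK_sq_gradSup_le {q : HK G k₁ k₂ 2} (hq : ‖q‖ ≤ Y) :
    ∫ x, gradSup q x.2 ^ 2 ∂G.domK k₁ k₂ ≤ G.len * G.supBound Y ^ 2 := by
  have hlen := G.len_pos
  have hsup := G.supBound_nonneg (norm_nonneg q)
  rw [Box.integral_param (fun k => gradSup q k ^ 2), integral_sq_gradSup]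
  change G.len * G.supBound ‖q‖ ^ 2 ≤ _
  gcongr
  exact G.supBound_le_supBound hq

theorem integrable_domK_sq_wSup (hlam : 0 < lam) (r : HK₀ G k₁ k₂) :
    Integrable (fun x => wSup lam r x.2 ^ 2) (G.domK k₁ k₂) :=
  Box.integrable_param (integrable_sq_wSup hlam r)

theorem integral_domK_sq_wSup (hlam : 0 < lam) (r : HK₀ G k₁ k₂) :
    ∫ x, wSup lam r x.2 ^ 2 ∂G.domK k₁ k₂ = G.len * (G.small lam * energy lam r) := by
  rw [Box.integral_param (fun k => wSup lam r k ^ 2), integral_sq_wSup hlam]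

end Param

namespace Coeff

theorem mono (H : Coeff G k₁ k₂ θ V b Y) {Z : ℝ} (h : Y ≤ Z) : Coeff G k₁ k₂ θ V b Z :=
  { H with norm_le := H.norm_le.trans h }

theorem nonneg (H : Coeff G k₁ k₂ θ V b Y) : 0 ≤ Y := (norm_nonneg _).trans H.norm_le

theorem opBound_nonneg (H : Coeff G k₁ k₂ θ V b Y) : 0 ≤ G.opBound k₁ k₂ b Y := by
  have hlen := G.len_pos
  have hk := sub_pos.2 H.lt
  unfold Box.opBound
  positivity

theorem pertBound_nonneg (H : Coeff G k₁ k₂ θ V b Y) : 0 ≤ G.pertBound k₁ k₂ b Y := by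
  have hlen := G.len_pos
  have hk := sub_pos.2 H.lt
  unfold Box.pertBound
  positivity

theorem quadBound_nonneg (H : Coeff G k₁ k₂ θ V b Y) : 0 ≤ G.quadBound k₁ k₂ b Y := by
  have hop := H.opBound_nonneg
  have hlen := G.len_pos
  have hk := sub_pos.2 H.lt
  unfold Box.quadBound
  positivity

theorem ae_norm_grad_tail_le (H : Coeff G k₁ k₂ θ V b Y) :
    ∀ᵐ x ∂G.domK k₁ k₂, ∀ i l c, ‖grad V i l (x.1, ()) c‖ ≤ G.gradBound k₁ k₂ Y := by
  filter_upwards [SemiDiscrete.ae_norm_grad_tail_le (k₁ := k₁) (k₂ := k₂) V] with x hx i l c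
  calc ‖grad V i l (x.1, ()) c‖ ≤ G.supBound ‖V‖ := hx i l c
    _ ≤ G.supBound Y := G.supBound_le_supBound H.norm_le
    _ ≤ G.gradBound k₁ k₂ Y := le_mul_of_one_le_left (G.supBound_nonneg H.nonneg)
        (le_add_of_nonneg_right (Real.sqrt_nonneg _))

theorem ae_norm_gradInt_le (H : Coeff G k₁ k₂ θ V b Y) {q : HK G k₁ k₂ 2} (hq : ‖q‖ ≤ Y) :
    ∀ᵐ x ∂G.domK k₁ k₂, ∀ i l c, ‖gradInt q i l x c‖ ≤ G.gradBound k₁ k₂ Y := by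
  filter_upwards [SemiDiscrete.ae_norm_gradInt_le q] with x hx i l c
  calc ‖gradInt q i l x c‖ ≤ √(k₂ - k₁) * G.supBound ‖q‖ := hx i l c
    _ ≤ √(k₂ - k₁) * G.supBound Y := by
        gcongr
        exact G.supBound_le_supBound hq
    _ ≤ G.gradBound k₁ k₂ Y := mul_le_mul_of_nonneg_right (le_add_of_nonneg_left zero_le_one)
        (G.supBound_nonneg H.nonneg)

theorem ae_sq_norm_Lop_le (H : Coeff G k₁ k₂ θ V b Y) {q : HK G k₁ k₂ 2} (hq : ‖q‖ ≤ Y)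
    (i l : Fin G.n) :
    ∀ᵐ x ∂G.domK k₁ k₂, ‖Lop G k₁ k₂ θ V q i l x‖ ^ 2
      ≤ 3 * ‖lap q i l x‖ ^ 2 + 3 * G.coeffBound k₁ k₂ b Y ^ 2 * gradSup q x.2 ^ 2
        + 3 * (G.coeffBound k₁ k₂ b Y * G.gradBound k₁ k₂ Y) ^ 2 := by
  filter_upwards [H.ae_norm_grad_tail_le, H.ae_norm_gradInt_le hq, ae_norm_grad_le q,
    Box.ae_mem_param G k₁ k₂] with x hV hS hg hm
  have hlower : ‖lowerForm x.2 (θ x.2) (grad V i l (x.1, ())) (grad q i l x) (gradInt q i l x)‖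
      ≤ G.coeffBound k₁ k₂ b Y * (gradSup q x.2 + G.gradBound k₁ k₂ Y) :=
    norm_lowerForm_le H.one_le (H.abs_param_le _ hm) (H.abs_coeff_le _ hm)
      (hV i l) (hg i l) (hS i l)
  calc ‖Lop G k₁ k₂ θ V q i l x‖ ^ 2
      ≤ (‖lap q i l x‖ + G.coeffBound k₁ k₂ b Y * gradSup q x.2
          + G.coeffBound k₁ k₂ b Y * G.gradBound k₁ k₂ Y) ^ 2 := by
        rw [Lop_eq, add_assoc, ← mul_add]
        gcongr
        exact norm_add_le_of_le le_rfl hlower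
    _ ≤ _ := sq_add_add_le _ _ _
    _ = _ := by ring

theorem integrable_sq_norm_Lop_bound (q : HK G k₁ k₂ 2) (i l : Fin G.n) (a c : ℝ) :
    Integrable (fun x => 3 * ‖lap q i l x‖ ^ 2 + a * gradSup q x.2 ^ 2 + c) (G.domK k₁ k₂) :=
  (((integrable_sq_lap q i l).const_mul 3).add ((integrable_domK_sq_gradSup q).const_mul _)).add
    (integrable_domK_const _)

theorem integrable_sq_norm_Lop (H : Coeff G k₁ k₂ θ V b Y) (q : HK G k₁ k₂ 2) (i l : Fin G.n) :
    Integrable (fun x => ‖Lop G k₁ k₂ θ V q i l x‖ ^ 2) (G.domK k₁ k₂) :=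
  integrable_of_nonneg_of_ae_le
    ((measurable_Lop H.measurable V q i l).norm.pow_const 2).aestronglyMeasurable
    (fun _ => sq_nonneg _) ((H.mono (le_max_left Y ‖q‖)).ae_sq_norm_Lop_le (le_max_right _ _) i l)
    (integrable_sq_norm_Lop_bound q i l _ _)

theorem integral_sq_norm_Lop_le (H : Coeff G k₁ k₂ θ V b Y) {q : HK G k₁ k₂ 2} (hq : ‖q‖ ≤ Y)
    (i l : Fin G.n) :
    ∫ x, ‖Lop G k₁ k₂ θ V q i l x‖ ^ 2 ∂G.domK k₁ k₂ ≤ G.opBound k₁ k₂ b Y := by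
  have hlap : ∫ x, ‖lap q i l x‖ ^ 2 ∂G.domK k₁ k₂
      ≤ (1 + 8 / G.h ^ 2) ^ 2 * (Y ^ 2 / G.h ^ 2) :=
    (integral_sq_lap_le q i l).trans (by gcongr)
  refine (integral_mono_ae (H.integrable_sq_norm_Lop q i l)
    (integrable_sq_norm_Lop_bound q i l _ _) (H.ae_sq_norm_Lop_le hq i l)).trans ?_
  rw [integral_add_add ((integrable_sq_lap q i l).const_mul 3)
      ((integrable_domK_sq_gradSup q).const_mul _) (integrable_domK_const _),
    integral_const_mul, integral_const_mul, integral_domK_const H.lt, Box.opBound]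
  gcongr
  exact integral_domK_sq_gradSup_le hq

theorem ae_weighted_sq_norm_pert_le (H : Coeff G k₁ k₂ θ V b Y) (hlam : 0 < lam)
    {q₁ q₂ : HK G k₁ k₂ 2} (hq₁ : ‖q₁‖ ≤ Y) (hq₂ : ‖q₂‖ ≤ Y) (r : HK₀ G k₁ k₂) (i l : Fin G.n) :
    ∀ᵐ x ∂G.domK k₁ k₂, ‖pert θ V q₁ q₂ r.1 i l x‖ ^ 2 * Real.exp (-2 * lam * x.1)
      ≤ 3 * G.coeffBound k₁ k₂ b Y ^ 2 * wSup lam r x.2 ^ 2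
        + 3 * G.coeffBound k₁ k₂ b Y ^ 2 * wSupInt lam r ^ 2
        + 3 * G.coeffBound k₁ k₂ b Y ^ 2 * wSupInt lam r ^ 2 * gradSup q₂ x.2 ^ 2 := by
  filter_upwards [H.ae_norm_grad_tail_le, H.ae_norm_gradInt_le hq₁, H.ae_norm_gradInt_le hq₂,
    ae_norm_grad_le q₂, ae_weighted_grad_le hlam r, ae_weighted_gradInt_le hlam r,
    Box.ae_mem_param G k₁ k₂] with x hV hS₁ hS₂ hg hgr hSr hm
  have hexp := Real.exp_pos (-lam * x.1)
  rw [← sq_exp_neg_mul, ← mul_pow]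
  set ω := Real.exp (-lam * x.1)
  set e := wSup lam r x.2
  set s := wSupInt lam r
  set C := G.coeffBound k₁ k₂ b Y
  have hpert : ‖pert θ V q₁ q₂ r.1 i l x‖ ≤ C * (e / ω + s / ω + s / ω * gradSup q₂ x.2) :=
    norm_pertForm_le H.one_le (H.abs_param_le _ hm) (H.abs_coeff_le _ hm) (hV i l) (hS₁ i l)
      (hg i l) (hS₂ i l) (fun c => (le_div_iff₀ hexp).2 (hgr i l c))
      (fun c => (le_div_iff₀ hexp).2 (hSr i l c))
  calc (‖pert θ V q₁ q₂ r.1 i l x‖ * ω) ^ 2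
      ≤ (C * (e / ω + s / ω + s / ω * gradSup q₂ x.2) * ω) ^ 2 := by gcongr
    _ = (C * e + C * s + C * (s * gradSup q₂ x.2)) ^ 2 := by field_simp
    _ ≤ _ := sq_add_add_le _ _ _
    _ = _ := by ring

theorem integrable_weighted_sq_norm_pert_bound (hlam : 0 < lam) (q₂ : HK G k₁ k₂ 2)
    (r : HK₀ G k₁ k₂) (a c c' : ℝ) :
    Integrable (fun x => a * wSup lam r x.2 ^ 2 + c + c' * gradSup q₂ x.2 ^ 2) (G.domK k₁ k₂) :=
  (((integrable_domK_sq_wSup hlam r).const_mul _).add (integrable_domK_const _)).add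
    ((integrable_domK_sq_gradSup q₂).const_mul _)

theorem integrable_weighted_sq_norm_pert (H : Coeff G k₁ k₂ θ V b Y) (hlam : 0 < lam)
    (q₁ q₂ : HK G k₁ k₂ 2) (r : HK₀ G k₁ k₂) (i l : Fin G.n) :
    Integrable (fun x => ‖pert θ V q₁ q₂ r.1 i l x‖ ^ 2 * Real.exp (-2 * lam * x.1))
      (G.domK k₁ k₂) := by
  have hmeas := measurable_pert H.measurable V q₁ q₂ r.1 i l
  have hmeas_sq : Measurable fun x =>
      ‖pert θ V q₁ q₂ r.1 i l x‖ ^ 2 * Real.exp (-2 * lam * x.1) := by fun_prop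
  exact integrable_of_nonneg_of_ae_le hmeas_sq.aestronglyMeasurable (fun _ => by positivity)
    ((H.mono (le_max_left Y (max ‖q₁‖ ‖q₂‖))).ae_weighted_sq_norm_pert_le hlam
      ((le_max_left _ _).trans (le_max_right _ _)) ((le_max_right _ _).trans (le_max_right _ _))
      r i l)
    (integrable_weighted_sq_norm_pert_bound hlam q₂ r _ _ _)

theorem integral_weighted_sq_norm_pert_le (H : Coeff G k₁ k₂ θ V b Y) (hlam : 0 < lam)
    {q₁ q₂ : HK G k₁ k₂ 2} (hq₁ : ‖q₁‖ ≤ Y) (hq₂ : ‖q₂‖ ≤ Y) (r : HK₀ G k₁ k₂) (i l : Fin G.n) :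
    ∫ x, ‖pert θ V q₁ q₂ r.1 i l x‖ ^ 2 * Real.exp (-2 * lam * x.1) ∂G.domK k₁ k₂
      ≤ G.pertBound k₁ k₂ b Y * (G.small lam * energy lam r) := by
  set C := G.coeffBound k₁ k₂ b Y
  calc _ ≤ ∫ x, 3 * C ^ 2 * wSup lam r x.2 ^ 2 + 3 * C ^ 2 * wSupInt lam r ^ 2
          + 3 * C ^ 2 * wSupInt lam r ^ 2 * gradSup q₂ x.2 ^ 2 ∂G.domK k₁ k₂ :=
        integral_mono_ae (H.integrable_weighted_sq_norm_pert hlam q₁ q₂ r i l)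
          (integrable_weighted_sq_norm_pert_bound hlam q₂ r _ _ _)
          (H.ae_weighted_sq_norm_pert_le hlam hq₁ hq₂ r i l)
    _ = 3 * C ^ 2 * (G.len * (G.small lam * energy lam r))
        + 3 * C ^ 2 * wSupInt lam r ^ 2 * (G.len * (k₂ - k₁))
        + 3 * C ^ 2 * wSupInt lam r ^ 2 * ∫ x, gradSup q₂ x.2 ^ 2 ∂G.domK k₁ k₂ := by
        rw [integral_add_add ((integrable_domK_sq_wSup hlam r).const_mul _)
            (integrable_domK_const _) ((integrable_domK_sq_gradSup q₂).const_mul _),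
          integral_const_mul, integral_domK_sq_wSup hlam, integral_domK_const H.lt,
          integral_const_mul]
    _ ≤ 3 * C ^ 2 * (G.len * (G.small lam * energy lam r))
        + 3 * C ^ 2 * wSupInt lam r ^ 2 * (G.len * (k₂ - k₁))
        + 3 * C ^ 2 * wSupInt lam r ^ 2 * (G.len * G.supBound Y ^ 2) := by
        gcongr
        exact integral_domK_sq_gradSup_le hq₂
    _ = _ := by
        rw [sq_wSupInt hlam H.lt, Box.pertBound]
        ring

end Coeff

/-- The product of the operator with the quadratic part of its increment. -/
def crossTerm (θ : ℝ → ℝ) (V : HΩ G 2) (lam : ℝ) (q r : HK G k₁ k₂ 2) (i l : Fin G.n)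
    (x : ℝ × ℝ) : ℝ :=
  2 * (‖Lop G k₁ k₂ θ V q i l x‖ * ‖pert θ V (q + r) q r i l x - pert θ V q q r i l x‖)
    * Real.exp (-2 * lam * x.1)

theorem crossTerm_nonneg (lam : ℝ) (q r : HK G k₁ k₂ 2) (i l : Fin G.n) (x : ℝ × ℝ) :
    0 ≤ crossTerm θ V lam q r i l x := by
  unfold crossTerm
  positivity

namespace Coeff

theorem ae_crossTerm_le (H : Coeff G k₁ k₂ θ V b Y) (hlam : 0 < lam)
    (q : HK G k₁ k₂ 2) (r : HK₀ G k₁ k₂) (i l : Fin G.n) :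
    ∀ᵐ x ∂G.domK k₁ k₂, crossTerm θ V lam q r.1 i l x
      ≤ 6 * b ^ 2 * (2 * wSupInt lam r ^ 2) * ‖Lop G k₁ k₂ θ V q i l x‖ ^ 2
        + 6 * b ^ 2 * wSup lam r x.2 ^ 2 + 6 * b ^ 2 * wSupInt lam r ^ 2 := by
  filter_upwards [ae_pert_sub θ V q r.1, ae_weighted_grad_le hlam r,
    ae_weighted_gradInt_le hlam r, Box.ae_mem_param G k₁ k₂] with x hp hgr hSr hm
  have hexp := Real.exp_pos (-lam * x.1)
  have hquad := norm_quadForm_le H.one_le (H.abs_param_le _ hm)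
    (fun c => (le_div_iff₀ hexp).2 (hgr i l c)) (fun c => (le_div_iff₀ hexp).2 (hSr i l c))
  rw [← hp i l] at hquad
  rw [crossTerm, ← sq_exp_neg_mul]
  set ω := Real.exp (-lam * x.1)
  set e := wSup lam r x.2
  set s := wSupInt lam r
  set L := ‖Lop G k₁ k₂ θ V q i l x‖
  set D := ‖pert θ V (q + r.1) q r.1 i l x - pert θ V q q r.1 i l x‖
  have : 0 ≤ L := norm_nonneg _
  calc 2 * (L * D) * ω ^ 2 = 2 * L * (D * ω ^ 2) := by ring
    _ ≤ 2 * L * (6 * b ^ 2 * (s / ω * (e / ω) + (s / ω) ^ 2) * ω ^ 2) := by gcongr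
    _ = 6 * b ^ 2 * (2 * (s * L) * e + 2 * L * s ^ 2) := by
        field_simp
    _ ≤ 6 * b ^ 2 * ((s * L) ^ 2 + e ^ 2 + (1 + L ^ 2) * s ^ 2) := by
        gcongr
        · exact two_mul_le_add_sq _ _
        · linarith [two_mul_le_add_sq 1 L]
    _ = _ := by ring

theorem integrable_crossTerm_bound (H : Coeff G k₁ k₂ θ V b Y) (hlam : 0 < lam)
    (q : HK G k₁ k₂ 2) (r : HK₀ G k₁ k₂) (i l : Fin G.n) (a c c' : ℝ) :
    Integrable (fun x => a * ‖Lop G k₁ k₂ θ V q i l x‖ ^ 2 + c * wSup lam r x.2 ^ 2 + c')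
      (G.domK k₁ k₂) :=
  (((H.integrable_sq_norm_Lop q i l).const_mul _).add
    ((integrable_domK_sq_wSup hlam r).const_mul _)).add (integrable_domK_const _)

theorem integrable_crossTerm (H : Coeff G k₁ k₂ θ V b Y) (hlam : 0 < lam)
    (q : HK G k₁ k₂ 2) (r : HK₀ G k₁ k₂) (i l : Fin G.n) :
    Integrable (crossTerm θ V lam q r.1 i l) (G.domK k₁ k₂) := by
  have hincr := measurable_pert H.measurable V (q + r.1) q r.1 i l
  have hderiv := measurable_pert H.measurable V q q r.1 i l
  have hLop := measurable_Lop H.measurable V q i l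
  have hmeas : Measurable (crossTerm θ V lam q r.1 i l) := by
    unfold crossTerm
    fun_prop
  exact integrable_of_nonneg_of_ae_le hmeas.aestronglyMeasurable (crossTerm_nonneg _ _ _ _ _)
    (H.ae_crossTerm_le hlam q r i l) (H.integrable_crossTerm_bound hlam q r i l _ _ _)

theorem integral_crossTerm_le (H : Coeff G k₁ k₂ θ V b Y) (hlam : 0 < lam)
    {q : HK G k₁ k₂ 2} (hq : ‖q‖ ≤ Y) (r : HK₀ G k₁ k₂) (i l : Fin G.n) :
    ∫ x, crossTerm θ V lam q r.1 i l x ∂G.domK k₁ k₂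
      ≤ G.quadBound k₁ k₂ b Y * (G.small lam * energy lam r) := by
  calc _ ≤ ∫ x, 6 * b ^ 2 * (2 * wSupInt lam r ^ 2) * ‖Lop G k₁ k₂ θ V q i l x‖ ^ 2
          + 6 * b ^ 2 * wSup lam r x.2 ^ 2 + 6 * b ^ 2 * wSupInt lam r ^ 2 ∂G.domK k₁ k₂ :=
        integral_mono_ae (H.integrable_crossTerm hlam q r i l)
          (H.integrable_crossTerm_bound hlam q r i l _ _ _) (H.ae_crossTerm_le hlam q r i l)
    _ = 6 * b ^ 2 * (2 * wSupInt lam r ^ 2)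
          * ∫ x, ‖Lop G k₁ k₂ θ V q i l x‖ ^ 2 ∂G.domK k₁ k₂
        + 6 * b ^ 2 * (G.len * (G.small lam * energy lam r))
        + 6 * b ^ 2 * wSupInt lam r ^ 2 * (G.len * (k₂ - k₁)) := by
        rw [integral_add_add ((H.integrable_sq_norm_Lop q i l).const_mul _)
            ((integrable_domK_sq_wSup hlam r).const_mul _) (integrable_domK_const _),
          integral_const_mul, integral_const_mul, integral_domK_sq_wSup hlam,
          integral_domK_const H.lt]
    _ ≤ 6 * b ^ 2 * (2 * wSupInt lam r ^ 2) * G.opBound k₁ k₂ b Y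
        + 6 * b ^ 2 * (G.len * (G.small lam * energy lam r))
        + 6 * b ^ 2 * wSupInt lam r ^ 2 * (G.len * (k₂ - k₁)) := by
        gcongr
        exact H.integral_sq_norm_Lop_le hq i l
    _ = _ := by
        rw [sq_wSupInt hlam H.lt, Box.quadBound]
        ring

end Coeff

end Bounds

/-! ## Differentiability and convexity of the cost -/

section InnerProduct

variable {E : Type*} [NormedAddCommGroup E] [InnerProductSpace ℝ E]

theorem sq_norm_add_le (a b : E) : ‖a + b‖ ^ 2 ≤ 2 * ‖a‖ ^ 2 + 2 * ‖b‖ ^ 2 := by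
  linarith [parallelogram_law_with_norm ℝ a b, sq_nonneg ‖a - b‖]

theorem abs_two_mul_inner_add_le (a b c : E) :
    |2 * inner ℝ a (b + c)| ≤ ‖a‖ ^ 2 + 2 * ‖b‖ ^ 2 + 2 * ‖c‖ ^ 2 := by
  calc |2 * inner ℝ a (b + c)| = 2 * |inner ℝ a (b + c)| := by rw [abs_mul, abs_two]
    _ ≤ 2 * (‖a‖ * ‖b + c‖) := by
        gcongr
        exact abs_real_inner_le_norm a (b + c)
    _ ≤ ‖a‖ ^ 2 + ‖b + c‖ ^ 2 := by
        rw [← mul_assoc]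
        exact two_mul_le_add_sq _ _
    _ ≤ _ := by
        rw [add_assoc]
        gcongr
        exact sq_norm_add_le b c

theorem sq_norm_add_sub_inner_eq (a d p p' : E) :
    ‖a + (d + p)‖ ^ 2 - ‖a‖ ^ 2 - 2 * inner ℝ a (d + p')
      = ‖d + p‖ ^ 2 + 2 * inner ℝ a (p - p') := by
  rw [norm_add_sq_real, inner_sub_right, inner_add_right, inner_add_right]
  ring

theorem half_sq_norm_le_remainder (a d p p' : E) :
    1 / 2 * ‖d‖ ^ 2 ≤ ‖a + (d + p)‖ ^ 2 - ‖a‖ ^ 2 - 2 * inner ℝ a (d + p')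
      + ‖p‖ ^ 2 + 2 * (‖a‖ * ‖p - p'‖) := by
  have hd := sq_norm_add_le (d + p) (-p)
  rw [add_neg_cancel_right, norm_neg] at hd
  linarith [sq_norm_add_sub_inner_eq a d p p', neg_le_of_abs_le (abs_real_inner_le_norm a (p - p'))]

theorem remainder_le (a d p p' : E) :
    ‖a + (d + p)‖ ^ 2 - ‖a‖ ^ 2 - 2 * inner ℝ a (d + p')
      ≤ 2 * ‖d‖ ^ 2 + 2 * ‖p‖ ^ 2 + 2 * (‖a‖ * ‖p - p'‖) := by
  linarith [sq_norm_add_sub_inner_eq a d p p', sq_norm_add_le d p, real_inner_le_norm a (p - p')]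

theorem exists_hasFrechetGrad [CompleteSpace E] {J f : E → ℝ} {p : E} {B C : ℝ}
    (hadd : ∀ r r', f (r + r') = f r + f r') (hsmul : ∀ (a : ℝ) r, f (a • r) = a * f r)
    (hJ : ∀ r, ‖r‖ ≤ 1 → |J (p + r)| ≤ B)
    (hrem : ∀ r, ‖r‖ ≤ 1 → |J (p + r) - J p - f r| ≤ C * ‖r‖ ^ 2) :
    ∃ X : E, HasFrechetGrad J X p ∧ ∀ r, inner ℝ X r = f r := by
  have hbound : ∀ r : E, ‖r‖ ≤ 1 → |f r| ≤ B + B + |C| := by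
    intro r hr
    have hJp : |J p| ≤ B := by simpa using hJ 0 (by simp)
    have hCr : C * ‖r‖ ^ 2 ≤ |C| := by
      calc C * ‖r‖ ^ 2 ≤ |C| * 1 := by
            gcongr
            · exact le_abs_self C
            · exact pow_le_one₀ (norm_nonneg r) hr
        _ = |C| := mul_one _
    calc |f r| = |J (p + r) - J p - (J (p + r) - J p - f r)| := by rw [sub_sub_cancel]
      _ ≤ |J (p + r)| + |J p| + |J (p + r) - J p - f r| :=
          (abs_sub _ _).trans (add_le_add_left (abs_sub _ _) _)
      _ ≤ _ := add_le_add (add_le_add (hJ r hr) hJp) ((hrem r hr).trans hCr)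
  let g : E →ₗ[ℝ] ℝ := { toFun := f, map_add' := hadd, map_smul' := hsmul }
  let g' : E →L[ℝ] ℝ := g.mkContinuous _ (LinearMap.bound_of_ball_bound' one_pos _ g
    fun r hr => hbound r (by simpa using hr))
  have hX : ∀ r, inner ℝ ((InnerProductSpace.toDual ℝ E).symm g') r = f r :=
    fun r => InnerProductSpace.toDual_symm_apply
  refine ⟨(InnerProductSpace.toDual ℝ E).symm g', hasFDerivAt_iff_isLittleO_nhds_zero.2 ?_, hX⟩
  refine Asymptotics.IsBigO.trans_isLittleO (.of_bound C ?_)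
    (Asymptotics.isLittleO_norm_pow_id one_lt_two)
  filter_upwards [Metric.closedBall_mem_nhds (0 : E) one_pos] with r hr
  rw [Real.norm_eq_abs, Real.norm_of_nonneg (sq_nonneg _), innerSL_apply_apply, hX]
  exact hrem r (by simpa using hr)

theorem strictConvexOn_of_remainder {J : E → ℝ} {g : E → E} {C R : ℝ} (hC : 0 < C)
    (h : ∀ p r : E, ‖p‖ ≤ R → ‖p + r‖ ≤ R → C * ‖r‖ ^ 2 ≤ J (p + r) - J p - inner ℝ (g p) r) :
    StrictConvexOn ℝ (Metric.closedBall (0 : E) R) J := by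
  refine ⟨convex_closedBall 0 R, fun x hx y hy hxy a b ha hb hab => ?_⟩
  have hz := convex_closedBall (0 : E) R hx hy ha.le hb.le hab
  set z := a • x + b • y with hz_eq
  rw [mem_closedBall_zero_iff] at hx hy hz
  have hxz := h z (x - z) hz (by rwa [add_sub_cancel])
  have hyz := h z (y - z) hz (by rwa [add_sub_cancel])
  rw [add_sub_cancel] at hxz hyz
  have hcombination : a • (x - z) + b • (y - z) = 0 := by
    calc a • (x - z) + b • (y - z) = a • x + b • y - (a + b) • z := by module
      _ = 0 := by rw [hab, one_smul, hz_eq, sub_self]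
  have hinner : a * inner ℝ (g z) (x - z) + b * inner ℝ (g z) (y - z) = 0 := by
    rw [← real_inner_smul_right, ← real_inner_smul_right, ← inner_add_right, hcombination,
      inner_zero_right]
  have hx_ne : x - z ≠ 0 := by
    have hx_sub : x - z = b • (x - y) := by
      rw [hz_eq, eq_sub_iff_add_eq.2 hab]
      module
    rw [hx_sub]
    exact smul_ne_zero hb.ne' (sub_ne_zero.2 hxy)
  have hx_pos : 0 < a * (C * ‖x - z‖ ^ 2) := by
    have := norm_pos_iff.2 hx_ne
    positivity
  have hy_nonneg : 0 ≤ b * (C * ‖y - z‖ ^ 2) := by positivity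
  calc J z = a * J z + b * J z + (a * inner ℝ (g z) (x - z) + b * inner ℝ (g z) (y - z)) := by
        rw [hinner, ← add_mul, hab, one_mul, add_zero]
    _ < a * (J z + inner ℝ (g z) (x - z) + C * ‖x - z‖ ^ 2)
        + b * (J z + inner ℝ (g z) (y - z) + C * ‖y - z‖ ^ 2) := by linarith
    _ ≤ a • J x + b • J y := by
        simp only [smul_eq_mul]
        gcongr <;> linarith

end InnerProduct

section Functional

theorem sum_sum_le_add {n : ℕ} {f g : Fin n → Fin n → ℝ} {c : ℝ}
    (h : ∀ i l, f i l ≤ g i l + c) : ∑ i, ∑ l, f i l ≤ ∑ i, ∑ l, g i l + n ^ 2 * c := by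
  have hsub := sum_sum_le (f := fun i l => f i l - g i l) fun i l => sub_left_le_of_le_add (h i l)
  simp only [Finset.sum_sub_distrib] at hsub
  linarith

variable {G : Box} {k₁ k₂ b Y lam : ℝ} {θ : ℝ → ℝ} {V : HΩ G 2}

/-- The derivative of `|L^h(q)|² e^{-2λz}` in the direction `r`. -/
def derivDensity (θ : ℝ → ℝ) (V : HΩ G 2) (lam : ℝ) (q r : HK G k₁ k₂ 2) (i l : Fin G.n)
    (x : ℝ × ℝ) : ℝ :=
  2 * inner ℝ (Lop G k₁ k₂ θ V q i l x) (lap r i l x + pert θ V q q r i l x)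
    * Real.exp (-2 * lam * x.1)

/-- The second order remainder of `|L^h(q)|² e^{-2λz}` in the direction `r`. -/
def remDensity (θ : ℝ → ℝ) (V : HΩ G 2) (lam : ℝ) (q r : HK G k₁ k₂ 2) (i l : Fin G.n)
    (x : ℝ × ℝ) : ℝ :=
  ‖Lop G k₁ k₂ θ V (q + r) i l x‖ ^ 2 * Real.exp (-2 * lam * x.1)
    - ‖Lop G k₁ k₂ θ V q i l x‖ ^ 2 * Real.exp (-2 * lam * x.1) - derivDensity θ V lam q r i l x

/-- The sum of the Carleman-weighted square norms of `L^h(q)` over the interior nodes. -/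
def lopEnergy (θ : ℝ → ℝ) (V : HΩ G 2) (lam : ℝ) (q : HK G k₁ k₂ 2) : ℝ :=
  ∑ i, ∑ l, G.weightedNormSq (volume.restrict (Ioo k₁ k₂)) lam (Lop G k₁ k₂ θ V q i l)

/-- The derivative of `lopEnergy` at `q` in the direction `r`. -/
def lopDeriv (θ : ℝ → ℝ) (V : HΩ G 2) (lam : ℝ) (q r : HK G k₁ k₂ 2) : ℝ :=
  ∑ i, ∑ l, ∫ x, derivDensity θ V lam q r i l x ∂G.domK k₁ k₂

/-- The second order remainder of `lopEnergy` at `q` in the direction `r`. -/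
def lopRem (θ : ℝ → ℝ) (V : HΩ G 2) (lam : ℝ) (q r : HK G k₁ k₂ 2) : ℝ :=
  lopEnergy θ V lam (q + r) - lopEnergy θ V lam q - lopDeriv θ V lam q r

/-- The bound for the lower order part of `lopRem`, relative to the energy. -/
def Box.remBound (G : Box) (k₁ k₂ b Y : ℝ) : ℝ := G.pertBound k₁ k₂ b Y + G.quadBound k₁ k₂ b Y

theorem cost_eq (θ : ℝ → ℝ) (V : HΩ G 2) (F : HK G k₁ k₂ 3) (lam : ℝ) (p : HK₀ G k₁ k₂) :
    cost G k₁ k₂ θ V F lam p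
      = Real.exp (2 * lam * G.d) * G.h ^ 2 * lopEnergy θ V lam (p.1 + trunc F) := by
  simp only [cost, lopEnergy, Box.weightedNormSq, costDensity, ← Finset.mul_sum]
  ring

theorem abs_derivDensity_le (lam : ℝ) (q r : HK G k₁ k₂ 2) (i l : Fin G.n) (x : ℝ × ℝ) :
    |derivDensity θ V lam q r i l x|
      ≤ ‖Lop G k₁ k₂ θ V q i l x‖ ^ 2 * Real.exp (-2 * lam * x.1)
        + 2 * (‖lap r i l x‖ ^ 2 * Real.exp (-2 * lam * x.1))
        + 2 * (‖pert θ V q q r i l x‖ ^ 2 * Real.exp (-2 * lam * x.1)) := by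
  rw [derivDensity, abs_mul, Real.abs_exp]
  calc _ ≤ _ := mul_le_mul_of_nonneg_right (abs_two_mul_inner_add_le _ _ _) (Real.exp_pos _).le
    _ = _ := by ring

theorem ae_half_sq_norm_lap_le (θ : ℝ → ℝ) (V : HΩ G 2) (lam : ℝ) (q r : HK G k₁ k₂ 2) :
    ∀ᵐ x ∂G.domK k₁ k₂, ∀ i l, 1 / 2 * (‖lap r i l x‖ ^ 2 * Real.exp (-2 * lam * x.1))
      ≤ remDensity θ V lam q r i l x
        + ‖pert θ V (q + r) q r i l x‖ ^ 2 * Real.exp (-2 * lam * x.1)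
        + crossTerm θ V lam q r i l x := by
  filter_upwards [ae_Lop_add θ V q r] with x hx i l
  rw [remDensity, derivDensity, crossTerm, hx, ← mul_assoc, ← sub_mul, ← sub_mul, ← add_mul,
    ← add_mul]
  exact mul_le_mul_of_nonneg_right (half_sq_norm_le_remainder _ _ _ _) (Real.exp_pos _).le

theorem ae_remDensity_le (θ : ℝ → ℝ) (V : HΩ G 2) (lam : ℝ) (q r : HK G k₁ k₂ 2) :
    ∀ᵐ x ∂G.domK k₁ k₂, ∀ i l, remDensity θ V lam q r i l x
      ≤ 2 * (‖lap r i l x‖ ^ 2 * Real.exp (-2 * lam * x.1))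
        + 2 * (‖pert θ V (q + r) q r i l x‖ ^ 2 * Real.exp (-2 * lam * x.1))
        + crossTerm θ V lam q r i l x := by
  filter_upwards [ae_Lop_add θ V q r] with x hx i l
  rw [remDensity, derivDensity, crossTerm, hx, ← mul_assoc, ← mul_assoc, ← sub_mul, ← sub_mul,
    ← add_mul, ← add_mul]
  exact mul_le_mul_of_nonneg_right (remainder_le _ _ _ _) (Real.exp_pos _).le

theorem lopDeriv_smul (θ : ℝ → ℝ) (V : HΩ G 2) (lam : ℝ) (q : HK G k₁ k₂ 2) (a : ℝ)
    (r : HK G k₁ k₂ 2) : lopDeriv θ V lam q (a • r) = a * lopDeriv θ V lam q r := by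
  simp only [lopDeriv, Finset.mul_sum, ← integral_const_mul]
  refine Finset.sum_congr rfl fun i _ => Finset.sum_congr rfl fun l _ => integral_congr_ae ?_
  filter_upwards [ae_pert_smul θ V q q r a, ae_zD_smul a r] with x hpert hzD
  rw [derivDensity, hpert, lap_eq_smul hzD, ← mul_add, ← Complex.real_smul, real_inner_smul_right,
    derivDensity]
  ring

namespace Coeff

theorem remBound_nonneg (H : Coeff G k₁ k₂ θ V b Y) : 0 ≤ G.remBound k₁ k₂ b Y :=
  add_nonneg H.pertBound_nonneg H.quadBound_nonneg

theorem integrable_weighted_sq_norm_Lop (H : Coeff G k₁ k₂ θ V b Y) (lam : ℝ) (q : HK G k₁ k₂ 2)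
    (i l : Fin G.n) :
    Integrable (fun x => ‖Lop G k₁ k₂ θ V q i l x‖ ^ 2 * Real.exp (-2 * lam * x.1))
      (G.domK k₁ k₂) :=
  Box.integrable_mul_exp lam (H.integrable_sq_norm_Lop q i l)

theorem integrable_derivDensity (H : Coeff G k₁ k₂ θ V b Y) (hlam : 0 < lam)
    (q : HK G k₁ k₂ 2) (r : HK₀ G k₁ k₂) (i l : Fin G.n) :
    Integrable (derivDensity θ V lam q r.1 i l) (G.domK k₁ k₂) := by
  have hLop := measurable_Lop H.measurable V q i l
  have hlap := measurable_lap r.1 i l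
  have hpert := measurable_pert H.measurable V q q r.1 i l
  have hmeas : Measurable (derivDensity θ V lam q r.1 i l) := by
    unfold derivDensity
    fun_prop
  exact (((H.integrable_weighted_sq_norm_Lop lam q i l).add
    ((integrable_lap_mul_exp lam r.1 i l).const_mul 2)).add
    ((H.integrable_weighted_sq_norm_pert hlam q q r i l).const_mul 2)).mono'
    hmeas.aestronglyMeasurable (.of_forall fun x => abs_derivDensity_le lam q r.1 i l x)

theorem integrable_remDensity (H : Coeff G k₁ k₂ θ V b Y) (hlam : 0 < lam)
    (q : HK G k₁ k₂ 2) (r : HK₀ G k₁ k₂) (i l : Fin G.n) :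
    Integrable (remDensity θ V lam q r.1 i l) (G.domK k₁ k₂) :=
  ((H.integrable_weighted_sq_norm_Lop lam (q + r.1) i l).sub
    (H.integrable_weighted_sq_norm_Lop lam q i l)).sub (H.integrable_derivDensity hlam q r i l)

theorem lopDeriv_add (H : Coeff G k₁ k₂ θ V b Y) (hlam : 0 < lam)
    (q : HK G k₁ k₂ 2) (r r' : HK₀ G k₁ k₂) :
    lopDeriv θ V lam q (r.1 + r'.1) = lopDeriv θ V lam q r.1 + lopDeriv θ V lam q r'.1 := by
  simp only [lopDeriv, ← Finset.sum_add_distrib]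
  refine Finset.sum_congr rfl fun i _ => Finset.sum_congr rfl fun l _ => ?_
  rw [← integral_add (H.integrable_derivDensity hlam q r i l)
    (H.integrable_derivDensity hlam q r' i l)]
  refine integral_congr_ae ?_
  filter_upwards [ae_pert_add θ V q q r.1 r'.1, ae_zD_add r.1 r'.1] with x hpert hzD
  simp only [derivDensity, hpert, lap_eq_add hzD, inner_add_right]
  ring

theorem lopRem_eq (H : Coeff G k₁ k₂ θ V b Y) (hlam : 0 < lam) (q : HK G k₁ k₂ 2)
    (r : HK₀ G k₁ k₂) :
    lopRem θ V lam q r.1 = ∑ i, ∑ l, ∫ x, remDensity θ V lam q r.1 i l x ∂G.domK k₁ k₂ := by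
  simp only [lopRem, lopEnergy, lopDeriv, ← Finset.sum_sub_distrib]
  refine Finset.sum_congr rfl fun i _ => Finset.sum_congr rfl fun l _ => ?_
  have hqr := H.integrable_weighted_sq_norm_Lop lam (q + r.1) i l
  have hq := H.integrable_weighted_sq_norm_Lop lam q i l
  rw [Box.weightedNormSq, Box.weightedNormSq, ← integral_sub hqr hq]
  exact (integral_sub (hqr.sub hq) (H.integrable_derivDensity hlam q r i l)).symm

theorem half_weightedNormSq_lap_le (H : Coeff G k₁ k₂ θ V b Y) (hlam : 0 < lam)
    {q : HK G k₁ k₂ 2} (hq : ‖q‖ ≤ Y) (r : HK₀ G k₁ k₂) (hqr : ‖q + r.1‖ ≤ Y) (i l : Fin G.n) :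
    1 / 2 * G.weightedNormSq (volume.restrict (Ioo k₁ k₂)) lam (lap r.1 i l)
      ≤ ∫ x, remDensity θ V lam q r.1 i l x ∂G.domK k₁ k₂
        + G.remBound k₁ k₂ b Y * (G.small lam * energy lam r) := by
  have hlap := integrable_lap_mul_exp lam r.1 i l
  have hrem := H.integrable_remDensity hlam q r i l
  have hpert := H.integrable_weighted_sq_norm_pert hlam (q + r.1) q r i l
  have hcross := H.integrable_crossTerm hlam q r i l
  calc 1 / 2 * G.weightedNormSq (volume.restrict (Ioo k₁ k₂)) lam (lap r.1 i l)
      ≤ ∫ x, remDensity θ V lam q r.1 i l x ∂G.domK k₁ k₂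
        + ∫ x, ‖pert θ V (q + r.1) q r.1 i l x‖ ^ 2 * Real.exp (-2 * lam * x.1) ∂G.domK k₁ k₂
        + ∫ x, crossTerm θ V lam q r.1 i l x ∂G.domK k₁ k₂ := by
        rw [Box.weightedNormSq, ← integral_const_mul, ← integral_add_add hrem hpert hcross]
        refine integral_mono_ae (hlap.const_mul _) ((hrem.add hpert).add hcross) ?_
        exact (ae_half_sq_norm_lap_le θ V lam q r.1).mono fun x hx => hx i l
    _ ≤ _ := by
        rw [Box.remBound, add_mul, add_assoc]
        gcongr
        · exact H.integral_weighted_sq_norm_pert_le hlam hqr hq r i l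
        · exact H.integral_crossTerm_le hlam hq r i l

theorem integral_remDensity_le (H : Coeff G k₁ k₂ θ V b Y) (hlam : 0 < lam)
    {q : HK G k₁ k₂ 2} (hq : ‖q‖ ≤ Y) (r : HK₀ G k₁ k₂) (hqr : ‖q + r.1‖ ≤ Y) (i l : Fin G.n) :
    ∫ x, remDensity θ V lam q r.1 i l x ∂G.domK k₁ k₂
      ≤ 2 * G.weightedNormSq (volume.restrict (Ioo k₁ k₂)) lam (lap r.1 i l)
        + 2 * G.remBound k₁ k₂ b Y * (G.small lam * energy lam r) := by
  have hlap := (integrable_lap_mul_exp lam r.1 i l).const_mul 2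
  have hrem := H.integrable_remDensity hlam q r i l
  have hpert := (H.integrable_weighted_sq_norm_pert hlam (q + r.1) q r i l).const_mul 2
  have hcross := H.integrable_crossTerm hlam q r i l
  have henergy := mul_nonneg (G.small_nonneg hlam) (energy_nonneg lam r)
  have hquad := H.quadBound_nonneg
  calc _ ≤ 2 * G.weightedNormSq _ lam (lap r.1 i l)
        + 2 * ∫ x, ‖pert θ V (q + r.1) q r.1 i l x‖ ^ 2 * Real.exp (-2 * lam * x.1) ∂G.domK k₁ k₂
        + ∫ x, crossTerm θ V lam q r.1 i l x ∂G.domK k₁ k₂ := by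
        rw [Box.weightedNormSq, ← integral_const_mul, ← integral_const_mul,
          ← integral_add_add hlap hpert hcross]
        refine integral_mono_ae hrem ((hlap.add hpert).add hcross) ?_
        exact (ae_remDensity_le θ V lam q r.1).mono fun x hx => hx i l
    _ ≤ 2 * G.weightedNormSq _ lam (lap r.1 i l)
        + 2 * (G.pertBound k₁ k₂ b Y * (G.small lam * energy lam r))
        + 2 * (G.quadBound k₁ k₂ b Y * (G.small lam * energy lam r)) := by
        gcongr
        · exact H.integral_weighted_sq_norm_pert_le hlam hqr hq r i l
        · exact (H.integral_crossTerm_le hlam hq r i l).trans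
            (le_mul_of_one_le_left (by positivity) one_le_two)
    _ = _ := by
        rw [Box.remBound]
        ring

theorem half_lapEnergy_le (H : Coeff G k₁ k₂ θ V b Y) (hlam : 0 < lam)
    {q : HK G k₁ k₂ 2} (hq : ‖q‖ ≤ Y) (r : HK₀ G k₁ k₂) (hqr : ‖q + r.1‖ ≤ Y) :
    1 / 2 * lapEnergy lam r.1 ≤ lopRem θ V lam q r.1
      + G.n ^ 2 * (G.remBound k₁ k₂ b Y * (G.small lam * energy lam r)) := by
  rw [H.lopRem_eq hlam]
  simp only [lapEnergy, Finset.mul_sum]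
  exact sum_sum_le_add (H.half_weightedNormSq_lap_le hlam hq r hqr)

theorem lopRem_le (H : Coeff G k₁ k₂ θ V b Y) (hlam : 0 < lam)
    {q : HK G k₁ k₂ 2} (hq : ‖q‖ ≤ Y) (r : HK₀ G k₁ k₂) (hqr : ‖q + r.1‖ ≤ Y) :
    lopRem θ V lam q r.1 ≤ 2 * lapEnergy lam r.1
      + G.n ^ 2 * (2 * G.remBound k₁ k₂ b Y * (G.small lam * energy lam r)) := by
  rw [H.lopRem_eq hlam]
  simp only [lapEnergy, Finset.mul_sum]
  exact sum_sum_le_add (H.integral_remDensity_le hlam hq r hqr)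

end Coeff

end Functional

section Differentiability

variable {G : Box} {k₁ k₂ b Y lam : ℝ} {θ : ℝ → ℝ} {V : HΩ G 2}

theorem lopEnergy_nonneg (θ : ℝ → ℝ) (V : HΩ G 2) (lam : ℝ) (q : HK G k₁ k₂ 2) :
    0 ≤ lopEnergy θ V lam q :=
  Finset.sum_nonneg fun _ _ => Finset.sum_nonneg fun _ _ => Box.weightedNormSq_nonneg _

theorem add_add_trunc (p r : HK₀ G k₁ k₂) (F : HK G k₁ k₂ 3) :
    (p + r).1 + trunc F = p.1 + trunc F + r.1 :=
  add_right_comm _ _ _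

theorem cost_add_sub_cost_sub (θ : ℝ → ℝ) (V : HΩ G 2) (F : HK G k₁ k₂ 3) (lam : ℝ)
    (p r : HK₀ G k₁ k₂) :
    cost G k₁ k₂ θ V F lam (p + r) - cost G k₁ k₂ θ V F lam p
        - Real.exp (2 * lam * G.d) * G.h ^ 2 * lopDeriv θ V lam (p.1 + trunc F) r.1
      = Real.exp (2 * lam * G.d) * G.h ^ 2 * lopRem θ V lam (p.1 + trunc F) r.1 := by
  rw [cost_eq, cost_eq, add_add_trunc, lopRem]
  ring

namespace Coeff

theorem lopEnergy_le (H : Coeff G k₁ k₂ θ V b Y) (hlam : 0 ≤ lam) {q : HK G k₁ k₂ 2}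
    (hq : ‖q‖ ≤ Y) : lopEnergy θ V lam q ≤ G.n ^ 2 * (G.wMax lam * G.opBound k₁ k₂ b Y) :=
  sum_sum_le fun i l => (Box.weightedNormSq_le hlam (H.integrable_sq_norm_Lop q i l)).trans
    (mul_le_mul_of_nonneg_left (H.integral_sq_norm_Lop_le hq i l) (G.wMax_pos lam).le)

theorem exists_abs_lopRem_le (H : Coeff G k₁ k₂ θ V b Y) (hlam : 0 < lam) :
    ∃ C, ∀ (q : HK G k₁ k₂ 2) (r : HK₀ G k₁ k₂), ‖q‖ ≤ Y → ‖q + r.1‖ ≤ Y →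
      |lopRem θ V lam q r.1| ≤ C * ‖r‖ ^ 2 := by
  have hB := H.remBound_nonneg
  have hsmall := G.small_nonneg hlam
  refine ⟨2 * (G.n ^ 2 * (G.wMax lam * ((1 + 8 / G.h ^ 2) ^ 2 * (1 / G.h ^ 2))))
    + G.n ^ 2 * (2 * G.remBound k₁ k₂ b Y * (G.small lam *
      (G.n ^ 2 * (G.wMax lam * (1 / G.h ^ 2))))), fun q r hq hqr => ?_⟩
  have hlapEnergy := lapEnergy_nonneg lam r.1
  have henergy : 0 ≤ G.n ^ 2 * (G.remBound k₁ k₂ b Y * (G.small lam * energy lam r)) := by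
    have := energy_nonneg lam r
    positivity
  calc |lopRem θ V lam q r.1|
      ≤ 2 * lapEnergy lam r.1
        + G.n ^ 2 * (2 * G.remBound k₁ k₂ b Y * (G.small lam * energy lam r)) :=
        abs_le.2 ⟨by linarith [H.half_lapEnergy_le hlam hq r hqr], H.lopRem_le hlam hq r hqr⟩
    _ ≤ 2 * (G.n ^ 2 * (G.wMax lam * ((1 + 8 / G.h ^ 2) ^ 2 * (‖r‖ ^ 2 / G.h ^ 2))))
        + G.n ^ 2 * (2 * G.remBound k₁ k₂ b Y * (G.small lam *
          (G.n ^ 2 * (G.wMax lam * (‖r‖ ^ 2 / G.h ^ 2))))) := by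
        gcongr
        · exact lapEnergy_le_norm_sq hlam.le r.1
        · exact energy_le_norm_sq hlam.le r
    _ = _ := by ring

theorem exists_frechetGrad (H : Coeff G k₁ k₂ θ V b Y) (F : HK G k₁ k₂ 3) (hlam : 0 < lam)
    (p : HK₀ G k₁ k₂) :
    ∃ X : HK₀ G k₁ k₂, HasFrechetGrad (cost G k₁ k₂ θ V F lam) X p ∧ ∀ r, inner ℝ X r
      = Real.exp (2 * lam * G.d) * G.h ^ 2 * lopDeriv θ V lam (p.1 + trunc F) r.1 := by
  set q := p.1 + trunc F with hq_eq
  have HZ := H.mono (le_max_left Y (‖q‖ + 1))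
  have hq : ‖q‖ ≤ max Y (‖q‖ + 1) := le_max_of_le_right (by linarith)
  have hqr (r : HK₀ G k₁ k₂) (hr : ‖r‖ ≤ 1) : ‖q + r.1‖ ≤ max Y (‖q‖ + 1) :=
    le_max_of_le_right ((norm_add_le _ _).trans (by gcongr; exact hr))
  obtain ⟨C, hC⟩ := HZ.exists_abs_lopRem_le hlam
  have hscale : 0 ≤ Real.exp (2 * lam * G.d) * G.h ^ 2 := by positivity
  refine exists_hasFrechetGrad (fun r r' => ?_) (fun a r => ?_) (fun r hr => ?_) (fun r hr => ?_)
    (B := Real.exp (2 * lam * G.d) * G.h ^ 2 *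
      (G.n ^ 2 * (G.wMax lam * G.opBound k₁ k₂ b (max Y (‖q‖ + 1)))))
    (C := Real.exp (2 * lam * G.d) * G.h ^ 2 * C)
  · rw [Submodule.coe_add, H.lopDeriv_add hlam, mul_add]
  · rw [Submodule.coe_smul, lopDeriv_smul]
    ring
  · rw [cost_eq, add_add_trunc, abs_of_nonneg (mul_nonneg hscale (lopEnergy_nonneg _ _ _ _))]
    exact mul_le_mul_of_nonneg_left (HZ.lopEnergy_le hlam.le (hqr r hr)) hscale
  · rw [cost_add_sub_cost_sub, ← hq_eq, abs_mul, abs_of_nonneg hscale, mul_assoc _ C]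
    exact mul_le_mul_of_nonneg_left (hC q r hq (hqr r hr)) hscale

end Coeff

end Differentiability

section Convexity

variable {G : Box} {k₁ k₂ b Y lam : ℝ} {θ : ℝ → ℝ} {V : HΩ G 2}

/-- The threshold `λ₁` beyond which the lower order terms are absorbed. -/
def Box.convexParam (G : Box) (k₁ k₂ b Y : ℝ) : ℝ :=
  G.carlemanParam + 32 * (G.n ^ 2 * G.remBound k₁ k₂ b Y) * (1 + 1 / G.h) ^ 2

/-- The constant `C₁` of strong convexity. -/
def Box.convexConst (G : Box) : ℝ := G.h ^ 2 / (16 * G.normConst)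

theorem Box.convexConst_pos (G : Box) : 0 < G.convexConst := by
  have hh := G.h_pos
  have hN := G.normConst_pos
  unfold Box.convexConst
  positivity

theorem norm_trunc_le (F : HK G k₁ k₂ 3) : ‖trunc F‖ ≤ ‖F‖ := by
  refine (sq_le_sq₀ (norm_nonneg _) (norm_nonneg _)).1 ?_
  simp only [norm_sq_eq_sum, Fintype.sum_prod_type]
  gcongr with j _ s _
  rw [Fin.sum_univ_castSucc (n := 3)]
  exact le_add_of_nonneg_right (integral_nonneg fun _ => sq_nonneg _)

namespace Coeff

theorem carlemanParam_le (H : Coeff G k₁ k₂ θ V b Y) :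
    G.carlemanParam ≤ G.convexParam k₁ k₂ b Y := by
  have hB := H.remBound_nonneg
  exact le_add_of_nonneg_right (by positivity)

theorem remBound_mul_small_le (H : Coeff G k₁ k₂ θ V b Y)
    (hlam : G.convexParam k₁ k₂ b Y ≤ lam) :
    G.n ^ 2 * G.remBound k₁ k₂ b Y * G.small lam ≤ 1 / 16 := by
  have hh := G.h_pos
  have hB := H.remBound_nonneg
  have two_le : 2 ≤ lam := G.two_le_carlemanParam.trans (H.carlemanParam_le.trans hlam)
  have hlam_pos : 0 < lam := by linarith
  have hinv : 1 / lam ≤ 1 := (div_le_one hlam_pos).2 (by linarith)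
  have habsorb : 32 * (G.n ^ 2 * G.remBound k₁ k₂ b Y) * (1 + 1 / G.h) ^ 2 ≤ lam := by
    unfold Box.convexParam at hlam
    linarith [G.two_le_carlemanParam]
  calc _ ≤ G.n ^ 2 * G.remBound k₁ k₂ b Y * ((1 + 1 / G.h) ^ 2 * (1 + 1) ^ 2 / (2 * lam)) := by
        unfold Box.small
        gcongr
    _ = 32 * (G.n ^ 2 * G.remBound k₁ k₂ b Y) * (1 + 1 / G.h) ^ 2 / lam * (1 / 16) := by
        field_simp
        ring
    _ ≤ 1 * (1 / 16) := by
        gcongr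
        exact (div_le_one hlam_pos).2 habsorb
    _ = 1 / 16 := one_mul _

theorem energy_le_lopRem (H : Coeff G k₁ k₂ θ V b Y) (hlam : G.convexParam k₁ k₂ b Y ≤ lam)
    {q : HK G k₁ k₂ 2} (hq : ‖q‖ ≤ Y) (r : HK₀ G k₁ k₂) (hqr : ‖q + r.1‖ ≤ Y) :
    1 / 16 * energy lam r ≤ lopRem θ V lam q r.1 := by
  have hcarleman := H.carlemanParam_le.trans hlam
  have hlam_pos : 0 < lam := by linarith [G.two_le_carlemanParam]
  have habsorb : G.n ^ 2 * (G.remBound k₁ k₂ b Y * (G.small lam * energy lam r))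
      ≤ 1 / 16 * energy lam r := by
    rw [← mul_assoc, ← mul_assoc]
    exact mul_le_mul_of_nonneg_right (H.remBound_mul_small_le hlam) (energy_nonneg lam r)
  linarith [H.half_lapEnergy_le hlam_pos hq r hqr, energy_le_lapEnergy hcarleman r]

theorem convexConst_mul_sq_norm_le (H : Coeff G k₁ k₂ θ V b Y)
    (hlam : G.convexParam k₁ k₂ b Y ≤ lam) {q : HK G k₁ k₂ 2} (hq : ‖q‖ ≤ Y) (r : HK₀ G k₁ k₂)
    (hqr : ‖q + r.1‖ ≤ Y) :
    G.convexConst * ‖r‖ ^ 2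
      ≤ Real.exp (2 * lam * G.d) * G.h ^ 2 * lopRem θ V lam q r.1 := by
  have one_le : 1 ≤ lam := by linarith [G.two_le_carlemanParam, H.carlemanParam_le]
  have hN := G.normConst_pos
  calc _ ≤ G.convexConst * (G.normConst * (Real.exp (2 * lam * G.d) * energy lam r)) :=
        mul_le_mul_of_nonneg_left (norm_sq_le_energy one_le r) G.convexConst_pos.le
    _ = Real.exp (2 * lam * G.d) * G.h ^ 2 * (1 / 16 * energy lam r) := by
        unfold Box.convexConst
        field_simp
    _ ≤ _ := by
        gcongr
        exact H.energy_le_lopRem hlam hq r hqr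

theorem exists_gradient_convex (H : Coeff G k₁ k₂ θ V b Y) {F : HK G k₁ k₂ 3} {R : ℝ}
    (hF : R + ‖F‖ ≤ Y) (hlam : 0 < lam) :
    ∃ J' : HK₀ G k₁ k₂ → HK₀ G k₁ k₂,
      (∀ p, HasFrechetGrad (cost G k₁ k₂ θ V F lam) (J' p) p) ∧
      (G.convexParam k₁ k₂ b Y ≤ lam →
        (∀ p r : HK₀ G k₁ k₂, ‖p‖ ≤ R → ‖p + r‖ ≤ R →
          G.convexConst * ‖r‖ ^ 2 ≤ cost G k₁ k₂ θ V F lam (p + r)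
            - cost G k₁ k₂ θ V F lam p - inner ℝ (J' p) r) ∧
        StrictConvexOn ℝ (Metric.closedBall (0 : HK₀ G k₁ k₂) R) (cost G k₁ k₂ θ V F lam)) := by
  choose J' hJ' hinner using fun p => H.exists_frechetGrad F hlam p
  have hnorm (p : HK₀ G k₁ k₂) (hp : ‖p‖ ≤ R) : ‖p.1 + trunc F‖ ≤ Y := by
    have hp' : ‖p.1‖ ≤ R := hp
    linarith [norm_add_le p.1 (trunc F), norm_trunc_le F]
  refine ⟨J', hJ', fun hlam₁ => ?_⟩
  have hconvex : ∀ p r : HK₀ G k₁ k₂, ‖p‖ ≤ R → ‖p + r‖ ≤ R →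
      G.convexConst * ‖r‖ ^ 2 ≤ cost G k₁ k₂ θ V F lam (p + r)
        - cost G k₁ k₂ θ V F lam p - inner ℝ (J' p) r := by
    intro p r hp hpr
    rw [hinner, cost_add_sub_cost_sub]
    have hqr := hnorm (p + r) hpr
    rw [add_add_trunc] at hqr
    exact H.convexConst_mul_sq_norm_le hlam₁ (hnorm p hp) r hqr
  exact ⟨hconvex, strictConvexOn_of_remainder (E := HK₀ G k₁ k₂)
    (J := cost G k₁ k₂ θ V F lam) (g := J') G.convexConst_pos hconvex⟩

end Coeff

end Convexity

section Main

variable {G : Box} {k₁ k₂ : ℝ}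

theorem Coeff.of_norm_le (hk : k₁ < k₂) {M Y : ℝ} {θ : ℝ → ℝ} (hθ : Measurable θ)
    (hM : ∀ k ∈ Ioo k₁ k₂, |θ k| ≤ M) {V : HΩ G 2} (hV : ‖V‖ ≤ Y) :
    Coeff G k₁ k₂ θ V (1 + max |k₁| |k₂| + |M|) Y where
  lt := hk
  measurable := hθ
  one_le := by
    linarith [(abs_nonneg k₁).trans (le_max_left |k₁| |k₂|), abs_nonneg M]
  abs_param_le k hk := by
    linarith [abs_le_max_abs_abs hk.1.le hk.2.le, abs_nonneg M]
  abs_coeff_le k hk := by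
    linarith [hM k hk, le_abs_self M, (abs_nonneg k₁).trans (le_max_left |k₁| |k₂|)]
  norm_le := hV

theorem carlemanParam_le_convexParam (hk : k₁ < k₂) (M : ℝ) {Y : ℝ} (hY : 0 ≤ Y) :
    G.carlemanParam ≤ G.convexParam k₁ k₂ (1 + max |k₁| |k₂| + |M|) Y := by
  have H := Coeff.of_norm_le (θ := fun _ => M) (V := (0 : HΩ G 2)) (Y := Y) hk
    measurable_const (fun _ _ => le_refl |M|) (norm_zero.trans_le hY)
  rw [abs_abs] at H
  exact H.carlemanParam_le

theorem le_one_of_lt_exp {δ lam : ℝ} (hlam : 0 ≤ lam)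
    (hδ : δ < Real.exp (-2 * (G.d + G.ξ) * lam)) : δ ≤ 1 := by
  have hlen : 0 < G.d + G.ξ := G.len_pos
  refine hδ.le.trans (Real.exp_le_one_iff.2 ?_)
  nlinarith [mul_nonneg hlen.le hlam]

theorem measurable_and_abs_le_of_eq_one_or_id {θ : ℝ → ℝ}
    (hθ : θ = (fun _ => 1) ∨ θ = (fun k => k)) :
    Measurable θ ∧ ∀ k ∈ Ioo k₁ k₂, |θ k| ≤ max 1 (max |k₁| |k₂|) := by
  rcases hθ with rfl | rfl
  · exact ⟨measurable_const, fun _ _ => by simp⟩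
  · exact ⟨measurable_id, fun k hk =>
      le_max_of_le_right (abs_le_max_abs_abs hk.1.le hk.2.le)⟩

end Main

end SemiDiscrete

end

open SemiDiscrete in
theorem theorem7p3_general (G : Box) :
    ∃ lam₀ : ℝ, 1 < lam₀ ∧
      (∃ C : ℝ, 0 < C ∧ ∀ lam : ℝ, lam₀ ≤ lam → CarlemanEstimate G C lam) ∧
    ∀ k₁ k₂ : ℝ, k₁ < k₂ → ∀ M R normF normV : ℝ,
    ∃ lam₁ : ℝ, lam₀ ≤ lam₁ ∧ ∃ C₁ : ℝ, 0 < C₁ ∧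
    ∀ θ : ℝ → ℝ, Measurable θ → (∀ k ∈ Ioo k₁ k₂, |θ k| ≤ M) →
    ∀ δ : ℝ, 0 < δ → δ < Real.exp (-2 * (G.d + G.ξ) * lam₁) →
    ∀ Q Qs Vs : HΩ G 2, ‖Q - Qs‖ < δ → Vs - Qs ∈ Sob₀ G (.dirac ()) →
      (∀ i l, ∀ᵐ x ∂G.dom (.dirac ()), lap Vs i l x = 0) → ‖Vs‖ ≤ normV →
    ∀ F Fs : HK G k₁ k₂ 3, ‖F - Fs‖ < δ → ‖Fs‖ ≤ normF →
    (∃! W : HΩ₀ G, IsMinOn (tailCost G Q (tailParam G δ)) univ W) ∧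
    ∀ W : HΩ₀ G, IsMinOn (tailCost G Q (tailParam G δ)) univ W → ∀ lam : ℝ, 0 < lam →
      (∀ (p : HK₀ G k₁ k₂) (i l : Fin G.n),
        Integrable (costDensity G k₁ k₂ θ (W.1 + Q) F lam p i l)
          (G.dom (volume.restrict (Ioo k₁ k₂)))) ∧
      ∃ J' : HK₀ G k₁ k₂ → HK₀ G k₁ k₂,
        (∀ p, HasFrechetGrad (cost G k₁ k₂ θ (W.1 + Q) F lam) (J' p) p) ∧
        (lam₁ ≤ lam →
          (∀ p r : HK₀ G k₁ k₂, ‖p‖ ≤ R → ‖p + r‖ ≤ R →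
            C₁ * ‖r‖ ^ 2 ≤ cost G k₁ k₂ θ (W.1 + Q) F lam (p + r)
              - cost G k₁ k₂ θ (W.1 + Q) F lam p - inner ℝ (J' p) r) ∧
          StrictConvexOn ℝ (Metric.closedBall (0 : HK₀ G k₁ k₂) R)
            (cost G k₁ k₂ θ (W.1 + Q) F lam)) := by
  refine ⟨G.carlemanParam, by linarith [G.two_le_carlemanParam],
    ⟨G.carlemanConst, G.carlemanConst_pos, fun lam hlam => carlemanEstimate hlam⟩, ?_⟩
  intro k₁ k₂ hk M R normF normV
  set Y : ℝ := (|R| + |normF| + 1) + (√G.tailConst + 1 + |normV|)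
  have hparam := carlemanParam_le_convexParam (G := G) hk M (Y := Y) (by positivity)
  refine ⟨_, hparam, G.convexConst, G.convexConst_pos, ?_⟩
  intro θ hθ hM δ hδ hδ_lt Q Qs Vs hQ hVs hlap hVs_le F Fs hF hFs_le
  have hμ := hparam.trans (le_tailParam hδ hδ_lt)
  have hδ_le : δ ≤ 1 := le_one_of_lt_exp (by linarith [G.two_le_carlemanParam]) hδ_lt
  refine ⟨existsUnique_isMinOn_tailCost Q hμ, fun W hW lam hlam => ?_⟩
  have hV : ‖W.1 + Q‖ ≤ Y := by
    linarith [norm_tail_le hδ hδ_le hμ hQ hVs hlap hW, le_abs_self normV, abs_nonneg R,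
      abs_nonneg normF]
  have hF_le : R + ‖F‖ ≤ Y := by
    linarith [norm_le_norm_add_norm_sub' F Fs, le_abs_self R, le_abs_self normF,
      abs_nonneg normV, Real.sqrt_nonneg G.tailConst]
  have H := Coeff.of_norm_le hk hθ hM hV
  exact ⟨fun p => H.integrable_weighted_sq_norm_Lop lam _, H.exists_gradient_convex hF_le hlam⟩

theorem theorem7p3 (G : SemiDiscrete.Box) :
    ∃ lam₀ : ℝ, 1 < lam₀ ∧
      (∃ C : ℝ, 0 < C ∧ ∀ lam : ℝ, lam₀ ≤ lam → SemiDiscrete.CarlemanEstimate G C lam) ∧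
    ∀ (k₁ k₂ : ℝ), 0 < k₁ → k₁ < k₂ →
    ∀ θ : ℝ → ℝ, (θ = (fun _ => 1) ∨ θ = (fun k => k)) →
    ∀ R : ℝ, 0 < R → ∀ normF normV : ℝ,
    ∃ lam₁ : ℝ, lam₀ ≤ lam₁ ∧ ∃ C₁ : ℝ, 0 < C₁ ∧
    ∀ δ : ℝ, 0 < δ → δ < Real.exp (-2 * (G.d + G.ξ) * lam₁) →
    -- the data of the tail problem
    ∀ (ψ₀ ψ₁ ψ₀s ψ₁s : Fin G.n → Fin G.n → Unit → ℂ) (Q Qs Vs : SemiDiscrete.HΩ G 2),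
      SemiDiscrete.HasBC Q ψ₀ ψ₁ → SemiDiscrete.HasBC Qs ψ₀s ψ₁s → ‖Q - Qs‖ < δ →
      SemiDiscrete.HasBC Vs ψ₀s ψ₁s →
      (∀ i l, ∀ᵐ x ∂(G.dom (MeasureTheory.Measure.dirac ())), SemiDiscrete.lap Vs i l x = 0) →
      ‖Vs‖ = normV →
    -- the data of the integro-differential problem
    ∀ (φ₀ φ₁ φ₀s φ₁s : Fin G.n → Fin G.n → ℝ → ℂ) (F Fs : SemiDiscrete.HK G k₁ k₂ 3),
      SemiDiscrete.HasBC (SemiDiscrete.trunc F) φ₀ φ₁ →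
      SemiDiscrete.HasBC (SemiDiscrete.trunc Fs) φ₀s φ₁s → ‖F - Fs‖ < δ →
      ‖Fs‖ = normF →
    -- the tail function is `W + Q` with the unique minimizer `W`
    (∃! W : SemiDiscrete.HΩ₀ G,
      IsMinOn (SemiDiscrete.tailCost G Q (SemiDiscrete.tailParam G δ)) Set.univ W) ∧
    ∀ W : SemiDiscrete.HΩ₀ G,
      IsMinOn (SemiDiscrete.tailCost G Q (SemiDiscrete.tailParam G δ)) Set.univ W →
    ∀ lam : ℝ, 0 < lam →
      -- the functional is given by convergent integrals
      (∀ (p : SemiDiscrete.HK₀ G k₁ k₂) (i l : Fin G.n),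
        MeasureTheory.Integrable
          (SemiDiscrete.costDensity G k₁ k₂ θ (W.1 + Q) F lam p i l)
          (G.dom (MeasureTheory.volume.restrict (Set.Ioo k₁ k₂)))) ∧
      -- the Fréchet derivative, represented by an element of the space, and the convexity
      ∃ J' : SemiDiscrete.HK₀ G k₁ k₂ → SemiDiscrete.HK₀ G k₁ k₂,
        (∀ p, SemiDiscrete.HasFrechetGrad
          (SemiDiscrete.cost G k₁ k₂ θ (W.1 + Q) F lam) (J' p) p) ∧
        (lam₁ ≤ lam →
          (∀ p r : SemiDiscrete.HK₀ G k₁ k₂, ‖p‖ ≤ R → ‖p + r‖ ≤ R →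
            C₁ * ‖r‖ ^ 2 ≤
              SemiDiscrete.cost G k₁ k₂ θ (W.1 + Q) F lam (p + r)
                - SemiDiscrete.cost G k₁ k₂ θ (W.1 + Q) F lam p
                - inner ℝ (J' p) r) ∧
          StrictConvexOn ℝ (Metric.closedBall (0 : SemiDiscrete.HK₀ G k₁ k₂) R)
            (SemiDiscrete.cost G k₁ k₂ θ (W.1 + Q) F lam)) := by
  obtain ⟨lam₀, hlam₀, hcarleman, h⟩ := theorem7p3_general G
  refine ⟨lam₀, hlam₀, hcarleman, fun k₁ k₂ _ hk θ hθ R _ normF normV => ?_⟩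
  obtain ⟨hmeas, habs⟩ := SemiDiscrete.measurable_and_abs_le_of_eq_one_or_id hθ
  obtain ⟨lam₁, hlam₁, C₁, hC₁, h⟩ := h k₁ k₂ hk _ R normF normV
  exact ⟨lam₁, hlam₁, C₁, hC₁, fun δ hδ hδ_lt _ _ _ _ Q Qs Vs _ hQs hQ hVs hlap hnormV
    _ _ _ _ F Fs _ _ hF hnormF => h θ hmeas habs δ hδ hδ_lt Q Qs Vs hQ (hVs.sub_mem hQs) hlap
      hnormV.le F Fs hF hnormF.le⟩
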